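/- Let $n\ge 1$ and let $q\in\mathbb C^\times$ not be a root of unity. Let $\alpha_i=\epsilon_i-\epsilon_{i+1}$ ($1\le i<n$) and $\alpha_n=\epsilon_n$, where $(\epsilon_i,\epsilon_j)=\delta_{ij}$, and $a_{ij}=2(\alpha_i,\alpha_j)/(\alpha_i,\alpha_i)$. Let $U_q=U_q(\mathrm{osp}(1|2n))$ be the $\mathbb Z_2$-graded associative $\mathbb C$-algebra with generators $k_i^{\pm1},e_i,f_i$ ($1\le i\le n$), where $e_n,f_n$ are odd and all other generators are even, and relations $$k_ik_i^{-1}=k_i^{-1}k_i=1,\quad k_ik_j=k_jk_i,\quad k_ie_j=q^{(\alpha_i,\alpha_j)}e_jk_i,\quad k_if_j=q^{-(\alpha_i,\alpha_j)}f_jk_i,$$ $$e_if_j-(-1)^{[e_i][f_j]}f_je_i=\delta_{ij}\frac{k_i-k_i^{-1}}{q-q^{-1}},\qquad (\mathrm{Ad}\,e_i)^{1-a_{ij}}(e_j)=0=(\mathrm{Ad}\,f_i)^{1-a_{ij}}(f_j)\quad(i\ne j),$$ where $\mathrm{Ad}\,e_i(x)=e_ix-(-1)^{[e_i][x]}k_ixk_i^{-1}e_i$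 and $\mathrm{Ad}\,f_i(x)=f_ix-(-1)^{[f_i][x]}k_ixk_i^{-1}f_i$. It is a $\mathbb Z_2$-graded Hopf algebra with $\Delta(k_i)=k_i\otimes k_i$, $\Delta(e_i)=e_i\otimes k_i+1\otimes e_i$, $\Delta(f_i)=f_i\otimes 1+k_i^{-1}\otimes f_i$, $\varepsilon(k_i)=1$, $\varepsilon(e_i)=\varepsilon(f_i)=0$, $S(k_i)=k_i^{-1}$, $S(e_i)=-e_ik_i^{-1}$, $S(f_i)=-k_if_i$. Let $t$ be the vector representation of $U_q$, with basis $w_\mu$, $\mu\in\{0,\pm1,\dots,\pm n\}$, $w_0$ odd and the other $w_\mu$ even, given by $$t(e_i)_{\mu\nu}=\delta_{\mu i}\delta_{\nu,i+1}+\delta_{\mu,-i-1}\delta_{\nu,-i},\quad t(f_i)_{\mu\nu}=\delta_{\mu,i+1}\delta_{\nu i}+\delta_{\mu,-i}\delta_{\nu,-i-1}\quad(i<n),$$ $$t(e_n)_{\mu\nu}=\delta_{\mu n}\delta_{\nu0}-\delta_{\mu0}\delta_{\nu,-n},\quad t(f_n)_{\mu\nu}=\delta_{\mu0}\delta_{\nu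 n}+\delta_{\mu,-n}\delta_{\nu0},\quad t(k_j)_{\mu\nu}=\delta_{\mu\nu}q^{(\alpha_j,\epsilon_\mu)},$$ with $\epsilon_0=0$, $\epsilon_{-i}=-\epsilon_i$. Let $T_q$ be the subalgebra generated by the linear forms $t_{\mu\nu}:x\mapsto t(x)_{\mu\nu}$ in the dual of $U_q$, whose multiplication is $\langle gh,x\rangle=\sum_{(x)}(-1)^{[h][x_{(1)}]}\langle g,x_{(1)}\rangle\langle h,x_{(2)}\rangle$ and whose unit is $\varepsilon$. Let $U_q$ act on $T_q$ by $\langle x\circ g,y\rangle=\langle g,yx\rangle$. Let $\Theta\subseteq\{1,\dots,n\}$, and let $U_q(\mathfrak k)\subseteq U_q$ be the subalgebra generated by all $k_i^{\pm1}$ and by the $e_j,f_j$ with $j\in\Theta$. Let $V$ be a finite-dimensional $\mathbb Z_2$-graded $U_q(\mathfrak k)$-module, and for $x\in U_q$ and $\zeta=\sum_iv_i\otimes g_i\in V\otimes T_q$ put $x\circ\zeta=\sum_i(-1)^{[x][v_i]}v_i\otimes x\circ g_i$ (here and below signs are for homogeneous elements, and formulas are extended linearly). Define $$E_q=\{g\in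 T_q\mid x\circ g=\varepsilon(x)g\ \ \forall x\in U_q(\mathfrak k)\},\qquad H_q(V)=\{\zeta\in V\otimes T_q\mid x\circ\zeta=(S(x)\otimes\mathrm{id})\zeta\ \ \forall x\in U_q(\mathfrak k)\};$$ $E_q$ is a subalgebra of $T_q$. Theorem. For $a\in E_q$ and $\zeta=\sum_iv_i\otimes g_i\in H_q(V)$ the elements $$a\zeta=\sum_i(-1)^{[a][v_i]}v_i\otimes ag_i,\qquad \zeta a=\sum_iv_i\otimes g_ia$$ of $V\otimes T_q$ belong to $H_q(V)$, and these two operations make $H_q(V)$ a two-sided $E_q$-module: a (unital) left module and a (unital) right module, with $a(\zeta b)=(a\zeta)b$ for all $a,b\in E_q$. -/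

import Mathlib

open scoped TensorProduct

namespace QOsp

/-! ## Root data -/

/-- The simple root `α_i = ε_i - ε_{i+1}` for `i < n`, `α_n = ε_n`, in coordinates with respect to
the orthonormal basis `ε`.  The index set `{1, …, n}` is `Fin n`, shifted by one. -/
def simpleRoot {n : ℕ} (i : Fin n) : Fin n → ℤ :=
  fun a => if a = i then 1 else if a.val = i.val + 1 then -1 else 0

/-- The inner product `(α_i, α_j)`. -/
def form {n : ℕ} (i j : Fin n) : ℤ := simpleRoot i ⬝ᵥ simpleRoot j

/-- The Cartan matrix `a_{ij} = 2 (α_i, α_j) / (α_i, α_i)` (the division is exact). -/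
def cartan {n : ℕ} (i j : Fin n) : ℤ := 2 * form i j / form i i

/-- The only odd simple root is the last one. -/
def IsOdd {n : ℕ} (i : Fin n) : Prop := i.val + 1 = n

instance {n : ℕ} (i : Fin n) : Decidable (IsOdd i) := inferInstanceAs (Decidable (i.val + 1 = n))

/-- The sign `(-1)^{[e_i]}`. -/
def sgn {n : ℕ} (i : Fin n) : ℂ := if IsOdd i then -1 else 1

/-- The Koszul sign `(-1)^{[e_i][f_j]}`. -/
def koszul {n : ℕ} (i j : Fin n) : ℂ := if IsOdd i ∧ IsOdd j then -1 else 1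

/-! ## The quantum superalgebra -/

/-- The generators `k_i`, `k_i⁻¹`, `e_i`, `f_i`. -/
inductive Gen (n : ℕ) : Type
  | k (i : Fin n)
  | kinv (i : Fin n)
  | e (i : Fin n)
  | f (i : Fin n)

/-- The free algebra on the generators. -/
abbrev Free (n : ℕ) : Type := FreeAlgebra ℂ (Gen n)

/-- The sign `(-1)^{[g]}` of a generator `g`. -/
def Gen.sign {n : ℕ} : Gen n → ℂ
  | .k _ => 1
  | .kinv _ => 1
  | .e i => sgn i
  | .f i => sgn i

/-- The parity automorphism `x ↦ (-1)^{[x]} x` of the free algebra. -/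
noncomputable def freeParity (n : ℕ) : Free n →ₐ[ℂ] Free n :=
  FreeAlgebra.lift ℂ fun g => g.sign • FreeAlgebra.ι ℂ g

/-- `x ↦ (-1)^{[e_i][x]} x` on the free algebra. -/
noncomputable def freeTwist {n : ℕ} (i : Fin n) (x : Free n) : Free n :=
  if IsOdd i then freeParity n x else x

section FreeGens

variable {n : ℕ}

/-- The generator `k_i` of the free algebra. -/
noncomputable def fk (i : Fin n) : Free n := FreeAlgebra.ι ℂ (Gen.k i)
/-- The generator `k_i⁻¹` of the free algebra. -/
noncomputable def fkinv (i : Fin n) : Free n := FreeAlgebra.ι ℂ (Gen.kinv i)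
/-- The generator `e_i` of the free algebra. -/
noncomputable def fe (i : Fin n) : Free n := FreeAlgebra.ι ℂ (Gen.e i)
/-- The generator `f_i` of the free algebra. -/
noncomputable def ff (i : Fin n) : Free n := FreeAlgebra.ι ℂ (Gen.f i)

/-- `Ad e_i (x) = e_i x - (-1)^{[e_i][x]} k_i x k_i⁻¹ e_i`. -/
noncomputable def adE (i : Fin n) (x : Free n) : Free n :=
  fe i * x - fk i * freeTwist i x * fkinv i * fe i

/-- `Ad f_i (x) = f_i x - (-1)^{[f_i][x]} k_i x k_i⁻¹ f_i`. -/
noncomputable def adF (i : Fin n) (x : Free n) : Free n :=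
  ff i * x - fk i * freeTwist i x * fkinv i * ff i

end FreeGens

/-- The defining relations of `U_q(osp(1|2n))`.  In the relation for the graded commutator
`[e_i, f_j} = δ_{ij} (k_i - k_i⁻¹) / (q - q⁻¹)` the denominator has been cleared. -/
inductive Rel (n : ℕ) (q : ℂˣ) : Free n → Free n → Prop
  | k_kinv (i : Fin n) : Rel n q (fk i * fkinv i) 1
  | kinv_k (i : Fin n) : Rel n q (fkinv i * fk i) 1
  | k_k (i j : Fin n) : Rel n q (fk i * fk j) (fk j * fk i)
  | k_e (i j : Fin n) : Rel n q (fk i * fe j) (((q ^ form i j : ℂˣ) : ℂ) • (fe j * fk i))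
  | k_f (i j : Fin n) : Rel n q (fk i * ff j) (((q ^ (-form i j) : ℂˣ) : ℂ) • (ff j * fk i))
  | e_f (i j : Fin n) : Rel n q
      (((q : ℂ) - (q : ℂ)⁻¹) • (fe i * ff j - koszul i j • (ff j * fe i)))
      (if i = j then fk i - fkinv i else 0)
  | serre_e (i j : Fin n) (h : i ≠ j) : Rel n q ((adE i)^[(1 - cartan i j).toNat] (fe j)) 0
  | serre_f (i j : Fin n) (h : i ≠ j) : Rel n q ((adF i)^[(1 - cartan i j).toNat] (ff j)) 0

/-- The quantum superalgebra `U_q(osp(1|2n))`, as an algebra. -/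
def Uq (n : ℕ) (q : ℂˣ) : Type := RingQuot (Rel n q)

noncomputable instance (n : ℕ) (q : ℂˣ) : Ring (Uq n q) := inferInstanceAs (Ring (RingQuot (Rel n q)))
noncomputable instance (n : ℕ) (q : ℂˣ) : Algebra ℂ (Uq n q) :=
  inferInstanceAs (Algebra ℂ (RingQuot (Rel n q)))

/-- The projection from the free algebra. -/
noncomputable def toUq (n : ℕ) (q : ℂˣ) : Free n →ₐ[ℂ] Uq n q := RingQuot.mkAlgHom ℂ (Rel n q)

section Gens

variable {n : ℕ} (q : ℂˣ)

/-- The generator `k_i` of `U_q`. -/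
noncomputable def k (i : Fin n) : Uq n q := toUq n q (fk i)
/-- The generator `k_i⁻¹` of `U_q`. -/
noncomputable def kinv (i : Fin n) : Uq n q := toUq n q (fkinv i)
/-- The generator `e_i` of `U_q`. -/
noncomputable def e (i : Fin n) : Uq n q := toUq n q (fe i)
/-- The generator `f_i` of `U_q`. -/
noncomputable def f (i : Fin n) : Uq n q := toUq n q (ff i)

end Gens

/-! ### Explicit form of the relations, and the universal property -/

section Explicit

variable {B : Type*} [Ring B] [Algebra ℂ B]

/-- The cubic Serre polynomial. -/
noncomputable def serreTwo (c : ℂ) (x y : B) : B :=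
  x * x * y - (c + c⁻¹) • (x * y * x) + y * x * x

/-- The quartic Serre polynomial of the odd simple root. -/
noncomputable def serreThree (c : ℂ) (x y : B) : B :=
  x * x * x * y + (1 - (c + c⁻¹)) • (x * x * y * x) + (1 - (c + c⁻¹)) • (x * y * x * x)
    + y * x * x * x

end Explicit

/-- Adjacency of nodes in the Dynkin diagram. -/
def Adj {n : ℕ} (i j : Fin n) : Prop := i.val + 1 = j.val ∨ j.val + 1 = i.val

instance {n : ℕ} (i j : Fin n) : Decidable (Adj i j) :=
  inferInstanceAs (Decidable (i.val + 1 = j.val ∨ j.val + 1 = i.val))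

lemma simpleRoot_eq {n : ℕ} (i : Fin n) : simpleRoot i =
    Pi.single i 1 - (if h : i.val + 1 < n then Pi.single ⟨i.val + 1, h⟩ 1 else 0) := by
  funext a
  have := a.2
  have := i.2
  by_cases h : i.val + 1 < n <;>
    simp only [simpleRoot, h, dite_true, dite_false, Pi.sub_apply, Pi.single_apply, Fin.ext_iff,
      Pi.zero_apply] <;> split_ifs <;> omega

lemma form_eq {n : ℕ} (i j : Fin n) : form i j =
    if i = j then (if IsOdd i then 1 else 2) else if i.val + 1 = j.val ∨ j.val + 1 = i.val then -1
      else 0 := by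
  have := i.2
  have := j.2
  unfold form
  rw [simpleRoot_eq i, sub_dotProduct, single_dotProduct]
  by_cases h : i.val + 1 < n
  · simp only [h, dite_true, single_dotProduct, simpleRoot, Fin.ext_iff, IsOdd]
    split_ifs <;> omega
  · simp only [h, dite_false, zero_dotProduct, simpleRoot, Fin.ext_iff, IsOdd]
    split_ifs <;> omega

lemma form_comm {n : ℕ} (i j : Fin n) : form i j = form j i := dotProduct_comm _ _

/-- Elements of an algebra that satisfy the relations of `U_q`, in explicit form. -/
structure Datum (n : ℕ) (q : ℂˣ) (B : Type*) [Ring B] [Algebra ℂ B] where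
  K : Fin n → B
  L : Fin n → B
  E : Fin n → B
  F : Fin n → B
  KL : ∀ i, K i * L i = 1
  LK : ∀ i, L i * K i = 1
  KK : ∀ i j, K i * K j = K j * K i
  KE : ∀ i j, K i * E j = ((q ^ form i j : ℂˣ) : ℂ) • (E j * K i)
  KF : ∀ i j, K i * F j = ((q ^ (-form i j) : ℂˣ) : ℂ) • (F j * K i)
  EF : ∀ i j, ((q : ℂ) - (q : ℂ)⁻¹) • (E i * F j - koszul i j • (F j * E i)) =
    if i = j then K i - L i else 0
  EE : ∀ i j, i ≠ j → ¬ Adj i j → E i * E j = E j * E i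
  EEE : ∀ i j, ¬ IsOdd i → Adj i j → serreTwo (q : ℂ) (E i) (E j) = 0
  EEEE : ∀ i j, IsOdd i → Adj i j → serreThree (q : ℂ) (E i) (E j) = 0
  FF : ∀ i j, i ≠ j → ¬ Adj i j → F i * F j = F j * F i
  FFF : ∀ i j, ¬ IsOdd i → Adj i j → serreTwo (q : ℂ) (F i) (F j) = 0
  FFFF : ∀ i j, IsOdd i → Adj i j → serreThree (q : ℂ) (F i) (F j) = 0

section AdExpand

variable {n : ℕ} {q : ℂˣ} {B : Type*} [Ring B] [Algebra ℂ B]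

lemma conj_mul {K L x y : B} {a b : ℂ} (h : L * K = 1) (hx : K * x * L = a • x)
    (hy : K * y * L = b • y) : K * (x * y) * L = (a * b) • (x * y) := by
  have : K * (x * y) * L = (K * x * L) * (K * y * L) := by
    calc K * (x * y) * L = K * x * 1 * y * L := by noncomm_ring
      _ = _ := by rw [← h]; noncomm_ring
  rw [this, hx, hy, smul_mul_smul_comm]

lemma conj_ad {K L E x : B} {a b d : ℂ} (h : L * K = 1) (hE : K * E * L = a • E)
    (hx : K * x * L = b • x) :
    K * (E * x - d • (x * E)) * L = (a * b) • (E * x - d • (x * E)) := by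
  rw [mul_sub, sub_mul, conj_mul h hE hx, mul_smul_comm, smul_mul_assoc, conj_mul h hx hE,
    smul_sub, smul_smul, smul_smul, mul_comm b a, mul_comm d]


/-- Bookkeeping for iterated adjoint operations: `X` has parity sign `s`, image `x` and
`K`-weight `b`. -/
def AdState (φ : Free n →ₐ[ℂ] B) (K L : B) (X : Free n) (x : B) (b s : ℂ) : Prop :=
  freeParity n X = s • X ∧ φ X = x ∧ K * x * L = b • x

lemma freeParity_k (i : Fin n) : freeParity n (fk i) = fk i := by
  simp [freeParity, fk, Gen.sign]
lemma freeParity_kinv (i : Fin n) : freeParity n (fkinv i) = fkinv i := by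
  simp [freeParity, fkinv, Gen.sign]
lemma freeParity_e (i : Fin n) : freeParity n (fe i) = sgn i • fe i := by
  simp [freeParity, fe, Gen.sign]
lemma freeParity_f (i : Fin n) : freeParity n (ff i) = sgn i • ff i := by
  simp [freeParity, ff, Gen.sign]

lemma adState_step {φ : Free n →ₐ[ℂ] B} {i : Fin n} {K L E : B} (hK : φ (fk i) = K)
    (hL : φ (fkinv i) = L) (h : L * K = 1) {G : Free n} (hG : φ G = E)
    (hGp : freeParity n G = sgn i • G) {a : ℂ} (hE : K * E * L = a • E)
    {X : Free n} {x : B} {b s : ℂ} (hX : AdState φ K L X x b s) :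
    AdState φ K L (G * X - fk i * freeTwist i X * fkinv i * G)
      (E * x - ((if IsOdd i then s else 1) * b) • (x * E)) (a * b) (sgn i * s) := by
  obtain ⟨h1, h2, h3⟩ := hX
  have ht : freeTwist i X = (if IsOdd i then s else 1) • X := by
    unfold freeTwist
    split_ifs
    · exact h1
    · rw [one_smul]
  refine ⟨?_, ?_, conj_ad h hE h3⟩
  · rw [ht, map_sub, map_mul, map_mul, map_mul, map_mul, map_smul, h1, hGp, freeParity_k,
      freeParity_kinv]
    simp only [smul_mul_assoc, mul_smul_comm, smul_sub, smul_smul]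
    congr 2 <;> ac_rfl
  · rw [ht, map_sub, map_mul, map_mul, map_mul, map_mul, map_smul, hG, hK, hL, h2]
    simp only [smul_mul_assoc, mul_smul_comm]
    rw [h3, smul_mul_assoc, smul_smul]

lemma cartan_zero {i j : Fin n} (hij : i ≠ j) (h : ¬ Adj i j) : (1 - cartan i j).toNat = 1 := by
  have : form i j = 0 := by
    unfold Adj at h
    rw [form_eq, if_neg hij, if_neg h]
  simp [cartan, this]

lemma form_adj {i j : Fin n} (h : Adj i j) : form i j = -1 := by
  unfold Adj at h
  have hij : i ≠ j := by rintro rfl; omega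
  rw [form_eq, if_neg hij, if_pos h]

lemma cartan_even {i j : Fin n} (hi : ¬ IsOdd i) (h : Adj i j) : (1 - cartan i j).toNat = 2 := by
  simp [cartan, form_adj h, form_eq i i, hi]

lemma cartan_odd {i j : Fin n} (hi : IsOdd i) (h : Adj i j) : (1 - cartan i j).toNat = 3 := by
  simp [cartan, form_adj h, form_eq i i, hi]

lemma Adj.not_odd {i j : Fin n} (h : Adj i j) (hi : IsOdd i) : ¬ IsOdd j := by
  unfold Adj at h
  unfold IsOdd at *
  omega

/-- The iterated adjoint operation in terms of the explicit Serre polynomials.  Here `c` is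
`q` for the `e_i` and `q⁻¹` for the `f_i`. -/
lemma ad_iter {φ : Free n →ₐ[ℂ] B} {i j : Fin n} {K L E E' : B} (hK : φ (fk i) = K)
    (hL : φ (fkinv i) = L) (h : L * K = 1) {G G' : Free n} (hG : φ G = E) (hG' : φ G' = E')
    (hGp : freeParity n G = sgn i • G) (hGp' : freeParity n G' = sgn j • G')
    (c : ℂˣ) (hE : K * E * L = ((c ^ form i i : ℂˣ) : ℂ) • E)
    (hE' : K * E' * L = ((c ^ form i j : ℂˣ) : ℂ) • E') (hij : i ≠ j) :
    φ ((fun X => G * X - fk i * freeTwist i X * fkinv i * G)^[(1 - cartan i j).toNat] G') =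
      if Adj i j then (if IsOdd i then serreThree (c : ℂ) E E' else serreTwo (c : ℂ) E E')
      else E * E' - E' * E := by
  have hc : (c : ℂ) ≠ 0 := c.ne_zero
  have s0 : AdState φ K L G' E' _ _ := ⟨hGp', hG', hE'⟩
  have s1 := adState_step hK hL h hG hGp hE s0
  by_cases ha : Adj i j
  · rw [if_pos ha]
    by_cases hi : IsOdd i
    · have s2 := adState_step hK hL h hG hGp hE s1
      have s3 := adState_step hK hL h hG hGp hE s2
      rw [cartan_odd hi ha, if_pos hi]
      refine s3.2.1.trans ?_
      rw [form_adj ha, form_eq i i]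
      simp only [serreThree, sgn, hi, ha.not_odd hi, if_true, if_false, zpow_neg, zpow_one,
        Units.val_inv_eq_inv_val, mul_sub, sub_mul, smul_mul_assoc, mul_smul_comm, mul_assoc,
        smul_sub, smul_smul]
      match_scalars <;> field_simp <;> ring
    · have s2 := adState_step hK hL h hG hGp hE s1
      rw [cartan_even hi ha, if_neg hi]
      refine s2.2.1.trans ?_
      rw [form_adj ha, form_eq i i]
      have e2 : ((c ^ (2 : ℤ) : ℂˣ) : ℂ) = (c : ℂ) ^ 2 := by norm_cast
      simp only [serreTwo, hi, if_true, if_false, zpow_neg, zpow_one, e2,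
        Units.val_inv_eq_inv_val, mul_sub, sub_mul, smul_mul_assoc, mul_smul_comm, mul_assoc,
        smul_sub, smul_smul]
      match_scalars <;> field_simp
      ring
  · rw [cartan_zero hij ha, if_neg ha]
    refine s1.2.1.trans ?_
    have : form i j = 0 := by
      unfold Adj at ha
      rw [form_eq, if_neg hij, if_neg ha]
    have hs : (if IsOdd i then sgn j else 1) = 1 := by
      unfold sgn
      split_ifs with h1 h2
      · exact absurd (Fin.ext (by unfold IsOdd at *; omega)) hij
      · rfl
      · rfl
    rw [this, hs, zpow_zero, Units.val_one, mul_one, one_smul]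

end AdExpand

namespace Datum

variable {n : ℕ} {q : ℂˣ} {B : Type*} [Ring B] [Algebra ℂ B] (D : Datum n q B)

/-- The images of the generators. -/
def gen : Gen n → B
  | .k i => D.K i
  | .kinv i => D.L i
  | .e i => D.E i
  | .f i => D.F i

lemma conj_of {K L x : B} {a : ℂ} (h : K * L = 1) (hx : K * x = a • (x * K)) :
    K * x * L = a • x := by
  rw [hx, smul_mul_assoc, mul_assoc, h, mul_one]

lemma serreTwo_inv (c : ℂˣ) (x y : B) :
    serreTwo ((c⁻¹ : ℂˣ) : ℂ) x y = serreTwo (c : ℂ) x y := by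
  simp only [serreTwo, Units.val_inv_eq_inv_val, inv_inv, add_comm ((c : ℂ)⁻¹)]

lemma serreThree_inv (c : ℂˣ) (x y : B) :
    serreThree ((c⁻¹ : ℂˣ) : ℂ) x y = serreThree (c : ℂ) x y := by
  simp only [serreThree, Units.val_inv_eq_inv_val, inv_inv, add_comm ((c : ℂ)⁻¹)]

lemma rel ⦃X Y : Free n⦄ (h : Rel n q X Y) :
    FreeAlgebra.lift ℂ D.gen X = FreeAlgebra.lift ℂ D.gen Y := by
  have hk : ∀ i, FreeAlgebra.lift ℂ D.gen (fk i) = D.K i := fun i => by simp [fk, gen]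
  have hl : ∀ i, FreeAlgebra.lift ℂ D.gen (fkinv i) = D.L i := fun i => by simp [fkinv, gen]
  have he : ∀ i, FreeAlgebra.lift ℂ D.gen (fe i) = D.E i := fun i => by simp [fe, gen]
  have hf : ∀ i, FreeAlgebra.lift ℂ D.gen (ff i) = D.F i := fun i => by simp [ff, gen]
  cases h with
  | k_kinv i => rw [map_mul, map_one, hk, hl, D.KL]
  | kinv_k i => rw [map_mul, map_one, hk, hl, D.LK]
  | k_k i j => rw [map_mul, map_mul, hk, hk, D.KK]
  | k_e i j => rw [map_mul, map_smul, map_mul, hk, he, D.KE]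
  | k_f i j => rw [map_mul, map_smul, map_mul, hk, hf, D.KF]
  | e_f i j =>
    rw [map_smul, map_sub, map_mul, map_smul, map_mul, he, hf, D.EF]
    split_ifs
    · rw [map_sub, hk, hl]
    · rw [map_zero]
  | serre_e i j hij =>
    rw [map_zero]
    refine (ad_iter (hk i) (hl i) (D.LK i) (he i) (he j) (freeParity_e i) (freeParity_e j) q
      (conj_of (D.KL i) (D.KE i i)) (conj_of (D.KL i) (D.KE i j)) hij).trans ?_
    split_ifs with h1 h2
    · exact D.EEEE i j h2 h1
    · exact D.EEE i j h2 h1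
    · exact sub_eq_zero.2 (D.EE i j hij h1)
  | serre_f i j hij =>
    rw [map_zero]
    refine (ad_iter (hk i) (hl i) (D.LK i) (hf i) (hf j) (freeParity_f i) (freeParity_f j) q⁻¹
      (conj_of (D.KL i) ?_) (conj_of (D.KL i) ?_) hij).trans ?_
    · rw [inv_zpow']; exact D.KF i i
    · rw [inv_zpow']; exact D.KF i j
    rw [serreTwo_inv, serreThree_inv]
    split_ifs with h1 h2
    · exact D.FFFF i j h2 h1
    · exact D.FFF i j h2 h1
    · exact sub_eq_zero.2 (D.FF i j hij h1)

/-- The algebra homomorphism out of `U_q` with given values on the generators. -/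
noncomputable def lift : Uq n q →ₐ[ℂ] B :=
  RingQuot.liftAlgHom ℂ ⟨FreeAlgebra.lift ℂ D.gen, D.rel⟩

lemma lift_toUq (X : Free n) : D.lift (toUq n q X) = FreeAlgebra.lift ℂ D.gen X :=
  RingQuot.liftAlgHom_mkAlgHom_apply ℂ _ _ _

@[simp] lemma lift_k (i : Fin n) : D.lift (k q i) = D.K i := by simp [k, lift_toUq, fk, gen]
@[simp] lemma lift_kinv (i : Fin n) : D.lift (kinv q i) = D.L i := by
  simp [kinv, lift_toUq, fkinv, gen]
@[simp] lemma lift_e (i : Fin n) : D.lift (e q i) = D.E i := by simp [e, lift_toUq, fe, gen]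
@[simp] lemma lift_f (i : Fin n) : D.lift (f q i) = D.F i := by simp [f, lift_toUq, ff, gen]

end Datum

section

variable {n : ℕ} {q : ℂˣ}

/-- `U_q` is generated by the `k_i`, `k_i⁻¹`, `e_i`, `f_i`. -/
lemma adjoin_gens : Algebra.adjoin ℂ (Set.range fun g : Gen n => toUq n q (FreeAlgebra.ι ℂ g)) = ⊤ := by
  have h : (fun g : Gen n => toUq n q (FreeAlgebra.ι ℂ g)) = toUq n q ∘ FreeAlgebra.ι ℂ := rfl
  rw [h, Set.range_comp, ← AlgHom.map_adjoin, FreeAlgebra.adjoin_range_ι, Algebra.map_top,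
    AlgHom.range_eq_top]
  exact RingQuot.mkAlgHom_surjective ℂ _

/-- Two homomorphisms out of `U_q` agree if they agree on the generators. -/
lemma hom_ext {B : Type*} [Ring B] [Algebra ℂ B] {φ ψ : Uq n q →ₐ[ℂ] B}
    (hk : ∀ i, φ (k q i) = ψ (k q i)) (hl : ∀ i, φ (kinv q i) = ψ (kinv q i))
    (he : ∀ i, φ (e q i) = ψ (e q i)) (hf : ∀ i, φ (f q i) = ψ (f q i)) : φ = ψ := by
  refine AlgHom.ext_of_adjoin_eq_top adjoin_gens ?_
  rintro _ ⟨g, rfl⟩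
  cases g with
  | k i => exact hk i
  | kinv i => exact hl i
  | e i => exact he i
  | f i => exact hf i

variable (n q) in
/-- The generators of `U_q` satisfy the explicit relations. -/
noncomputable def univ : Datum n q (Uq n q) :=
  have rl : ∀ {X Y : Free n}, Rel n q X Y → toUq n q X = toUq n q Y :=
    fun h => RingQuot.mkAlgHom_rel ℂ h
  have hKL : ∀ i : Fin n, k q i * kinv q i = 1 := fun i => by
    simpa only [map_mul, map_one, k, kinv] using rl (Rel.k_kinv i)
  have hLK : ∀ i : Fin n, kinv q i * k q i = 1 := fun i => by
    simpa only [map_mul, map_one, k, kinv] using rl (Rel.kinv_k i)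
  have hKE : ∀ i j : Fin n, k q i * e q j = ((q ^ form i j : ℂˣ) : ℂ) • (e q j * k q i) :=
    fun i j => by simpa only [map_mul, map_smul, k, e, f] using rl (Rel.k_e i j)
  have hKF : ∀ i j : Fin n, k q i * f q j = ((q ^ (-form i j) : ℂˣ) : ℂ) • (f q j * k q i) :=
    fun i j => by simpa only [map_mul, map_smul, k, e, f] using rl (Rel.k_f i j)
  have hE : ∀ i j : Fin n, i ≠ j → (if Adj i j then (if IsOdd i then
      serreThree (q : ℂ) (e q i) (e q j) else serreTwo (q : ℂ) (e q i) (e q j))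
      else e q i * e q j - e q j * e q i) = 0 := fun i j hij => by
    refine (ad_iter (φ := toUq n q) rfl rfl (hLK i) rfl rfl (freeParity_e i) (freeParity_e j) q
      (Datum.conj_of (hKL i) (hKE i i)) (Datum.conj_of (hKL i) (hKE i j)) hij).symm.trans ?_
    exact (rl (Rel.serre_e i j hij)).trans (map_zero _)
  have hF : ∀ i j : Fin n, i ≠ j → (if Adj i j then (if IsOdd i then
      serreThree (q : ℂ) (f q i) (f q j) else serreTwo (q : ℂ) (f q i) (f q j))
      else f q i * f q j - f q j * f q i) = 0 := fun i j hij => by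
    rw [← Datum.serreTwo_inv, ← Datum.serreThree_inv]
    refine (ad_iter (φ := toUq n q) rfl rfl (hLK i) rfl rfl (freeParity_f i) (freeParity_f j) q⁻¹
      (Datum.conj_of (hKL i) ?_) (Datum.conj_of (hKL i) ?_) hij).symm.trans ?_
    · rw [inv_zpow']; exact hKF i i
    · rw [inv_zpow']; exact hKF i j
    · exact (rl (Rel.serre_f i j hij)).trans (map_zero _)
  { K := k q
    L := kinv q
    E := e q
    F := f q
    KL := hKL
    LK := hLK
    KK := fun i j => by simpa only [map_mul, k] using rl (Rel.k_k i j)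
    KE := hKE
    KF := hKF
    EF := fun i j => by
      have := rl (Rel.e_f (q := q) i j)
      rw [apply_ite (toUq n q)] at this
      simpa only [map_smul, map_sub, map_mul, map_zero, k, kinv, e, f] using this
    EE := fun i j hij h => by
      have := hE i j hij
      rw [if_neg h] at this
      exact sub_eq_zero.1 this
    EEE := fun i j h h' => by
      have := hE i j (by rintro rfl; unfold Adj at h'; omega)
      rwa [if_pos h', if_neg h] at this
    EEEE := fun i j h h' => by
      have := hE i j (by rintro rfl; unfold Adj at h'; omega)
      rwa [if_pos h', if_pos h] at this
    FF := fun i j hij h => by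
      have := hF i j hij
      rw [if_neg h] at this
      exact sub_eq_zero.1 this
    FFF := fun i j h h' => by
      have := hF i j (by rintro rfl; unfold Adj at h'; omega)
      rwa [if_pos h', if_neg h] at this
    FFFF := fun i j h h' => by
      have := hF i j (by rintro rfl; unfold Adj at h'; omega)
      rwa [if_pos h', if_pos h] at this }

end

/-! ### The `ℤ/2`-grading -/

section Grading

variable (n : ℕ) (q : ℂˣ)

lemma sgn_mul_self {n : ℕ} (i : Fin n) : sgn i * sgn i = 1 := by
  unfold sgn; split_ifs <;> norm_num

section

variable {B : Type*} [Ring B] [Algebra ℂ B]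

lemma serreTwo_smul (c a b : ℂ) (x y : B) :
    serreTwo c (a • x) (b • y) = (a * a * b) • serreTwo c x y := by
  simp only [serreTwo, smul_mul_assoc, mul_smul_comm, smul_smul, smul_add, smul_sub]
  match_scalars <;> ring

lemma serreThree_smul (c a b : ℂ) (x y : B) :
    serreThree c (a • x) (b • y) = (a * a * a * b) • serreThree c x y := by
  simp only [serreThree, smul_mul_assoc, mul_smul_comm, smul_smul, smul_add]
  match_scalars <;> ring

end

/-- Multiplying the odd generators by `-1`. -/
noncomputable def parityDatum : Datum n q (Uq n q) :=
  { K := k q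
    L := kinv q
    E := fun i => sgn i • e q i
    F := fun i => sgn i • f q i
    KL := (univ n q).KL
    LK := (univ n q).LK
    KK := (univ n q).KK
    KE := fun i j => by
      rw [mul_smul_comm, smul_mul_assoc, smul_comm]; exact congrArg _ ((univ n q).KE i j)
    KF := fun i j => by
      rw [mul_smul_comm, smul_mul_assoc, smul_comm]; exact congrArg _ ((univ n q).KF i j)
    EF := fun i j => by
      have h := (univ n q).EF i j
      have : ((q : ℂ) - (q : ℂ)⁻¹) • (sgn i • e q i * sgn j • f q j
          - koszul i j • (sgn j • f q j * sgn i • e q i)) = (sgn i * sgn j) •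
          (((q : ℂ) - (q : ℂ)⁻¹) • (e q i * f q j - koszul i j • (f q j * e q i))) := by
        simp only [smul_mul_assoc, mul_smul_comm, smul_smul, smul_sub]
        match_scalars <;> ring
      rw [this]
      refine (congrArg _ h).trans ?_
      split_ifs with hij
      · subst hij
        rw [sgn_mul_self, one_smul]
        rfl
      · rw [smul_zero]
    EE := fun i j h h' => by
      rw [smul_mul_smul_comm, smul_mul_smul_comm, mul_comm (sgn j)]
      exact congrArg _ ((univ n q).EE i j h h')
    EEE := fun i j h h' => by
      rw [serreTwo_smul]
      exact (congrArg _ ((univ n q).EEE i j h h')).trans (smul_zero _)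
    EEEE := fun i j h h' => by
      rw [serreThree_smul]
      exact (congrArg _ ((univ n q).EEEE i j h h')).trans (smul_zero _)
    FF := fun i j h h' => by
      rw [smul_mul_smul_comm, smul_mul_smul_comm, mul_comm (sgn j)]
      exact congrArg _ ((univ n q).FF i j h h')
    FFF := fun i j h h' => by
      rw [serreTwo_smul]
      exact (congrArg _ ((univ n q).FFF i j h h')).trans (smul_zero _)
    FFFF := fun i j h h' => by
      rw [serreThree_smul]
      exact (congrArg _ ((univ n q).FFFF i j h h')).trans (smul_zero _) }

/-- The parity automorphism `x ↦ (-1)^{[x]} x` of `U_q`. -/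
noncomputable def parity : Uq n q →ₐ[ℂ] Uq n q := (parityDatum n q).lift

variable {n q} in
@[simp] lemma parity_k (i : Fin n) : parity n q (k q i) = k q i := Datum.lift_k _ i
variable {n q} in
@[simp] lemma parity_kinv (i : Fin n) : parity n q (kinv q i) = kinv q i := Datum.lift_kinv _ i
variable {n q} in
@[simp] lemma parity_e (i : Fin n) : parity n q (e q i) = sgn i • e q i := Datum.lift_e _ i
variable {n q} in
@[simp] lemma parity_f (i : Fin n) : parity n q (f q i) = sgn i • f q i := Datum.lift_f _ i

lemma parity_comp : (parity n q).comp (parity n q) = AlgHom.id ℂ _ := by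
  apply hom_ext <;> intro i <;> simp [smul_smul, sgn_mul_self]

variable {n q} in
@[simp] lemma parity_parity (x : Uq n q) : parity n q (parity n q x) = x :=
  AlgHom.congr_fun (parity_comp n q) x

/-- The sign `(-1)^i` for `i : ZMod 2`. -/
def eps (i : ZMod 2) : ℂ := if i = 0 then 1 else -1

lemma eps_mul_self (i : ZMod 2) : eps i * eps i = 1 := by
  unfold eps; split_ifs <;> norm_num

@[simp] lemma eps_zero : eps 0 = 1 := if_pos rfl
@[simp] lemma eps_one : eps 1 = -1 := if_neg one_ne_zero

lemma zmod_two_cases (i : ZMod 2) : i = 0 ∨ i = 1 := by revert i; decide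

lemma eps_add (i j : ZMod 2) : eps (i + j) = eps i * eps j := by
  have h : (1 : ZMod 2) + 1 = 0 := rfl
  obtain rfl | rfl := zmod_two_cases i <;> obtain rfl | rfl := zmod_two_cases j <;> simp [h]

/-- The homogeneous component of degree `i` of `U_q`: the span of the monomials in the generators
whose number of odd factors is congruent to `i`, in other words the eigenspace of the parity
automorphism for the eigenvalue `(-1)^i`. -/
noncomputable def grade (i : ZMod 2) : Submodule ℂ (Uq n q) :=
  LinearMap.ker ((parity n q).toLinearMap - eps i • LinearMap.id)

variable {n q} in
lemma mem_grade {i : ZMod 2} {x : Uq n q} : x ∈ grade n q i ↔ parity n q x = eps i • x := by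
  simp [grade, sub_eq_zero]

/-- The projection of `U_q` to its component of degree `i`. -/
noncomputable def part (i : ZMod 2) : Uq n q →ₗ[ℂ] Uq n q :=
  (1 / 2 : ℂ) • (LinearMap.id + eps i • (parity n q).toLinearMap)

variable {n q} in
lemma part_apply (i : ZMod 2) (x : Uq n q) :
    part n q i x = (1 / 2 : ℂ) • (x + eps i • parity n q x) := rfl

variable {n q} in
lemma part_mem (i : ZMod 2) (x : Uq n q) : part n q i x ∈ grade n q i := by
  rw [mem_grade, part_apply, map_smul, map_add, map_smul, parity_parity, smul_comm (eps i),
    smul_add (eps i), smul_smul, eps_mul_self, one_smul, add_comm]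

variable {n q} in
lemma part_add (x : Uq n q) : part n q 0 x + part n q 1 x = x := by
  rw [part_apply, part_apply]
  simp only [eps, if_true, one_ne_zero, if_false]
  module

variable {n q} in
lemma part_of_mem {i : ZMod 2} (j : ZMod 2) {x : Uq n q} (h : x ∈ grade n q i) :
    part n q j x = if j = i then x else 0 := by
  rw [mem_grade] at h
  rw [part_apply, h]
  obtain rfl | rfl := zmod_two_cases i <;> obtain rfl | rfl := zmod_two_cases j <;> simp <;> module

noncomputable instance : DirectSum.Decomposition (grade n q) :=
  DirectSum.Decomposition.ofLinearMap _
    (DirectSum.lof ℂ (ZMod 2) (fun i => grade n q i) 0 ∘ₗ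
        (part n q 0).codRestrict (grade n q 0) (part_mem 0) +
      DirectSum.lof ℂ (ZMod 2) (fun i => grade n q i) 1 ∘ₗ
        (part n q 1).codRestrict (grade n q 1) (part_mem 1))
    (by
      ext x
      simp [part_add])
    (by
      ext i x : 2
      have h0 : (part n q 0).codRestrict (grade n q 0) (part_mem 0) x =
          if h : i = 0 then h ▸ x else 0 := by
        apply Subtype.ext
        rw [LinearMap.codRestrict_apply, part_of_mem 0 x.2]
        obtain rfl | rfl := zmod_two_cases i <;> simp
      have h1 : (part n q 1).codRestrict (grade n q 1) (part_mem 1) x =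
          if h : i = 1 then h ▸ x else 0 := by
        apply Subtype.ext
        rw [LinearMap.codRestrict_apply, part_of_mem 1 x.2]
        obtain rfl | rfl := zmod_two_cases i <;> simp
      simp only [LinearMap.comp_apply, LinearMap.add_apply, DirectSum.coeLinearMap_lof, h0, h1]
      obtain rfl | rfl := zmod_two_cases i <;> simp)

noncomputable instance : GradedAlgebra (grade n q) where
  one_mem := by rw [mem_grade, map_one]; simp [eps]
  mul_mem i j x y hx hy := by
    rw [mem_grade] at *
    rw [map_mul, hx, hy, smul_mul_smul_comm, eps_add]

end Grading


/-! ### Additivity of the Serre relations on `q`-commuting summands -/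

section SerreAdd

variable {B : Type*} [Ring B] [Algebra ℂ B]

lemma serreTwo_add {c : ℂ} (hc : c ≠ 0) {x y x' y' : B} (hx : serreTwo c x x' = 0)
    (hy : serreTwo c y y' = 0) (h1 : y * x = (c⁻¹ * c⁻¹) • (x * y)) (h2 : y * x' = c • (x' * y))
    (h3 : y' * x = c • (x * y')) : serreTwo c (x + y) (x' + y') = 0 := by
  have g1 : ∀ z, y * (x * z) = (c⁻¹ * c⁻¹) • (x * (y * z)) := fun z => by
    rw [← mul_assoc, h1, smul_mul_assoc, mul_assoc]
  have g2 : ∀ z, y * (x' * z) = c • (x' * (y * z)) := fun z => by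
    rw [← mul_assoc, h2, smul_mul_assoc, mul_assoc]
  have g3 : ∀ z, y' * (x * z) = c • (x * (y' * z)) := fun z => by
    rw [← mul_assoc, h3, smul_mul_assoc, mul_assoc]
  suffices h : serreTwo c (x + y) (x' + y') = serreTwo c x x' + serreTwo c y y' by
    rw [h, hx, hy, add_zero]
  simp only [serreTwo, add_mul, mul_add, mul_assoc, h1, h2, h3, g1, g2, g3, mul_smul_comm, smul_mul_assoc,
    smul_smul]
  match_scalars <;> field_simp <;> ring

lemma serreThree_add {c : ℂ} (hc : c ≠ 0) {x y x' y' : B} (hx : serreThree c x x' = 0)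
    (hy : serreThree c y y' = 0) (h1 : y * x = (-c⁻¹) • (x * y)) (h2 : y * x' = c • (x' * y))
    (h3 : y' * x = c • (x * y')) : serreThree c (x + y) (x' + y') = 0 := by
  have g1 : ∀ z, y * (x * z) = (-c⁻¹) • (x * (y * z)) := fun z => by
    rw [← mul_assoc, h1, smul_mul_assoc, mul_assoc]
  have g2 : ∀ z, y * (x' * z) = c • (x' * (y * z)) := fun z => by
    rw [← mul_assoc, h2, smul_mul_assoc, mul_assoc]
  have g3 : ∀ z, y' * (x * z) = c • (x * (y' * z)) := fun z => by
    rw [← mul_assoc, h3, smul_mul_assoc, mul_assoc]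
  suffices h : serreThree c (x + y) (x' + y') = serreThree c x x' + serreThree c y y' by
    rw [h, hx, hy, add_zero]
  simp only [serreThree, add_mul, mul_add, mul_assoc, h1, h2, h3, g1, g2, g3, mul_smul_comm, smul_mul_assoc,
    smul_smul]
  match_scalars <;> field_simp <;> ring

end SerreAdd


/-! ### The co-multiplication -/

section Comul

variable {n : ℕ} {q : ℂˣ}

/-- The degree `[e_i] = [f_i]`. -/
def deg (i : Fin n) : ZMod 2 := if IsOdd i then 1 else 0

lemma sgn_eq (i : Fin n) : sgn i = eps (deg i) := by
  unfold sgn deg; split_ifs <;> simp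

lemma k_mem (i : Fin n) : k q i ∈ grade n q 0 := by simp [mem_grade]
lemma kinv_mem (i : Fin n) : kinv q i ∈ grade n q 0 := by simp [mem_grade]
lemma one_mem_grade : (1 : Uq n q) ∈ grade n q 0 := by simp [mem_grade]
lemma e_mem (i : Fin n) : e q i ∈ grade n q (deg i) := by simp [mem_grade, sgn_eq]
lemma f_mem (i : Fin n) : f q i ∈ grade n q (deg i) := by simp [mem_grade, sgn_eq]

lemma mul_mem_zero {x y : Uq n q} (hx : x ∈ grade n q 0) (hy : y ∈ grade n q 0) :
    x * y ∈ grade n q 0 := by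
  rw [mem_grade] at *
  rw [map_mul, hx, hy, smul_mul_smul_comm, eps_mul_self, eps_zero]

variable (n q) in
/-- The graded tensor product `U_q ⊗ U_q`, with multiplication
`(a ⊗ b) (c ⊗ d) = (-1)^{[b][c]} a c ⊗ b d`. -/
abbrev UU : Type := grade n q ᵍ⊗[ℂ] grade n q

/-- The sign `(-1)^{i j}` for `i j : ZMod 2`. -/
def ksign (i j : ZMod 2) : ℂ := if i = 1 ∧ j = 1 then -1 else 1

lemma koszul_eq (i j : Fin n) : koszul i j = ksign (deg i) (deg j) := by
  unfold koszul ksign deg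
  by_cases hi : IsOdd i <;> by_cases hj : IsOdd j <;> simp [hi, hj]

lemma ksign_zero_left (i : ZMod 2) : ksign 0 i = 1 := by simp [ksign]
lemma ksign_zero_right (i : ZMod 2) : ksign i 0 = 1 := by simp [ksign]

lemma tmul_mul {i j : ZMod 2} {a b c d : Uq n q} (hb : b ∈ grade n q i) (hc : c ∈ grade n q j) :
    (a ᵍ⊗ₜ[ℂ] b * c ᵍ⊗ₜ[ℂ] d : UU n q) = ksign i j • ((a * c) ᵍ⊗ₜ[ℂ] (b * d)) := by
  refine (GradedTensorProduct.tmul_coe_mul_coe_tmul (grade n q) (grade n q) a ⟨b, hb⟩ ⟨c, hc⟩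
    d).trans ?_
  obtain rfl | rfl := zmod_two_cases i <;> obtain rfl | rfl := zmod_two_cases j <;>
    simp [ksign]

lemma tmul_mul_left {a b c d : Uq n q} (hb : b ∈ grade n q 0) {j : ZMod 2}
    (hc : c ∈ grade n q j) :
    (a ᵍ⊗ₜ[ℂ] b * c ᵍ⊗ₜ[ℂ] d : UU n q) = (a * c) ᵍ⊗ₜ[ℂ] (b * d) := by
  rw [tmul_mul hb hc, ksign_zero_left, one_smul]

lemma tmul_mul_right {a b c d : Uq n q} {i : ZMod 2} (hb : b ∈ grade n q i)
    (hc : c ∈ grade n q 0) :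
    (a ᵍ⊗ₜ[ℂ] b * c ᵍ⊗ₜ[ℂ] d : UU n q) = (a * c) ᵍ⊗ₜ[ℂ] (b * d) := by
  rw [tmul_mul hb hc, ksign_zero_right, one_smul]

lemma smul_tmul (r : ℂ) (a b : Uq n q) :
    ((r • a) ᵍ⊗ₜ[ℂ] b : UU n q) = r • (a ᵍ⊗ₜ[ℂ] b) := by
  simp [GradedTensorProduct.tmul, ← TensorProduct.smul_tmul']

lemma tmul_smul (r : ℂ) (a b : Uq n q) :
    (a ᵍ⊗ₜ[ℂ] (r • b) : UU n q) = r • (a ᵍ⊗ₜ[ℂ] b) := by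
  simp [GradedTensorProduct.tmul]

lemma add_tmul (a a' b : Uq n q) :
    ((a + a') ᵍ⊗ₜ[ℂ] b : UU n q) = a ᵍ⊗ₜ[ℂ] b + a' ᵍ⊗ₜ[ℂ] b := by
  simp [GradedTensorProduct.tmul, TensorProduct.add_tmul]

lemma tmul_add (a b b' : Uq n q) :
    (a ᵍ⊗ₜ[ℂ] (b + b') : UU n q) = a ᵍ⊗ₜ[ℂ] b + a ᵍ⊗ₜ[ℂ] b' := by
  simp [GradedTensorProduct.tmul, TensorProduct.tmul_add]

lemma sub_tmul (a a' b : Uq n q) :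
    ((a - a') ᵍ⊗ₜ[ℂ] b : UU n q) = a ᵍ⊗ₜ[ℂ] b - a' ᵍ⊗ₜ[ℂ] b := by
  simp [GradedTensorProduct.tmul, TensorProduct.sub_tmul]

lemma tmul_sub (a b b' : Uq n q) :
    (a ᵍ⊗ₜ[ℂ] (b - b') : UU n q) = a ᵍ⊗ₜ[ℂ] b - a ᵍ⊗ₜ[ℂ] b' := by
  simp [GradedTensorProduct.tmul, TensorProduct.tmul_sub]

lemma zero_tmul (b : Uq n q) : ((0 : Uq n q) ᵍ⊗ₜ[ℂ] b : UU n q) = 0 := by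
  simp [GradedTensorProduct.tmul]

lemma tmul_zero (b : Uq n q) : (b ᵍ⊗ₜ[ℂ] (0 : Uq n q) : UU n q) = 0 := by
  simp [GradedTensorProduct.tmul]

/-! Commutation rules among the generators of `U_q`. -/

lemma k_comm (i j : Fin n) : k q i * k q j = k q j * k q i := (univ n q).KK i j
lemma k_kinv (i : Fin n) : k q i * kinv q i = 1 := (univ n q).KL i
lemma kinv_k (i : Fin n) : kinv q i * k q i = 1 := (univ n q).LK i
lemma k_e (i j : Fin n) : k q i * e q j = ((q ^ form i j : ℂˣ) : ℂ) • (e q j * k q i) :=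
  (univ n q).KE i j
lemma k_f (i j : Fin n) : k q i * f q j = ((q ^ (-form i j) : ℂˣ) : ℂ) • (f q j * k q i) :=
  (univ n q).KF i j

lemma kinv_of {i : Fin n} {x : Uq n q} {z : ℂˣ} (h : k q i * x = (z : ℂ) • (x * k q i)) :
    kinv q i * x = ((z⁻¹ : ℂˣ) : ℂ) • (x * kinv q i) := by
  have : (z : ℂ) • (kinv q i * x) = x * kinv q i := by
    calc (z : ℂ) • (kinv q i * x) = kinv q i * ((z : ℂ) • (x * k q i)) * kinv q i := by
          rw [mul_smul_comm, smul_mul_assoc, mul_assoc, mul_assoc, k_kinv, mul_one]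
      _ = kinv q i * k q i * x * kinv q i := by rw [← h]; simp only [mul_assoc]
      _ = _ := by rw [kinv_k, one_mul]
  rw [← this, smul_smul, Units.inv_mul, one_smul]

lemma kinv_k_comm (i j : Fin n) : kinv q i * k q j = k q j * kinv q i := by
  have := kinv_of (q := q) (i := i) (x := k q j) (z := 1) (by simpa using k_comm i j)
  simpa using this

lemma kinv_comm (i j : Fin n) : kinv q i * kinv q j = kinv q j * kinv q i := by
  have := kinv_of (q := q) (i := i) (x := kinv q j) (z := 1)
    (by simpa using (kinv_k_comm j i).symm)
  simpa using this

lemma kinv_e (i j : Fin n) : kinv q i * e q j = ((q ^ (-form i j) : ℂˣ) : ℂ) • (e q j * kinv q i) := by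
  rw [zpow_neg]; exact kinv_of (k_e i j)

lemma kinv_f (i j : Fin n) : kinv q i * f q j = ((q ^ form i j : ℂˣ) : ℂ) • (f q j * kinv q i) := by
  have := kinv_of (k_f (q := q) i j)
  rwa [zpow_neg, inv_inv] at this

/-- Two distinct simple roots are not both odd. -/
lemma ksign_ne {i j : Fin n} (h : i ≠ j) : ksign (deg i) (deg j) = 1 := by
  unfold ksign deg
  by_cases hi : IsOdd i <;> by_cases hj : IsOdd j <;> simp [hi, hj]
  exact absurd (Fin.ext (by unfold IsOdd at *; omega)) h

/-- `y_i x_j` against `x_j y_i` for the summands `x_j = e_j ⊗ k_j`, `y_i = 1 ⊗ e_i` of `Δ(e)`. -/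
lemma e_swap (i j : Fin n) :
    ((1 : Uq n q) ᵍ⊗ₜ[ℂ] e q i * e q j ᵍ⊗ₜ[ℂ] k q j : UU n q) =
      (ksign (deg i) (deg j) * ((q ^ (-form i j) : ℂˣ) : ℂ)) •
        (e q j ᵍ⊗ₜ[ℂ] k q j * (1 : Uq n q) ᵍ⊗ₜ[ℂ] e q i) := by
  rw [tmul_mul (e_mem i) (e_mem j), tmul_mul_left (k_mem j) one_mem_grade, one_mul, mul_one, k_e,
    tmul_smul, smul_smul, form_comm j i, mul_assoc, ← Units.val_mul, ← zpow_add, neg_add_cancel,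
    zpow_zero, Units.val_one, mul_one]

/-- `y_i x_j` against `x_j y_i` for the summands `x_j = f_j ⊗ 1`, `y_i = k_i⁻¹ ⊗ f_i` of `Δ(f)`. -/
lemma f_swap (i j : Fin n) :
    (kinv q i ᵍ⊗ₜ[ℂ] f q i * f q j ᵍ⊗ₜ[ℂ] (1 : Uq n q) : UU n q) =
      (ksign (deg i) (deg j) * ((q ^ form i j : ℂˣ) : ℂ)) •
        (f q j ᵍ⊗ₜ[ℂ] (1 : Uq n q) * kinv q i ᵍ⊗ₜ[ℂ] f q i) := by
  rw [tmul_mul (f_mem i) (f_mem j), tmul_mul_left one_mem_grade (kinv_mem i), one_mul, mul_one,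
    kinv_f, smul_tmul, smul_smul]

/-- Serre relations for `e_i ⊗ g_i` (or `f_i ⊗ g_i`) with commuting even `g_i`. -/
lemma serreTwo_tmul_left {c : ℂ} {x y g h : Uq n q} {i j : ZMod 2} (hx : x ∈ grade n q i)
    (hy : y ∈ grade n q j) (hg : g ∈ grade n q 0) (hh : h ∈ grade n q 0) (hgh : g * h = h * g)
    (hs : serreTwo c x y = 0) :
    serreTwo c (x ᵍ⊗ₜ[ℂ] g : UU n q) (y ᵍ⊗ₜ[ℂ] h) = 0 := by
  have h1 : g * h * g = g * g * h := by rw [mul_assoc, ← hgh, mul_assoc]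
  have h2 : h * g * g = g * g * h := by rw [← hgh, h1]
  rw [serreTwo, tmul_mul_left hg hx, tmul_mul_left hg hy, tmul_mul_left hh hx,
    tmul_mul_left (mul_mem_zero hg hg) hy, tmul_mul_left (mul_mem_zero hg hh) hx,
    tmul_mul_left (mul_mem_zero hh hg) hx, h1, h2, ← smul_tmul, ← sub_tmul, ← add_tmul]
  exact (congrArg (fun z => (z ᵍ⊗ₜ[ℂ] (g * g * h) : UU n q)) hs).trans (zero_tmul _)

lemma serreThree_tmul_left {c : ℂ} {x y g h : Uq n q} {i j : ZMod 2} (hx : x ∈ grade n q i)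
    (hy : y ∈ grade n q j) (hg : g ∈ grade n q 0) (hh : h ∈ grade n q 0) (hgh : g * h = h * g)
    (hs : serreThree c x y = 0) :
    serreThree c (x ᵍ⊗ₜ[ℂ] g : UU n q) (y ᵍ⊗ₜ[ℂ] h) = 0 := by
  have h1 : g * g * h * g = g * g * g * h := by simp only [mul_assoc, ← hgh]
  have h2' : g * h * g = g * g * h := by rw [mul_assoc, ← hgh, mul_assoc]
  have h2 : g * h * g * g = g * g * g * h := by rw [h2', h1]
  have h3 : h * g * g * g = g * g * g * h := by rw [← hgh, h2]
  have m1 := mul_mem_zero hg hg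
  have m2 := mul_mem_zero hg hh
  have m3 := mul_mem_zero hh hg
  rw [serreThree, tmul_mul_left hg hx, tmul_mul_left hg hy, tmul_mul_left hh hx,
    tmul_mul_left m1 hx, tmul_mul_left m1 hy, tmul_mul_left m2 hx, tmul_mul_left m3 hx,
    tmul_mul_left (mul_mem_zero m1 hg) hy, tmul_mul_left (mul_mem_zero m1 hh) hx,
    tmul_mul_left (mul_mem_zero m2 hg) hx, tmul_mul_left (mul_mem_zero m3 hg) hx, h1, h2, h3,
    ← smul_tmul, ← smul_tmul, ← add_tmul, ← add_tmul, ← add_tmul]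
  exact (congrArg (fun z => (z ᵍ⊗ₜ[ℂ] (g * g * g * h) : UU n q)) hs).trans (zero_tmul _)

/-- Serre relations for `g_i ⊗ e_i` (or `g_i ⊗ f_i`) with commuting even `g_i`. -/
lemma serreTwo_tmul_right {c : ℂ} {x y g h : Uq n q} {i j : ZMod 2} (hx : x ∈ grade n q i)
    (hy : y ∈ grade n q j) (hg : g ∈ grade n q 0) (hh : h ∈ grade n q 0) (hgh : g * h = h * g)
    (hs : serreTwo c x y = 0) :
    serreTwo c (g ᵍ⊗ₜ[ℂ] x : UU n q) (h ᵍ⊗ₜ[ℂ] y) = 0 := by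
  have h1 : g * h * g = g * g * h := by rw [mul_assoc, ← hgh, mul_assoc]
  have h2 : h * g * g = g * g * h := by rw [← hgh, h1]
  have mm : ∀ {a b : Uq n q} {i j : ZMod 2}, a ∈ grade n q i → b ∈ grade n q j →
      a * b ∈ grade n q (i + j) := fun ha hb => SetLike.mul_mem_graded ha hb
  rw [serreTwo, tmul_mul_right hx hg, tmul_mul_right hx hh, tmul_mul_right hy hg,
    tmul_mul_right (mm hx hx) hh, tmul_mul_right (mm hx hy) hg,
    tmul_mul_right (mm hy hx) hg, h1, h2, ← tmul_smul, ← tmul_sub, ← tmul_add]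
  exact (congrArg (fun z => ((g * g * h) ᵍ⊗ₜ[ℂ] z : UU n q)) hs).trans (tmul_zero _)

lemma serreThree_tmul_right {c : ℂ} {x y g h : Uq n q} {i j : ZMod 2} (hx : x ∈ grade n q i)
    (hy : y ∈ grade n q j) (hg : g ∈ grade n q 0) (hh : h ∈ grade n q 0) (hgh : g * h = h * g)
    (hs : serreThree c x y = 0) :
    serreThree c (g ᵍ⊗ₜ[ℂ] x : UU n q) (h ᵍ⊗ₜ[ℂ] y) = 0 := by
  have h1 : g * g * h * g = g * g * g * h := by simp only [mul_assoc, ← hgh]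
  have h2' : g * h * g = g * g * h := by rw [mul_assoc, ← hgh, mul_assoc]
  have h2 : g * h * g * g = g * g * g * h := by rw [h2', h1]
  have h3 : h * g * g * g = g * g * g * h := by rw [← hgh, h2]
  have mm : ∀ {a b : Uq n q} {i j : ZMod 2}, a ∈ grade n q i → b ∈ grade n q j →
      a * b ∈ grade n q (i + j) := fun ha hb => SetLike.mul_mem_graded ha hb
  have m1 := mm hx hx
  have m2 := mm hx hy
  have m3 := mm hy hx
  rw [serreThree, tmul_mul_right hx hg, tmul_mul_right hx hh, tmul_mul_right hy hg,
    tmul_mul_right m1 hg, tmul_mul_right m1 hh, tmul_mul_right m2 hg, tmul_mul_right m3 hg,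
    tmul_mul_right (mm m1 hx) hh, tmul_mul_right (mm m1 hy) hg,
    tmul_mul_right (mm m2 hx) hg, tmul_mul_right (mm m3 hx) hg, h1, h2, h3,
    ← tmul_smul, ← tmul_smul, ← tmul_add, ← tmul_add, ← tmul_add]
  exact (congrArg (fun z => ((g * g * g * h) ᵍ⊗ₜ[ℂ] z : UU n q)) hs).trans (tmul_zero _)

lemma Adj.symm {i j : Fin n} (h : Adj i j) : Adj j i := Or.symm h
lemma Adj.ne {i j : Fin n} (h : Adj i j) : i ≠ j := by
  rintro rfl; unfold Adj at h; omega

lemma form_self_even {i : Fin n} (h : ¬ IsOdd i) : form i i = 2 := by simp [form_eq, h]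
lemma form_self_odd {i : Fin n} (h : IsOdd i) : form i i = 1 := by simp [form_eq, h]
lemma form_far {i j : Fin n} (h : i ≠ j) (h' : ¬ Adj i j) : form i j = 0 := by
  unfold Adj at h'; rw [form_eq, if_neg h, if_neg h']

lemma ksign_even {i : Fin n} (h : ¬ IsOdd i) (j : ZMod 2) : ksign (deg i) j = 1 := by
  simp [ksign, deg, h]
lemma ksign_odd {i : Fin n} (h : IsOdd i) : ksign (deg i) (deg i) = -1 := by
  simp [ksign, deg, h]

variable (n q) in
/-- The values of the co-multiplication on the generators:
`Δ(k_i) = k_i ⊗ k_i`, `Δ(e_i) = e_i ⊗ k_i + 1 ⊗ e_i`, `Δ(f_i) = f_i ⊗ 1 + k_i⁻¹ ⊗ f_i`. -/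
noncomputable def comulDatum : Datum n q (UU n q) :=
  { K := fun i => k q i ᵍ⊗ₜ[ℂ] k q i
    L := fun i => kinv q i ᵍ⊗ₜ[ℂ] kinv q i
    E := fun i => e q i ᵍ⊗ₜ[ℂ] k q i + 1 ᵍ⊗ₜ[ℂ] e q i
    F := fun i => f q i ᵍ⊗ₜ[ℂ] 1 + kinv q i ᵍ⊗ₜ[ℂ] f q i
    KL := fun i => by
      rw [tmul_mul_left (k_mem i) (kinv_mem i), k_kinv]; rfl
    LK := fun i => by
      rw [tmul_mul_left (kinv_mem i) (k_mem i), kinv_k]; rfl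
    KK := fun i j => by
      rw [tmul_mul_left (k_mem i) (k_mem j), tmul_mul_left (k_mem j) (k_mem i), k_comm]
    KE := fun i j => by
      rw [mul_add, add_mul, tmul_mul_left (k_mem i) (e_mem j), tmul_mul_left (k_mem i) one_mem_grade,
        tmul_mul_left (k_mem j) (k_mem i), tmul_mul_right (e_mem j) (k_mem i), k_e, smul_tmul,
        tmul_smul, k_comm i j, one_mul, mul_one, smul_add]
    KF := fun i j => by
      rw [mul_add, add_mul, tmul_mul_left (k_mem i) (f_mem j), tmul_mul_left (k_mem i) (kinv_mem j),
        tmul_mul_left one_mem_grade (k_mem i), tmul_mul_right (f_mem j) (k_mem i), k_f, smul_tmul,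
        tmul_smul, ← kinv_k_comm j i, one_mul, mul_one, smul_add]
    EF := fun i j => by
      have hq := (univ n q).EF i j
      have e1 : (e q i ᵍ⊗ₜ[ℂ] k q i + 1 ᵍ⊗ₜ[ℂ] e q i : UU n q) *
          (f q j ᵍ⊗ₜ[ℂ] 1 + kinv q j ᵍ⊗ₜ[ℂ] f q j) =
          (e q i * f q j) ᵍ⊗ₜ[ℂ] k q i + ksign (deg i) (deg j) • (f q j ᵍ⊗ₜ[ℂ] e q i) +
          (((q ^ (-form i j) : ℂˣ) : ℂ) • ((e q i * kinv q j) ᵍ⊗ₜ[ℂ] (f q j * k q i)) +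
            kinv q j ᵍ⊗ₜ[ℂ] (e q i * f q j)) := by
        rw [mul_add, add_mul, add_mul, tmul_mul_left (k_mem i) (f_mem j),
          tmul_mul (e_mem i) (f_mem j), tmul_mul_left (k_mem i) (kinv_mem j),
          tmul_mul_right (e_mem i) (kinv_mem j), k_f, tmul_smul]
        simp only [one_mul, mul_one]
      have e2 : (f q j ᵍ⊗ₜ[ℂ] 1 + kinv q j ᵍ⊗ₜ[ℂ] f q j : UU n q) *
          (e q i ᵍ⊗ₜ[ℂ] k q i + 1 ᵍ⊗ₜ[ℂ] e q i) =
          (f q j * e q i) ᵍ⊗ₜ[ℂ] k q i + f q j ᵍ⊗ₜ[ℂ] e q i +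
          (ksign (deg j) (deg i) • ((q ^ (-form i j) : ℂˣ) : ℂ) •
            ((e q i * kinv q j) ᵍ⊗ₜ[ℂ] (f q j * k q i)) +
            kinv q j ᵍ⊗ₜ[ℂ] (f q j * e q i)) := by
        rw [mul_add, add_mul, add_mul, tmul_mul_left one_mem_grade (e_mem i),
          tmul_mul_left one_mem_grade one_mem_grade,
          tmul_mul (f_mem j) (e_mem i), tmul_mul_right (f_mem j) one_mem_grade, kinv_e, smul_tmul,
          form_comm j i]
        simp only [one_mul, mul_one]
        abel
      have ks : ksign (deg i) (deg j) * ksign (deg j) (deg i) = 1 := by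
        unfold ksign
        by_cases hi : deg i = 1 <;> by_cases hj : deg j = 1 <;> simp [hi, hj]
      rw [e1, e2, koszul_eq]
      have e3 : ((q : ℂ) - (q : ℂ)⁻¹) • ((e q i * f q j) ᵍ⊗ₜ[ℂ] k q i +
          ksign (deg i) (deg j) • (f q j ᵍ⊗ₜ[ℂ] e q i) +
          (((q ^ (-form i j) : ℂˣ) : ℂ) • ((e q i * kinv q j) ᵍ⊗ₜ[ℂ] (f q j * k q i)) +
            kinv q j ᵍ⊗ₜ[ℂ] (e q i * f q j)) - ksign (deg i) (deg j) •
          ((f q j * e q i) ᵍ⊗ₜ[ℂ] k q i + f q j ᵍ⊗ₜ[ℂ] e q i +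
          (ksign (deg j) (deg i) • ((q ^ (-form i j) : ℂˣ) : ℂ) •
            ((e q i * kinv q j) ᵍ⊗ₜ[ℂ] (f q j * k q i)) +
            kinv q j ᵍ⊗ₜ[ℂ] (f q j * e q i))) : UU n q) =
          (((q : ℂ) - (q : ℂ)⁻¹) • (e q i * f q j - koszul i j • (f q j * e q i))) ᵍ⊗ₜ[ℂ] k q i +
          kinv q j ᵍ⊗ₜ[ℂ]
            (((q : ℂ) - (q : ℂ)⁻¹) • (e q i * f q j - koszul i j • (f q j * e q i))) := by
        simp only [smul_tmul, tmul_smul, sub_tmul, tmul_sub, koszul_eq]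
        simp only [smul_add, smul_smul (ksign _ _), ← mul_assoc, ks, one_mul]
        module
      refine e3.trans ?_
      have hq' : (((q : ℂ) - (q : ℂ)⁻¹) • (e q i * f q j - koszul i j • (f q j * e q i))) =
        if i = j then k q i - kinv q i else 0 := hq
      rw [hq']
      split_ifs with hij
      · subst hij
        rw [sub_tmul, tmul_sub]
        abel
      · rw [zero_tmul, tmul_zero, add_zero]
    EE := fun i j h h' => by
      have h0 := form_far h h'
      have h0' := form_far h.symm (fun H => h' H.symm)
      have hE : e q i * e q j = e q j * e q i := (univ n q).EE i j h h'
      rw [mul_add, add_mul, add_mul, mul_add, add_mul, add_mul, e_swap i j, e_swap j i,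
        ksign_ne h, ksign_ne h.symm, h0, h0', tmul_mul_left (k_mem i) (e_mem j),
        tmul_mul_left (k_mem j) (e_mem i), tmul_mul_right (e_mem i) one_mem_grade,
        tmul_mul_right (e_mem j) one_mem_grade, hE, k_comm]
      simp only [neg_zero, zpow_zero, Units.val_one, mul_one, one_smul]
      abel
    EEE := fun i j hi ha => by
      have hs : serreTwo (q : ℂ) (e q i) (e q j) = 0 := (univ n q).EEE i j hi ha
      refine serreTwo_add q.ne_zero
        (serreTwo_tmul_left (e_mem i) (e_mem j) (k_mem i) (k_mem j) (k_comm i j) hs)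
        (serreTwo_tmul_right (e_mem i) (e_mem j) one_mem_grade one_mem_grade rfl hs) ?_ ?_ ?_
      · rw [e_swap, ksign_even hi, form_self_even hi, one_mul]
        congr 1
        rw [zpow_neg, Units.val_inv_eq_inv_val, ← mul_inv]
        norm_cast
        rw [sq]
      · rw [e_swap, ksign_even hi, form_adj ha, one_mul, neg_neg, zpow_one]
      · rw [e_swap, ksign_ne ha.ne.symm, form_adj ha.symm, one_mul, neg_neg, zpow_one]
    EEEE := fun i j hi ha => by
      have hs : serreThree (q : ℂ) (e q i) (e q j) = 0 := (univ n q).EEEE i j hi ha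
      refine serreThree_add q.ne_zero
        (serreThree_tmul_left (e_mem i) (e_mem j) (k_mem i) (k_mem j) (k_comm i j) hs)
        (serreThree_tmul_right (e_mem i) (e_mem j) one_mem_grade one_mem_grade rfl hs) ?_ ?_ ?_
      · rw [e_swap, ksign_odd hi, form_self_odd hi, neg_one_mul, zpow_neg, zpow_one,
          Units.val_inv_eq_inv_val]
      · rw [e_swap, ksign_ne ha.ne, form_adj ha, one_mul, neg_neg, zpow_one]
      · rw [e_swap, ksign_ne ha.ne.symm, form_adj ha.symm, one_mul, neg_neg, zpow_one]
    FF := fun i j h h' => by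
      have h0 := form_far h h'
      have h0' := form_far h.symm (fun H => h' H.symm)
      have hF : f q i * f q j = f q j * f q i := (univ n q).FF i j h h'
      rw [mul_add, add_mul, add_mul, mul_add, add_mul, add_mul, f_swap i j, f_swap j i,
        ksign_ne h, ksign_ne h.symm, h0, h0', tmul_mul_left one_mem_grade (f_mem j),
        tmul_mul_left one_mem_grade (f_mem i), tmul_mul_right (f_mem i) (kinv_mem j),
        tmul_mul_right (f_mem j) (kinv_mem i), hF, kinv_comm]
      simp only [zpow_zero, Units.val_one, mul_one, one_smul]
      abel
    FFF := fun i j hi ha => by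
      have hs : serreTwo (q : ℂ) (f q i) (f q j) = 0 := (univ n q).FFF i j hi ha
      rw [← Datum.serreTwo_inv] at hs ⊢
      refine serreTwo_add q⁻¹.ne_zero
        (serreTwo_tmul_left (f_mem i) (f_mem j) one_mem_grade one_mem_grade rfl hs)
        (serreTwo_tmul_right (f_mem i) (f_mem j) (kinv_mem i) (kinv_mem j) (kinv_comm i j) hs)
        ?_ ?_ ?_
      · rw [f_swap, ksign_even hi, form_self_even hi, one_mul, Units.val_inv_eq_inv_val, inv_inv]
        congr 1
        norm_cast
        rw [sq]
      · rw [f_swap, ksign_even hi, form_adj ha, one_mul, zpow_neg, zpow_one]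
      · rw [f_swap, ksign_ne ha.ne.symm, form_adj ha.symm, one_mul, zpow_neg, zpow_one]
    FFFF := fun i j hi ha => by
      have hs : serreThree (q : ℂ) (f q i) (f q j) = 0 := (univ n q).FFFF i j hi ha
      rw [← Datum.serreThree_inv] at hs ⊢
      refine serreThree_add q⁻¹.ne_zero
        (serreThree_tmul_left (f_mem i) (f_mem j) one_mem_grade one_mem_grade rfl hs)
        (serreThree_tmul_right (f_mem i) (f_mem j) (kinv_mem i) (kinv_mem j) (kinv_comm i j) hs)
        ?_ ?_ ?_
      · rw [f_swap, ksign_odd hi, form_self_odd hi, neg_one_mul, zpow_one,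
          Units.val_inv_eq_inv_val, inv_inv]
      · rw [f_swap, ksign_ne ha.ne, form_adj ha, one_mul, zpow_neg, zpow_one]
      · rw [f_swap, ksign_ne ha.ne.symm, form_adj ha.symm, one_mul, zpow_neg, zpow_one] }

variable (n q) in
/-- The co-multiplication `Δ : U_q → U_q ⊗ U_q`, a homomorphism to the graded tensor product. -/
noncomputable def comul : Uq n q →ₐ[ℂ] UU n q := (comulDatum n q).lift

end Comul


/-! ### The co-unit and the antipode -/

section Antipode

variable (n : ℕ) (q : ℂˣ)

/-- The values of the co-unit on the generators: `ε(k_i) = 1`, `ε(e_i) = ε(f_i) = 0`. -/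
noncomputable def counitDatum : Datum n q ℂ :=
  { K := fun _ => 1
    L := fun _ => 1
    E := fun _ => 0
    F := fun _ => 0
    KL := fun _ => by simp
    LK := fun _ => by simp
    KK := fun _ _ => rfl
    KE := fun _ _ => by simp
    KF := fun _ _ => by simp
    EF := fun _ _ => by simp
    EE := fun _ _ _ _ => rfl
    EEE := fun _ _ _ _ => by simp [serreTwo]
    EEEE := fun _ _ _ _ => by simp [serreThree]
    FF := fun _ _ _ _ => rfl
    FFF := fun _ _ _ _ => by simp [serreTwo]
    FFFF := fun _ _ _ _ => by simp [serreThree] }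

/-- The co-unit `ε : U_q → ℂ`. -/
noncomputable def counit : Uq n q →ₐ[ℂ] ℂ := (counitDatum n q).lift

/-- The opposite superalgebra of `U_q`: the vector space `U_q` with the multiplication
`x ⋆ y = (-1)^{[x][y]} y x`. -/
def SuperOp : Type := Uq n q

noncomputable instance : AddCommGroup (SuperOp n q) := inferInstanceAs (AddCommGroup (Uq n q))
noncomputable instance : Module ℂ (SuperOp n q) := inferInstanceAs (Module ℂ (Uq n q))

/-- The identity map from `U_q` to its opposite superalgebra. -/
noncomputable def toOp : Uq n q ≃ₗ[ℂ] SuperOp n q := LinearEquiv.refl ℂ (Uq n q)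

/-- The multiplication `(-1)^{[x][y]} y x`, extended bilinearly. -/
noncomputable instance : Mul (SuperOp n q) :=
  ⟨fun x y => toOp n q ((toOp n q).symm y * part n q 0 ((toOp n q).symm x) +
    parity n q ((toOp n q).symm y) * part n q 1 ((toOp n q).symm x))⟩

variable {n q} in
lemma toOp_mul_toOp (x y : Uq n q) : toOp n q x * toOp n q y =
    toOp n q (y * part n q 0 x + parity n q y * part n q 1 x) := rfl

noncomputable instance : Ring (SuperOp n q) :=
  { (inferInstance : AddCommGroup (SuperOp n q)) with
    mul := (· * ·)
    one := toOp n q 1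
    left_distrib := fun x y z => by
      obtain ⟨x, rfl⟩ := (toOp n q).surjective x
      obtain ⟨y, rfl⟩ := (toOp n q).surjective y
      obtain ⟨z, rfl⟩ := (toOp n q).surjective z
      change toOp n q x * (toOp n q y + toOp n q z) =
        toOp n q x * toOp n q y + toOp n q x * toOp n q z
      rw [← map_add, toOp_mul_toOp, toOp_mul_toOp, toOp_mul_toOp, ← map_add]
      congr 1
      simp only [map_add, add_mul]
      abel
    right_distrib := fun x y z => by
      obtain ⟨x, rfl⟩ := (toOp n q).surjective x
      obtain ⟨y, rfl⟩ := (toOp n q).surjective y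
      obtain ⟨z, rfl⟩ := (toOp n q).surjective z
      change (toOp n q x + toOp n q y) * toOp n q z =
        toOp n q x * toOp n q z + toOp n q y * toOp n q z
      rw [← map_add, toOp_mul_toOp, toOp_mul_toOp, toOp_mul_toOp, ← map_add]
      congr 1
      simp only [map_add, mul_add]
      abel
    zero_mul := fun x => by
      obtain ⟨x, rfl⟩ := (toOp n q).surjective x
      change toOp n q 0 * toOp n q x = toOp n q 0
      rw [toOp_mul_toOp]
      simp
    mul_zero := fun x => by
      obtain ⟨x, rfl⟩ := (toOp n q).surjective x
      change toOp n q x * toOp n q 0 = toOp n q 0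
      rw [toOp_mul_toOp]
      simp
    one_mul := fun x => by
      obtain ⟨x, rfl⟩ := (toOp n q).surjective x
      change toOp n q 1 * toOp n q x = toOp n q x
      rw [toOp_mul_toOp, part_of_mem 0 one_mem_grade, part_of_mem 1 one_mem_grade]
      simp
    mul_one := fun x => by
      obtain ⟨x, rfl⟩ := (toOp n q).surjective x
      change toOp n q x * toOp n q 1 = toOp n q x
      rw [toOp_mul_toOp, map_one, one_mul, one_mul, part_add]
    mul_assoc := fun x y z => by
      obtain ⟨x, rfl⟩ := (toOp n q).surjective x
      obtain ⟨y, rfl⟩ := (toOp n q).surjective y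
      obtain ⟨z, rfl⟩ := (toOp n q).surjective z
      change toOp n q x * toOp n q y * toOp n q z = toOp n q x * (toOp n q y * toOp n q z)
      rw [toOp_mul_toOp, toOp_mul_toOp, toOp_mul_toOp, toOp_mul_toOp]
      congr 1
      simp only [part_apply, map_add, map_mul, map_smul, parity_parity, eps_zero, eps_one,
        mul_add, add_mul, smul_add, mul_smul_comm, smul_mul_assoc, smul_smul, mul_assoc, one_smul]
      module }

noncomputable instance : Algebra ℂ (SuperOp n q) :=
  Algebra.ofModule
    (fun r x y => by
      obtain ⟨x, rfl⟩ := (toOp n q).surjective x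
      obtain ⟨y, rfl⟩ := (toOp n q).surjective y
      rw [← map_smul, toOp_mul_toOp, toOp_mul_toOp, ← map_smul, map_smul, map_smul, mul_smul_comm,
        mul_smul_comm, smul_add])
    (fun r x y => by
      obtain ⟨x, rfl⟩ := (toOp n q).surjective x
      obtain ⟨y, rfl⟩ := (toOp n q).surjective y
      rw [← map_smul, toOp_mul_toOp, toOp_mul_toOp, ← map_smul, map_smul, smul_mul_assoc,
        smul_mul_assoc, smul_add])

variable {n q}

lemma toOp_one : toOp n q 1 = 1 := rfl

lemma op_mul {i j : ZMod 2} {x y : Uq n q} (hx : x ∈ grade n q i) (hy : y ∈ grade n q j) :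
    toOp n q x * toOp n q y = ksign i j • toOp n q (y * x) := by
  rw [toOp_mul_toOp, part_of_mem 0 hx, part_of_mem 1 hx, mem_grade.1 hy, ← map_smul]
  congr 1
  obtain rfl | rfl := zmod_two_cases i <;> obtain rfl | rfl := zmod_two_cases j <;>
    simp [ksign]

lemma mul_mem_grade {i j : ZMod 2} {x y : Uq n q} (hx : x ∈ grade n q i) (hy : y ∈ grade n q j) :
    x * y ∈ grade n q (i + j) := SetLike.mul_mem_graded hx hy

lemma serreTwo_op (c : ℂ) {j : ZMod 2} {x y : Uq n q} (hx : x ∈ grade n q 0)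
    (hy : y ∈ grade n q j) :
    serreTwo c (toOp n q x) (toOp n q y) = toOp n q (serreTwo c x y) := by
  have hxx := mul_mem_grade hx hx
  have hyx := mul_mem_grade hy hx
  have hxy := mul_mem_grade hx hy
  simp only [serreTwo, map_add, map_sub, map_smul]
  rw [op_mul hx hx, op_mul hx hy, op_mul hy hx]
  simp only [ksign_zero_left, ksign_zero_right, one_smul]
  rw [op_mul hxx hy, op_mul hyx hx, op_mul hxy hx]
  simp only [ksign_zero_left, ksign_zero_right, one_smul, add_zero, mul_assoc]
  abel

lemma serreThree_op (c : ℂ) {x y : Uq n q} (hx : x ∈ grade n q 1) (hy : y ∈ grade n q 0) :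
    serreThree c (toOp n q x) (toOp n q y) = -toOp n q (serreThree c x y) := by
  have h11 : (1 : ZMod 2) + 1 = 0 := rfl
  have hxx : x * x ∈ grade n q 0 := by
    simpa only [zero_add, add_zero, h11] using mul_mem_grade hx hx
  have hyx : y * x ∈ grade n q 1 := by
    simpa only [zero_add, add_zero, h11] using mul_mem_grade hy hx
  have hxy : x * y ∈ grade n q 1 := by
    simpa only [zero_add, add_zero, h11] using mul_mem_grade hx hy
  have t1 : x * (x * x) ∈ grade n q 1 := by
    simpa only [zero_add, add_zero, h11] using mul_mem_grade hx hxx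
  have t2 : y * (x * x) ∈ grade n q 0 := by
    simpa only [zero_add, add_zero, h11] using mul_mem_grade hy hxx
  have t3 : x * (y * x) ∈ grade n q 0 := by
    simpa only [zero_add, add_zero, h11] using mul_mem_grade hx hyx
  have t4 : x * (x * y) ∈ grade n q 0 := by
    simpa only [zero_add, add_zero, h11] using mul_mem_grade hx hxy
  have k11 : ksign 1 1 = -1 := by simp [ksign]
  simp only [serreThree, map_add, map_smul]
  rw [op_mul hx hx, op_mul hx hy, op_mul hy hx]
  simp only [ksign_zero_left, ksign_zero_right, one_smul, k11, smul_mul_assoc]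
  rw [op_mul hxx hx, op_mul hxx hy, op_mul hyx hx, op_mul hxy hx]
  simp only [ksign_zero_left, ksign_zero_right, one_smul, k11, smul_mul_assoc]
  rw [op_mul t1 hy, op_mul t2 hx, op_mul t3 hx, op_mul t4 hx]
  simp only [ksign_zero_left, ksign_zero_right, one_smul, mul_assoc]
  module

/-- Serre relations for `x g`, `y h` where `g`, `h` commute with `x`, `y` up to scalars. -/
lemma serreTwo_mul_right {B : Type*} [Ring B] [Algebra ℂ B] {c a b : ℂ} {x y g h : B}
    (hs : serreTwo c x y = 0) (gx : g * x = a • (x * g)) (gy : g * y = b • (y * g))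
    (hx : h * x = b • (x * h)) (hgh : h * g = g * h) : serreTwo c (x * g) (y * h) = 0 := by
  have gx' : ∀ z, g * (x * z) = a • (x * (g * z)) := fun z => by
    rw [← mul_assoc, gx, smul_mul_assoc, mul_assoc]
  have gy' : ∀ z, g * (y * z) = b • (y * (g * z)) := fun z => by
    rw [← mul_assoc, gy, smul_mul_assoc, mul_assoc]
  have hx' : ∀ z, h * (x * z) = b • (x * (h * z)) := fun z => by
    rw [← mul_assoc, hx, smul_mul_assoc, mul_assoc]
  suffices H : serreTwo c (x * g) (y * h) = (a * b * b) • (serreTwo c x y * (g * (g * h))) by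
    rw [H, hs, zero_mul, smul_zero]
  simp only [serreTwo, add_mul, sub_mul, mul_assoc, gx', gy', hx', hgh, mul_smul_comm,
    smul_mul_assoc, smul_smul, smul_add, smul_sub]
  match_scalars <;> ring

lemma serreThree_mul_right {B : Type*} [Ring B] [Algebra ℂ B] {c a b : ℂ} {x y g h : B}
    (hs : serreThree c x y = 0) (gx : g * x = a • (x * g)) (gy : g * y = b • (y * g))
    (hx : h * x = b • (x * h)) (hgh : h * g = g * h) : serreThree c (x * g) (y * h) = 0 := by
  have gx' : ∀ z, g * (x * z) = a • (x * (g * z)) := fun z => by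
    rw [← mul_assoc, gx, smul_mul_assoc, mul_assoc]
  have gy' : ∀ z, g * (y * z) = b • (y * (g * z)) := fun z => by
    rw [← mul_assoc, gy, smul_mul_assoc, mul_assoc]
  have hx' : ∀ z, h * (x * z) = b • (x * (h * z)) := fun z => by
    rw [← mul_assoc, hx, smul_mul_assoc, mul_assoc]
  suffices H : serreThree c (x * g) (y * h) =
      (a * a * a * b * b * b) • (serreThree c x y * (g * (g * (g * h)))) by
    rw [H, hs, zero_mul, smul_zero]
  simp only [serreThree, add_mul, mul_assoc, gx', gy', hx', hgh, mul_smul_comm,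
    smul_mul_assoc, smul_smul, smul_add]
  match_scalars <;> ring

lemma deg_even {i : Fin n} (h : ¬ IsOdd i) : deg i = 0 := if_neg h
lemma deg_odd {i : Fin n} (h : IsOdd i) : deg i = 1 := if_pos h

lemma sE_mem (i : Fin n) : (-1 : ℂ) • (e q i * kinv q i) ∈ grade n q (deg i) :=
  Submodule.smul_mem _ _ (by simpa using mul_mem_grade (e_mem i) (kinv_mem i))

lemma sF_mem (i : Fin n) : (-1 : ℂ) • (k q i * f q i) ∈ grade n q (deg i) :=
  Submodule.smul_mem _ _ (by simpa using mul_mem_grade (k_mem i) (f_mem i))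

lemma sF_eq (i : Fin n) : (-1 : ℂ) • (k q i * f q i) =
    (-((q ^ (-form i i) : ℂˣ) : ℂ)) • (f q i * k q i) := by
  rw [k_f, smul_smul, neg_one_mul]

variable (n q) in
/-- The values of the antipode on the generators:
`S(k_i) = k_i⁻¹`, `S(e_i) = - e_i k_i⁻¹`, `S(f_i) = - k_i f_i`. -/
noncomputable def antipodeDatum : Datum n q (SuperOp n q) :=
  { K := fun i => toOp n q (kinv q i)
    L := fun i => toOp n q (k q i)
    E := fun i => toOp n q ((-1 : ℂ) • (e q i * kinv q i))
    F := fun i => toOp n q ((-1 : ℂ) • (k q i * f q i))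
    KL := fun i => by
      rw [op_mul (kinv_mem i) (k_mem i), k_kinv, ksign_zero_left, one_smul, toOp_one]
    LK := fun i => by
      rw [op_mul (k_mem i) (kinv_mem i), kinv_k, ksign_zero_left, one_smul, toOp_one]
    KK := fun i j => by
      rw [op_mul (kinv_mem i) (kinv_mem j), op_mul (kinv_mem j) (kinv_mem i), kinv_comm]
    KE := fun i j => by
      rw [op_mul (kinv_mem i) (sE_mem j), op_mul (sE_mem j) (kinv_mem i), ksign_zero_left,
        ksign_zero_right, one_smul, one_smul, ← map_smul]
      congr 1
      rw [smul_mul_assoc, mul_smul_comm, ← mul_assoc (kinv q i), kinv_e, smul_mul_assoc,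
        smul_comm _ (-1 : ℂ), smul_smul (((q ^ form i j : ℂˣ) : ℂ)), ← Units.val_mul, ← zpow_add,
        add_neg_cancel, zpow_zero, Units.val_one, one_smul, mul_assoc, mul_assoc, kinv_comm i j]
    KF := fun i j => by
      rw [op_mul (kinv_mem i) (sF_mem j), op_mul (sF_mem j) (kinv_mem i), ksign_zero_left,
        ksign_zero_right, one_smul, one_smul, ← map_smul]
      congr 1
      rw [smul_mul_assoc, mul_smul_comm, ← mul_assoc (kinv q i), kinv_k_comm, mul_assoc (k q j),
        mul_assoc (k q j), kinv_f, mul_smul_comm,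
        smul_comm _ (-1 : ℂ), smul_smul (((q ^ (-form i j) : ℂˣ) : ℂ)), ← Units.val_mul,
        ← zpow_add, neg_add_cancel, zpow_zero, Units.val_one, one_smul]
    EF := fun i j => by
      have hq : ((q : ℂ) - (q : ℂ)⁻¹) • (e q i * f q j - koszul i j • (f q j * e q i)) =
        if i = j then k q i - kinv q i else 0 := (univ n q).EF i j
      have ks : ksign (deg i) (deg j) * ksign (deg j) (deg i) = 1 := by
        unfold ksign
        by_cases hi : deg i = 1 <;> by_cases hj : deg j = 1 <;> simp [hi, hj]
      have e1 : (k q j * f q j) * (e q i * kinv q i) =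
          ((q ^ (form i j - form j j) : ℂˣ) : ℂ) • ((f q j * e q i) * (k q j * kinv q i)) := by
        rw [k_f, smul_mul_assoc, mul_assoc (f q j), ← mul_assoc (k q j), k_e]
        simp only [smul_mul_assoc, mul_smul_comm, smul_smul, ← Units.val_mul, ← zpow_add,
          mul_assoc, form_comm j i]
        rw [neg_add_eq_sub]
      have e2 : (e q i * kinv q i) * (k q j * f q j) =
          ((q ^ (form i j - form j j) : ℂˣ) : ℂ) • ((e q i * f q j) * (k q j * kinv q i)) := by
        rw [k_f, mul_smul_comm, mul_assoc (e q i), ← mul_assoc (kinv q i), kinv_f]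
        simp only [smul_mul_assoc, mul_smul_comm, smul_smul, ← Units.val_mul, ← zpow_add,
          mul_assoc, kinv_k_comm]
        rw [neg_add_eq_sub]
      rw [op_mul (sE_mem i) (sF_mem j), op_mul (sF_mem j) (sE_mem i), koszul_eq, smul_smul, ks,
        smul_mul_smul_comm, smul_mul_smul_comm, e1, e2, ← map_smul, ← map_smul, ← map_sub,
        ← map_smul, ← map_sub]
      have e3 : ((q : ℂ) - (q : ℂ)⁻¹) • (ksign (deg i) (deg j) • (-1 * -1 : ℂ) •
          ((q ^ (form i j - form j j) : ℂˣ) : ℂ) • ((f q j * e q i) * (k q j * kinv q i)) -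
          (1 : ℂ) • (-1 * -1 : ℂ) •
          ((q ^ (form i j - form j j) : ℂˣ) : ℂ) • ((e q i * f q j) * (k q j * kinv q i))) =
          (-((q ^ (form i j - form j j) : ℂˣ) : ℂ)) •
          (((q : ℂ) - (q : ℂ)⁻¹) • (e q i * f q j - koszul i j • (f q j * e q i)) *
            (k q j * kinv q i)) := by
        simp only [smul_mul_assoc, sub_mul, koszul_eq]
        module
      rw [map_smul] at *
      rw [← map_smul]
      refine (congrArg (toOp n q) (e3.trans (congrArg _ (congrArg (· * _) hq)))).trans ?_
      split_ifs with hij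
      · subst hij
        rw [k_kinv, mul_one, sub_self, zpow_zero, Units.val_one]
        congr 1
        module
      · rw [zero_mul, smul_zero, map_zero]
    EE := fun i j h h' => by
      have h0 := form_far h h'
      have h0' := form_far h.symm (fun H => h' H.symm)
      have hE : e q i * e q j = e q j * e q i := (univ n q).EE i j h h'
      rw [op_mul (sE_mem i) (sE_mem j), op_mul (sE_mem j) (sE_mem i), ksign_ne h,
        ksign_ne h.symm, smul_mul_smul_comm, smul_mul_smul_comm, mul_assoc (e q j),
        ← mul_assoc (kinv q j), kinv_e, mul_assoc (e q i), ← mul_assoc (kinv q i), kinv_e, h0, h0']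
      simp only [neg_zero, zpow_zero, Units.val_one, one_smul, mul_assoc]
      rw [kinv_comm, ← mul_assoc, ← mul_assoc (e q i), hE]
    EEE := fun i j hi ha => by
      have hs : serreTwo (q : ℂ) (e q i) (e q j) = 0 := (univ n q).EEE i j hi ha
      rw [serreTwo_op _ (deg_even hi ▸ sE_mem i) (sE_mem j), serreTwo_smul,
        serreTwo_mul_right hs (kinv_e i i) (kinv_e i j) (form_comm i j ▸ kinv_e j i)
          (kinv_comm j i), smul_zero, map_zero]
    EEEE := fun i j hi ha => by
      have hs : serreThree (q : ℂ) (e q i) (e q j) = 0 := (univ n q).EEEE i j hi ha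
      rw [serreThree_op _ (deg_odd hi ▸ sE_mem i) (deg_even (ha.not_odd hi) ▸ sE_mem j),
        serreThree_smul,
        serreThree_mul_right hs (kinv_e i i) (kinv_e i j) (form_comm i j ▸ kinv_e j i)
          (kinv_comm j i), smul_zero, map_zero, neg_zero]
    FF := fun i j h h' => by
      have h0 := form_far h h'
      have h0' := form_far h.symm (fun H => h' H.symm)
      have hF : f q i * f q j = f q j * f q i := (univ n q).FF i j h h'
      rw [op_mul (sF_mem i) (sF_mem j), op_mul (sF_mem j) (sF_mem i), ksign_ne h,
        ksign_ne h.symm, sF_eq, sF_eq, smul_mul_smul_comm, smul_mul_smul_comm, mul_assoc (f q j),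
        ← mul_assoc (k q j), k_f, mul_assoc (f q i), ← mul_assoc (k q i), k_f, h0, h0']
      simp only [neg_zero, zpow_zero, Units.val_one, one_smul, mul_assoc]
      rw [k_comm, ← mul_assoc, ← mul_assoc (f q i), hF, neg_mul_neg, neg_mul_neg,
        mul_comm (((q ^ (-form j j) : ℂˣ) : ℂ))]
    FFF := fun i j hi ha => by
      have hs : serreTwo (q : ℂ) (f q i) (f q j) = 0 := (univ n q).FFF i j hi ha
      rw [serreTwo_op _ (deg_even hi ▸ sF_mem i) (sF_mem j), sF_eq, sF_eq, serreTwo_smul,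
        serreTwo_mul_right hs (k_f i i) (k_f i j) (form_comm i j ▸ k_f j i)
          (k_comm j i), smul_zero, map_zero]
    FFFF := fun i j hi ha => by
      have hs : serreThree (q : ℂ) (f q i) (f q j) = 0 := (univ n q).FFFF i j hi ha
      rw [serreThree_op _ (deg_odd hi ▸ sF_mem i) (deg_even (ha.not_odd hi) ▸ sF_mem j),
        sF_eq, sF_eq, serreThree_smul,
        serreThree_mul_right hs (k_f i i) (k_f i j) (form_comm i j ▸ k_f j i)
          (k_comm j i), smul_zero, map_zero, neg_zero] }

variable (n q) in
/-- The antipode `S : U_q → U_q`, the linear map with `S(x y) = (-1)^{[x][y]} S(y) S(x)` and the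
above values on the generators. -/
noncomputable def antipode : Uq n q →ₗ[ℂ] Uq n q :=
  (toOp n q).symm.toLinearMap ∘ₗ (antipodeDatum n q).lift.toLinearMap

lemma antipode_mul (x y : Uq n q) : antipode n q (x * y) =
    antipode n q y * part n q 0 (antipode n q x) +
      parity n q (antipode n q y) * part n q 1 (antipode n q x) := by
  unfold antipode
  simp only [LinearMap.comp_apply, AlgHom.toLinearMap_apply, map_mul]
  rfl

end Antipode

/-! ### The reductive subalgebra -/

section Levi

variable {n : ℕ} (q : ℂˣ) (Θ : Set (Fin n))

/-- The reductive subalgebra `U_q(𝔨)` attached to a subset `Θ` of the nodes: it is generated by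
all `k_i^{±1}` and by the `e_j`, `f_j` with `j ∈ Θ`. -/
noncomputable def Uk : Subalgebra ℂ (Uq n q) :=
  Algebra.adjoin ℂ (Set.range (k q) ∪ Set.range (kinv q) ∪ e q '' Θ ∪ f q '' Θ)

variable {q Θ}

lemma Uk_induction {P : Uq n q → Prop} (hk : ∀ i, P (k q i)) (hl : ∀ i, P (kinv q i))
    (he : ∀ i ∈ Θ, P (e q i)) (hf : ∀ i ∈ Θ, P (f q i)) (hc : ∀ r : ℂ, P (algebraMap ℂ _ r))
    (ha : ∀ x y, x ∈ Uk q Θ → y ∈ Uk q Θ → P x → P y → P (x + y))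
    (hm : ∀ x y, x ∈ Uk q Θ → y ∈ Uk q Θ → P x → P y → P (x * y)) {x : Uq n q}
    (hx : x ∈ Uk q Θ) : P x := by
  induction hx using Algebra.adjoin_induction with
  | mem x hx =>
    rcases hx with ((⟨i, rfl⟩ | ⟨i, rfl⟩) | ⟨i, hi, rfl⟩) | ⟨i, hi, rfl⟩
    exacts [hk i, hl i, he i hi, hf i hi]
  | algebraMap r => exact hc r
  | add x y hx hy h1 h2 => exact ha x y hx hy h1 h2
  | mul x y hx hy h1 h2 => exact hm x y hx hy h1 h2

lemma k_mem_Uk (i : Fin n) : k q i ∈ Uk q Θ :=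
  Algebra.subset_adjoin (Or.inl (Or.inl (Or.inl ⟨i, rfl⟩)))
lemma kinv_mem_Uk (i : Fin n) : kinv q i ∈ Uk q Θ :=
  Algebra.subset_adjoin (Or.inl (Or.inl (Or.inr ⟨i, rfl⟩)))
lemma e_mem_Uk {i : Fin n} (h : i ∈ Θ) : e q i ∈ Uk q Θ :=
  Algebra.subset_adjoin (Or.inl (Or.inr ⟨i, h, rfl⟩))
lemma f_mem_Uk {i : Fin n} (h : i ∈ Θ) : f q i ∈ Uk q Θ :=
  Algebra.subset_adjoin (Or.inr ⟨i, h, rfl⟩)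

lemma parity_mem_Uk {x : Uq n q} (hx : x ∈ Uk q Θ) : parity n q x ∈ Uk q Θ := by
  refine Uk_induction (P := fun x => parity n q x ∈ Uk q Θ) (fun i => ?_) (fun i => ?_)
    (fun i hi => ?_) (fun i hi => ?_) (fun r => ?_) (fun x y _ _ h1 h2 => ?_)
    (fun x y _ _ h1 h2 => ?_) hx
  · rw [parity_k]; exact k_mem_Uk i
  · rw [parity_kinv]; exact kinv_mem_Uk i
  · rw [parity_e]; exact Subalgebra.smul_mem _ (e_mem_Uk hi) _
  · rw [parity_f]; exact Subalgebra.smul_mem _ (f_mem_Uk hi) _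
  · rw [AlgHom.commutes]; exact Subalgebra.algebraMap_mem _ r
  · rw [map_add]; exact add_mem h1 h2
  · rw [map_mul]; exact mul_mem h1 h2

lemma part_mem_Uk (i : ZMod 2) {x : Uq n q} (hx : x ∈ Uk q Θ) : part n q i x ∈ Uk q Θ :=
  Subalgebra.smul_mem _ (add_mem hx (Subalgebra.smul_mem _ (parity_mem_Uk hx) _)) _

/-- `U_q(𝔨)` is stable under the antipode. -/
lemma antipode_mem_Uk {x : Uq n q} (hx : x ∈ Uk q Θ) : antipode n q x ∈ Uk q Θ := by
  have h1 : antipode n q 1 = 1 := by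
    unfold antipode
    simp only [LinearMap.comp_apply, AlgHom.toLinearMap_apply, map_one]
    rfl
  have hk : ∀ i, antipode n q (k q i) = kinv q i := fun i =>
    congrArg (toOp n q).symm (Datum.lift_k _ i)
  have hl : ∀ i, antipode n q (kinv q i) = k q i := fun i =>
    congrArg (toOp n q).symm (Datum.lift_kinv _ i)
  have he : ∀ i, antipode n q (e q i) = (-1 : ℂ) • (e q i * kinv q i) := fun i =>
    congrArg (toOp n q).symm (Datum.lift_e _ i)
  have hf : ∀ i, antipode n q (f q i) = (-1 : ℂ) • (k q i * f q i) := fun i =>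
    congrArg (toOp n q).symm (Datum.lift_f _ i)
  refine Uk_induction (P := fun x => antipode n q x ∈ Uk q Θ) (fun i => ?_) (fun i => ?_)
    (fun i hi => ?_) (fun i hi => ?_) (fun r => ?_) (fun x y _ _ h1 h2 => ?_)
    (fun x y _ _ h1 h2 => ?_) hx
  · rw [hk]; exact kinv_mem_Uk i
  · rw [hl]; exact k_mem_Uk i
  · rw [he]; exact Subalgebra.smul_mem _ (mul_mem (e_mem_Uk hi) (kinv_mem_Uk i)) _
  · rw [hf]; exact Subalgebra.smul_mem _ (mul_mem (k_mem_Uk i) (f_mem_Uk hi)) _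
  · rw [Algebra.algebraMap_eq_smul_one, map_smul, h1]
    exact Subalgebra.smul_mem _ (one_mem _) _
  · rw [map_add]; exact add_mem h1 h2
  · rw [antipode_mul]
    exact add_mem (mul_mem h2 (part_mem_Uk 0 h1)) (mul_mem (parity_mem_Uk h2) (part_mem_Uk 1 h1))

end Levi


/-! ### The dual superalgebra -/

section Dual

variable (n : ℕ) (q : ℂˣ)

/-- The dual space of `U_q`, to be made into an algebra by dualizing the co-multiplication. -/
def UDual : Type := Module.Dual ℂ (Uq n q)

noncomputable instance : AddCommGroup (UDual n q) :=
  inferInstanceAs (AddCommGroup (Module.Dual ℂ (Uq n q)))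
noncomputable instance : Module ℂ (UDual n q) :=
  inferInstanceAs (Module ℂ (Module.Dual ℂ (Uq n q)))

/-- The linear form underlying an element of the dual: `lin n q f x` is `⟨f, x⟩`. -/
noncomputable def lin : UDual n q ≃ₗ[ℂ] Module.Dual ℂ (Uq n q) :=
  LinearEquiv.refl ℂ (Module.Dual ℂ (Uq n q))

variable {n q}

lemma dual_ext {g h : UDual n q} (H : ∀ x, lin n q g x = lin n q h x) : g = h :=
  (lin n q).injective (LinearMap.ext H)

/-- The parity map `g ↦ (-1)^{[g]} g` of the dual, i.e. `⟨g, x⟩ ↦ ⟨g, (-1)^{[x]} x⟩`. -/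
noncomputable def dpar : UDual n q →ₗ[ℂ] UDual n q :=
  (lin n q).symm.toLinearMap ∘ₗ
    (LinearMap.lcomp ℂ ℂ (parity n q).toLinearMap) ∘ₗ (lin n q).toLinearMap

@[simp] lemma lin_dpar (g : UDual n q) (x : Uq n q) :
    lin n q (dpar g) x = lin n q g (parity n q x) := rfl

/-- The homogeneous component of degree `i` of a linear form: it agrees with the form on
`grade n q i` and vanishes on the other component. -/
noncomputable def dpart (i : ZMod 2) : UDual n q →ₗ[ℂ] UDual n q :=
  (lin n q).symm.toLinearMap ∘ₗ
    (LinearMap.lcomp ℂ ℂ (part n q i)) ∘ₗ (lin n q).toLinearMap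

@[simp] lemma lin_dpart (i : ZMod 2) (g : UDual n q) (x : Uq n q) :
    lin n q (dpart i g) x = lin n q g (part n q i x) := rfl

/-- The pairing `⟨g ⊗ h, a ⊗ b⟩ = (-1)^{[h][a]} ⟨g, a⟩ ⟨h, b⟩`. -/
noncomputable def superPair (g h : UDual n q) : UU n q →ₗ[ℂ] ℂ :=
  LinearMap.mul' ℂ ℂ ∘ₗ
    (TensorProduct.map (lin n q g) (lin n q (dpart 0 h)) +
      TensorProduct.map (lin n q (dpar g)) (lin n q (dpart 1 h))) ∘ₗ
    (GradedTensorProduct.of ℂ (grade n q) (grade n q)).symm.toLinearMap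

lemma superPair_tmul (g h : UDual n q) (a b : Uq n q) :
    superPair g h (a ᵍ⊗ₜ[ℂ] b) = lin n q g a * lin n q h (part n q 0 b) +
      lin n q g (parity n q a) * lin n q h (part n q 1 b) := by
  simp [superPair, GradedTensorProduct.tmul]

/-- The multiplication of the dual: `⟨g h, x⟩ = ⟨g ⊗ h, Δ(x)⟩`. -/
noncomputable instance : Mul (UDual n q) :=
  ⟨fun g h => (lin n q).symm (superPair g h ∘ₗ (comul n q).toLinearMap)⟩

lemma lin_mul (g h : UDual n q) (x : Uq n q) :
    lin n q (g * h) x = superPair g h (comul n q x) := rfl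

/-- The unit of the dual is the co-unit of `U_q`. -/
noncomputable instance : One (UDual n q) := ⟨(lin n q).symm (counit n q).toLinearMap⟩

@[simp] lemma lin_one (x : Uq n q) : lin n q 1 x = counit n q x := rfl

/-- The action `x ∘ g = Σ (-1)^{[g₁][g₂]} g₁ ⟨g₂, x⟩` on the dual.  Since the co-multiplication of
the dual satisfies `Σ (-1)^{[g₁][g₂]} ⟨g₁, y⟩ ⟨g₂, x⟩ = ⟨g, y x⟩`, this is right translation
`⟨x ∘ g, y⟩ = ⟨g, y x⟩`. -/
noncomputable def circ : Uq n q →ₐ[ℂ] Module.End ℂ (UDual n q) where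
  toFun x := (lin n q).symm.toLinearMap ∘ₗ
    (LinearMap.lcomp ℂ ℂ (LinearMap.mulRight ℂ x)) ∘ₗ (lin n q).toLinearMap
  map_one' := by
    ext g
    exact dual_ext fun y => congrArg (lin n q g) (mul_one y)
  map_mul' x y := by
    ext g
    exact dual_ext fun z => congrArg (lin n q g) (mul_assoc z x y).symm
  map_zero' := by
    ext g
    exact dual_ext fun y => (congrArg (lin n q g) (mul_zero y)).trans (map_zero _)
  map_add' x y := by
    ext g
    exact dual_ext fun z => (congrArg (lin n q g) (mul_add z x y)).trans (map_add _ _ _)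
  commutes' r := by
    ext g
    refine dual_ext fun y => ?_
    refine (congrArg (lin n q g) (Algebra.commutes r y).symm).trans ?_
    rw [← Algebra.smul_def, map_smul]
    rfl

@[simp] lemma lin_circ (x : Uq n q) (g : UDual n q) (y : Uq n q) :
    lin n q (circ x g) y = lin n q g (y * x) := rfl

lemma UU_induction {P : UU n q → Prop} (h : ∀ a b, P (a ᵍ⊗ₜ[ℂ] b))
    (ha : ∀ X Y, P X → P Y → P (X + Y)) (X : UU n q) : P X := by
  change P (GradedTensorProduct.of ℂ (grade n q) (grade n q)
    ((GradedTensorProduct.of ℂ (grade n q) (grade n q)).symm X))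
  induction (GradedTensorProduct.of ℂ (grade n q) (grade n q)).symm X using
    TensorProduct.induction_on with
  | zero => simpa [GradedTensorProduct.tmul] using h 0 0
  | tmul a b => exact h a b
  | add A B h1 h2 => rw [map_add]; exact ha _ _ h1 h2

lemma parity_part (i : ZMod 2) (x : Uq n q) : parity n q (part n q i x) = eps i • part n q i x :=
  mem_grade.1 (part_mem i x)

lemma part_parity (i : ZMod 2) (x : Uq n q) : part n q i (parity n q x) = eps i • part n q i x := by
  rw [← parity_part, part_apply, part_apply]
  simp

/-- `(-1)^{i [g]} g`. -/
noncomputable def dtw (i : ZMod 2) (g : UDual n q) : UDual n q := if i = 0 then g else dpar g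

lemma superPair_mul_left (g h : UDual n q) (X : UU n q) {i : ZMod 2} {x : Uq n q}
    (hx : x ∈ grade n q i) :
    superPair g h (X * x ᵍ⊗ₜ[ℂ] 1) = superPair (circ x g) h X := by
  induction X using UU_induction with
  | h a b =>
    have hb : (a ᵍ⊗ₜ[ℂ] b : UU n q) = a ᵍ⊗ₜ[ℂ] part n q 0 b + a ᵍ⊗ₜ[ℂ] part n q 1 b := by
      rw [← tmul_add, part_add]
    have z0 := part_of_mem (q := q) 0 (part_mem (q := q) 1 b)
    have z1 := part_of_mem (q := q) 1 (part_mem (q := q) 0 b)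
    have z2 := part_of_mem (q := q) 0 (part_mem (q := q) 0 b)
    have z3 := part_of_mem (q := q) 1 (part_mem (q := q) 1 b)
    rw [superPair_tmul, hb, add_mul, tmul_mul (part_mem 0 b) hx, tmul_mul (part_mem 1 b) hx, mul_one,
      mul_one, map_add, map_smul, map_smul, superPair_tmul, superPair_tmul, z0, z1, z2, z3]
    obtain rfl | rfl := zmod_two_cases i <;>
      simp [ksign, mem_grade.1 hx]
  | ha X Y h1 h2 => rw [add_mul, map_add, h1, h2, map_add]

lemma superPair_mul_right (g h : UDual n q) (X : UU n q) {i : ZMod 2} {x : Uq n q}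
    (hx : x ∈ grade n q i) :
    superPair g h (X * 1 ᵍ⊗ₜ[ℂ] x) = superPair (dtw i g) (circ x h) X := by
  induction X using UU_induction with
  | h a b =>
    have hb : (a ᵍ⊗ₜ[ℂ] b * 1 ᵍ⊗ₜ[ℂ] x : UU n q) = a ᵍ⊗ₜ[ℂ] (b * x) := by
      conv_lhs => rw [← part_add b, tmul_add, add_mul, tmul_mul_right (part_mem 0 b) one_mem_grade,
        tmul_mul_right (part_mem 1 b) one_mem_grade, ← tmul_add, ← add_mul, part_add, mul_one]
    have hp : ∀ j, part n q j (b * x) = part n q (j + i) b * x := fun j => by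
      rw [part_apply, part_apply, map_mul, mem_grade.1 hx, eps_add, smul_mul_assoc, add_mul,
        smul_mul_assoc, mul_smul_comm, smul_smul]
    have h11 : (1 : ZMod 2) + 1 = 0 := rfl
    rw [hb, superPair_tmul, superPair_tmul, hp, hp]
    obtain rfl | rfl := zmod_two_cases i
    · simp [dtw]
    · simp [dtw, h11, add_comm]
  | ha X Y h1 h2 => rw [add_mul, map_add, h1, h2, map_add]

/-- A pure tensor as a product. -/
lemma tmul_eq_mul (a b : Uq n q) : (a ᵍ⊗ₜ[ℂ] b : UU n q) = a ᵍ⊗ₜ[ℂ] 1 * 1 ᵍ⊗ₜ[ℂ] b := by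
  rw [tmul_mul_left one_mem_grade one_mem_grade, one_mul, mul_one]

lemma comul_k (i : Fin n) : comul n q (k q i) = k q i ᵍ⊗ₜ[ℂ] k q i := Datum.lift_k _ i
lemma comul_kinv (i : Fin n) : comul n q (kinv q i) = kinv q i ᵍ⊗ₜ[ℂ] kinv q i :=
  Datum.lift_kinv _ i
lemma comul_e (i : Fin n) :
    comul n q (e q i) = e q i ᵍ⊗ₜ[ℂ] k q i + 1 ᵍ⊗ₜ[ℂ] e q i := Datum.lift_e _ i
lemma comul_f (i : Fin n) :
    comul n q (f q i) = f q i ᵍ⊗ₜ[ℂ] 1 + kinv q i ᵍ⊗ₜ[ℂ] f q i := Datum.lift_f _ i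

@[simp] lemma counit_k (i : Fin n) : counit n q (k q i) = 1 := Datum.lift_k _ i
@[simp] lemma counit_kinv (i : Fin n) : counit n q (kinv q i) = 1 := Datum.lift_kinv _ i
@[simp] lemma counit_e (i : Fin n) : counit n q (e q i) = 0 := Datum.lift_e _ i
@[simp] lemma counit_f (i : Fin n) : counit n q (f q i) = 0 := Datum.lift_f _ i

lemma circ_k_mul (i : Fin n) (g h : UDual n q) :
    circ (k q i) (g * h) = circ (k q i) g * circ (k q i) h := by
  refine dual_ext fun y => ?_
  rw [lin_circ, lin_mul, map_mul, comul_k, tmul_eq_mul, ← mul_assoc,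
    superPair_mul_right _ _ _ (k_mem i), superPair_mul_left _ _ _ (k_mem i), lin_mul]
  rfl

lemma circ_kinv_mul (i : Fin n) (g h : UDual n q) :
    circ (kinv q i) (g * h) = circ (kinv q i) g * circ (kinv q i) h := by
  refine dual_ext fun y => ?_
  rw [lin_circ, lin_mul, map_mul, comul_kinv, tmul_eq_mul, ← mul_assoc,
    superPair_mul_right _ _ _ (kinv_mem i), superPair_mul_left _ _ _ (kinv_mem i), lin_mul]
  rfl

lemma circ_e_mul (i : Fin n) (g h : UDual n q) : circ (e q i) (g * h) =
    circ (e q i) g * circ (k q i) h + dtw (deg i) g * circ (e q i) h := by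
  refine dual_ext fun y => ?_
  rw [lin_circ, lin_mul, map_mul, comul_e, mul_add, map_add, tmul_eq_mul (e q i), ← mul_assoc,
    superPair_mul_right _ _ _ (k_mem i), superPair_mul_left _ _ _ (e_mem i),
    superPair_mul_right _ _ _ (e_mem i), map_add]
  rfl

lemma circ_f_mul (i : Fin n) (g h : UDual n q) : circ (f q i) (g * h) =
    circ (f q i) g * h + circ (kinv q i) (dtw (deg i) g) * circ (f q i) h := by
  refine dual_ext fun y => ?_
  rw [lin_circ, lin_mul, map_mul, comul_f, mul_add, map_add, tmul_eq_mul (kinv q i), ← mul_assoc,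
    superPair_mul_right _ _ _ (f_mem i), superPair_mul_left _ _ _ (kinv_mem i),
    superPair_mul_left _ _ _ (f_mem i), map_add]
  rfl

lemma Uq_induction {P : Uq n q → Prop} (hk : ∀ i, P (k q i)) (hl : ∀ i, P (kinv q i))
    (he : ∀ i, P (e q i)) (hf : ∀ i, P (f q i)) (hc : ∀ r : ℂ, P (algebraMap ℂ _ r))
    (ha : ∀ x y, P x → P y → P (x + y)) (hm : ∀ x y, P x → P y → P (x * y)) (x : Uq n q) : P x := by
  have hx : x ∈ Algebra.adjoin ℂ
      (Set.range fun g : Gen n => toUq n q (FreeAlgebra.ι ℂ g)) := by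
    rw [adjoin_gens]; trivial
  induction hx using Algebra.adjoin_induction with
  | mem x hx =>
    obtain ⟨g, rfl⟩ := hx
    cases g with
    | k i => exact hk i
    | kinv i => exact hl i
    | e i => exact he i
    | f i => exact hf i
  | algebraMap r => exact hc r
  | add x y _ _ h1 h2 => exact ha x y h1 h2
  | mul x y _ _ h1 h2 => exact hm x y h1 h2

/-- A subspace of the dual that is stable under the generators is stable under `U_q`. -/
lemma circ_mem_of_gens {N : Submodule ℂ (UDual n q)} (hk : ∀ i, ∀ a ∈ N, circ (k q i) a ∈ N)
    (hl : ∀ i, ∀ a ∈ N, circ (kinv q i) a ∈ N) (he : ∀ i, ∀ a ∈ N, circ (e q i) a ∈ N)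
    (hf : ∀ i, ∀ a ∈ N, circ (f q i) a ∈ N) (x : Uq n q) : ∀ a ∈ N, circ x a ∈ N := by
  refine Uq_induction (P := fun x => ∀ a ∈ N, circ x a ∈ N) hk hl he hf (fun r a ha => ?_)
    (fun x y h1 h2 a ha => ?_) (fun x y h1 h2 a ha => ?_) x
  · rw [AlgHom.commutes]; exact N.smul_mem r ha
  · rw [map_add]; exact N.add_mem (h1 a ha) (h2 a ha)
  · rw [map_mul]; exact h1 _ (h2 a ha)

/-- Two families of linear forms agree if they agree at `1` and transform in the same way under
the generators. -/
lemma eq_zero_of_span {s : Set (UDual n q)} (h1 : ∀ a ∈ s, lin n q a 1 = 0)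
    (hk : ∀ i, ∀ a ∈ s, circ (k q i) a ∈ Submodule.span ℂ s)
    (hl : ∀ i, ∀ a ∈ s, circ (kinv q i) a ∈ Submodule.span ℂ s)
    (he : ∀ i, ∀ a ∈ s, circ (e q i) a ∈ Submodule.span ℂ s)
    (hf : ∀ i, ∀ a ∈ s, circ (f q i) a ∈ Submodule.span ℂ s) {a : UDual n q} (ha : a ∈ s) :
    a = 0 := by
  have key : ∀ x : Uq n q, (∀ a ∈ s, circ x a ∈ Submodule.span ℂ s) →
      ∀ a ∈ Submodule.span ℂ s, circ x a ∈ Submodule.span ℂ s := fun x hx a ha =>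
    (Submodule.span_le (p := (Submodule.span ℂ s).comap (circ x))).2 hx ha
  have ev : ∀ a ∈ Submodule.span ℂ s, lin n q a 1 = 0 := fun a ha => by
    induction ha using Submodule.span_induction with
    | mem a ha => exact h1 a ha
    | zero => simp
    | add a b _ _ h h' => rw [map_add, LinearMap.add_apply, h, h', add_zero]
    | smul r a _ h => rw [map_smul, LinearMap.smul_apply, h, smul_zero]
  refine dual_ext fun x => ?_
  have := ev _ (circ_mem_of_gens (fun i => key _ (hk i)) (fun i => key _ (hl i))
    (fun i => key _ (he i)) (fun i => key _ (hf i)) x a (Submodule.subset_span ha))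
  rw [lin_circ, one_mul] at this
  rw [this, map_zero, LinearMap.zero_apply]

lemma lin_mul_one_apply (g h : UDual n q) : lin n q (g * h) 1 = lin n q g 1 * lin n q h 1 := by
  rw [lin_mul, map_one]
  refine (superPair_tmul g h 1 1).trans ?_
  rw [part_of_mem 0 one_mem_grade, part_of_mem 1 one_mem_grade]
  simp

lemma superPair_add_left (g g' h : UDual n q) (X : UU n q) :
    superPair (g + g') h X = superPair g h X + superPair g' h X := by
  induction X using UU_induction with
  | h a b => simp only [superPair_tmul, map_add, LinearMap.add_apply]; ring
  | ha X Y h1 h2 => rw [map_add, h1, h2, map_add, map_add]; ring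

lemma superPair_add_right (g h h' : UDual n q) (X : UU n q) :
    superPair g (h + h') X = superPair g h X + superPair g h' X := by
  induction X using UU_induction with
  | h a b => simp only [superPair_tmul, map_add, LinearMap.add_apply]; ring
  | ha X Y h1 h2 => rw [map_add, h1, h2, map_add, map_add]; ring

lemma superPair_smul_left (r : ℂ) (g h : UDual n q) (X : UU n q) :
    superPair (r • g) h X = r * superPair g h X := by
  induction X using UU_induction with
  | h a b => simp only [superPair_tmul, map_smul, LinearMap.smul_apply, smul_eq_mul]; ring
  | ha X Y h1 h2 => rw [map_add, h1, h2, map_add]; ring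

lemma superPair_smul_right (r : ℂ) (g h : UDual n q) (X : UU n q) :
    superPair g (r • h) X = r * superPair g h X := by
  induction X using UU_induction with
  | h a b => simp only [superPair_tmul, map_smul, LinearMap.smul_apply, smul_eq_mul]; ring
  | ha X Y h1 h2 => rw [map_add, h1, h2, map_add]; ring

lemma dual_add_mul (g g' h : UDual n q) : (g + g') * h = g * h + g' * h :=
  dual_ext fun x => by
    rw [map_add, LinearMap.add_apply, lin_mul, lin_mul, lin_mul, superPair_add_left]

lemma dual_mul_add (g h h' : UDual n q) : g * (h + h') = g * h + g * h' :=
  dual_ext fun x => by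
    rw [map_add, LinearMap.add_apply, lin_mul, lin_mul, lin_mul, superPair_add_right]

lemma dual_smul_mul (r : ℂ) (g h : UDual n q) : (r • g) * h = r • (g * h) :=
  dual_ext fun x => by
    rw [map_smul, LinearMap.smul_apply, lin_mul, lin_mul, superPair_smul_left, smul_eq_mul]

lemma dual_mul_smul (r : ℂ) (g h : UDual n q) : g * (r • h) = r • (g * h) :=
  dual_ext fun x => by
    rw [map_smul, LinearMap.smul_apply, lin_mul, lin_mul, superPair_smul_right, smul_eq_mul]

lemma dual_zero_mul (h : UDual n q) : 0 * h = 0 := by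
  have := dual_smul_mul 0 (0 : UDual n q) h
  rwa [zero_smul, zero_smul] at this

lemma dual_mul_zero (h : UDual n q) : h * 0 = 0 := by
  have := dual_mul_smul 0 h (0 : UDual n q)
  rwa [zero_smul, zero_smul] at this

lemma circ_one (x : Uq n q) : circ x (1 : UDual n q) = counit n q x • 1 :=
  dual_ext fun y => by
    rw [lin_circ, lin_one, map_mul, map_smul, LinearMap.smul_apply, lin_one, smul_eq_mul, mul_comm]

lemma counit_parity (x : Uq n q) : counit n q (parity n q x) = counit n q x := by
  refine AlgHom.congr_fun (φ₁ := (counit n q).comp (parity n q)) ?_ x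
  apply hom_ext <;> intro i <;> simp

@[simp] lemma dpar_one : dpar (1 : UDual n q) = 1 := dual_ext fun x => counit_parity x

lemma dtw_one (i : ZMod 2) : dtw i (1 : UDual n q) = 1 := by
  unfold dtw; split_ifs <;> simp

lemma circ_dpar (x : Uq n q) (g : UDual n q) : circ x (dpar g) = dpar (circ (parity n q x) g) :=
  dual_ext fun y => by simp

lemma dual_one_mul (g : UDual n q) : 1 * g = g := by
  have hs : ∀ x : Uq n q, (∀ g : UDual n q, circ x (1 * g) = 1 * circ x g) →
      ∀ a ∈ Set.range fun g : UDual n q => 1 * g - g, circ x a ∈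
        Submodule.span ℂ (Set.range fun g : UDual n q => 1 * g - g) := by
    rintro x hx _ ⟨g, rfl⟩
    exact Submodule.subset_span ⟨circ x g, by dsimp only; rw [map_sub, hx]⟩
  refine sub_eq_zero.1 (eq_zero_of_span (s := Set.range fun g : UDual n q => 1 * g - g) ?_
    (fun i => hs _ ?_) (fun i => hs _ ?_) (fun i => hs _ ?_) (fun i => hs _ ?_) ⟨g, rfl⟩)
  · rintro _ ⟨g, rfl⟩
    dsimp only
    rw [map_sub, LinearMap.sub_apply, lin_mul_one_apply]
    simp
  · intro g; rw [circ_k_mul, circ_one, counit_k, one_smul]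
  · intro g; rw [circ_kinv_mul, circ_one, counit_kinv, one_smul]
  · intro g; rw [circ_e_mul, circ_one, counit_e, zero_smul, dual_zero_mul, zero_add, dtw_one]
  · intro g
    rw [circ_f_mul, circ_one, counit_f, zero_smul, dual_zero_mul, zero_add, dtw_one, circ_one,
      counit_kinv, one_smul]

lemma dual_mul_one (g : UDual n q) : g * 1 = g := by
  have hs : ∀ x : Uq n q, (∀ g : UDual n q, circ x (g * 1) = circ x g * 1) →
      ∀ a ∈ Set.range fun g : UDual n q => g * 1 - g, circ x a ∈
        Submodule.span ℂ (Set.range fun g : UDual n q => g * 1 - g) := by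
    rintro x hx _ ⟨g, rfl⟩
    exact Submodule.subset_span ⟨circ x g, by dsimp only; rw [map_sub, hx]⟩
  refine sub_eq_zero.1 (eq_zero_of_span (s := Set.range fun g : UDual n q => g * 1 - g) ?_
    (fun i => hs _ ?_) (fun i => hs _ ?_) (fun i => hs _ ?_) (fun i => hs _ ?_) ⟨g, rfl⟩)
  · rintro _ ⟨g, rfl⟩
    dsimp only
    rw [map_sub, LinearMap.sub_apply, lin_mul_one_apply]
    simp
  · intro g; rw [circ_k_mul, circ_one, counit_k, one_smul]
  · intro g; rw [circ_kinv_mul, circ_one, counit_kinv, one_smul]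
  · intro g
    rw [circ_e_mul, circ_one, circ_one, counit_e, counit_k, zero_smul, dual_mul_zero, add_zero,
      one_smul]
  · intro g; rw [circ_f_mul, circ_one, counit_f, zero_smul, dual_mul_zero, add_zero]

lemma dtw_circ (i : ZMod 2) {x : Uq n q} {j : ZMod 2} (hx : x ∈ grade n q j) (g : UDual n q) :
    dtw i (circ x g) = (if i = 0 then 1 else eps j) • circ x (dtw i g) := by
  unfold dtw
  split_ifs
  · rw [one_smul]
  · rw [circ_dpar, mem_grade.1 hx, map_smul, LinearMap.smul_apply, map_smul, smul_smul,
      eps_mul_self, one_smul]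

lemma dpar_mul (g h : UDual n q) : dpar (g * h) = dpar g * dpar h := by
  set s := Set.range fun p : UDual n q × UDual n q => dpar (p.1 * p.2) - dpar p.1 * dpar p.2
    with hs
  have mem : ∀ g h : UDual n q, dpar (g * h) - dpar g * dpar h ∈ Submodule.span ℂ s :=
    fun g h => Submodule.subset_span ⟨(g, h), rfl⟩
  have dd : ∀ (i : ZMod 2) (g : UDual n q), dpar (dtw i g) = dtw i (dpar g) := fun i g => by
    unfold dtw; split_ifs <;> rfl
  refine sub_eq_zero.1 (eq_zero_of_span (s := s) ?_ ?_ ?_ ?_ ?_ ⟨(g, h), rfl⟩)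
  · rintro _ ⟨⟨g, h⟩, rfl⟩
    dsimp only
    rw [map_sub, LinearMap.sub_apply, lin_mul_one_apply, lin_dpar, map_one, lin_mul_one_apply]
    simp
  · rintro i _ ⟨⟨g, h⟩, rfl⟩
    dsimp only
    rw [map_sub, circ_k_mul, circ_dpar, circ_dpar, circ_dpar, parity_k, circ_k_mul]
    exact mem _ _
  · rintro i _ ⟨⟨g, h⟩, rfl⟩
    dsimp only
    rw [map_sub, circ_kinv_mul, circ_dpar, circ_dpar, circ_dpar, parity_kinv, circ_kinv_mul]
    exact mem _ _
  · rintro i _ ⟨⟨g, h⟩, rfl⟩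
    dsimp only
    rw [map_sub, circ_e_mul, circ_dpar, circ_dpar, circ_dpar, circ_dpar, parity_k, parity_e,
      map_smul, LinearMap.smul_apply, LinearMap.smul_apply, LinearMap.smul_apply, circ_e_mul,
      ← dd, map_smul, map_smul, map_smul, map_add, dual_smul_mul, dual_mul_smul, ← smul_add,
      ← smul_sub, add_sub_add_comm]
    exact Submodule.smul_mem _ _ (Submodule.add_mem _ (mem _ _) (mem _ _))
  · rintro i _ ⟨⟨g, h⟩, rfl⟩
    dsimp only
    rw [map_sub, circ_f_mul, ← dd, circ_dpar, circ_dpar, circ_dpar, circ_dpar, parity_kinv,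
      parity_f, map_smul, LinearMap.smul_apply, LinearMap.smul_apply, LinearMap.smul_apply,
      circ_f_mul, map_smul, map_smul, map_smul, map_add, dual_smul_mul, dual_mul_smul, ← smul_add,
      ← smul_sub, add_sub_add_comm]
    exact Submodule.smul_mem _ _ (Submodule.add_mem _ (mem _ _) (mem _ _))

lemma dtw_mul (i : ZMod 2) (g h : UDual n q) : dtw i (g * h) = dtw i g * dtw i h := by
  unfold dtw; split_ifs
  · rfl
  · exact dpar_mul g h

lemma dual_mul_assoc (g h l : UDual n q) : g * h * l = g * (h * l) := by
  set s := Set.range fun p : UDual n q × UDual n q × UDual n q =>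
    p.1 * p.2.1 * p.2.2 - p.1 * (p.2.1 * p.2.2) with hs
  have mem : ∀ g h l : UDual n q, g * h * l - g * (h * l) ∈ Submodule.span ℂ s :=
    fun g h l => Submodule.subset_span ⟨(g, h, l), rfl⟩
  refine sub_eq_zero.1 (eq_zero_of_span (s := s) ?_ ?_ ?_ ?_ ?_ ⟨(g, h, l), rfl⟩)
  · rintro _ ⟨⟨g, h, l⟩, rfl⟩
    dsimp only
    rw [map_sub, LinearMap.sub_apply, lin_mul_one_apply, lin_mul_one_apply, lin_mul_one_apply,
      lin_mul_one_apply, mul_assoc, sub_self]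
  · rintro i _ ⟨⟨g, h, l⟩, rfl⟩
    dsimp only
    rw [map_sub, circ_k_mul, circ_k_mul, circ_k_mul, circ_k_mul]
    exact mem _ _ _
  · rintro i _ ⟨⟨g, h, l⟩, rfl⟩
    dsimp only
    rw [map_sub, circ_kinv_mul, circ_kinv_mul, circ_kinv_mul, circ_kinv_mul]
    exact mem _ _ _
  · rintro i _ ⟨⟨g, h, l⟩, rfl⟩
    dsimp only
    have : circ (e q i) (g * h * l - g * (h * l)) =
        (circ (e q i) g * circ (k q i) h * circ (k q i) l -
          circ (e q i) g * (circ (k q i) h * circ (k q i) l)) +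
        (dtw (deg i) g * circ (e q i) h * circ (k q i) l -
          dtw (deg i) g * (circ (e q i) h * circ (k q i) l)) +
        (dtw (deg i) g * dtw (deg i) h * circ (e q i) l -
          dtw (deg i) g * (dtw (deg i) h * circ (e q i) l)) := by
      rw [map_sub, circ_e_mul, circ_e_mul, circ_e_mul, circ_e_mul, dtw_mul, circ_k_mul,
        dual_add_mul, dual_mul_add]
      abel
    rw [this]
    exact Submodule.add_mem _ (Submodule.add_mem _ (mem _ _ _) (mem _ _ _)) (mem _ _ _)
  · rintro i _ ⟨⟨g, h, l⟩, rfl⟩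
    dsimp only
    have : circ (f q i) (g * h * l - g * (h * l)) =
        (circ (f q i) g * h * l - circ (f q i) g * (h * l)) +
        (circ (kinv q i) (dtw (deg i) g) * circ (f q i) h * l -
          circ (kinv q i) (dtw (deg i) g) * (circ (f q i) h * l)) +
        (circ (kinv q i) (dtw (deg i) g) * circ (kinv q i) (dtw (deg i) h) * circ (f q i) l -
          circ (kinv q i) (dtw (deg i) g) *
            (circ (kinv q i) (dtw (deg i) h) * circ (f q i) l)) := by
      rw [map_sub, circ_f_mul, circ_f_mul, circ_f_mul, circ_f_mul, dtw_mul, circ_kinv_mul,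
        dual_add_mul, dual_mul_add]
      abel
    rw [this]
    exact Submodule.add_mem _ (Submodule.add_mem _ (mem _ _ _) (mem _ _ _)) (mem _ _ _)

noncomputable instance : Ring (UDual n q) :=
  { (inferInstance : AddCommGroup (UDual n q)), (inferInstance : Mul (UDual n q)),
    (inferInstance : One (UDual n q)) with
    left_distrib := dual_mul_add
    right_distrib := dual_add_mul
    zero_mul := dual_zero_mul
    mul_zero := dual_mul_zero
    mul_assoc := dual_mul_assoc
    one_mul := dual_one_mul
    mul_one := dual_mul_one }

noncomputable instance : Algebra ℂ (UDual n q) := Algebra.ofModule dual_smul_mul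
  (fun r g h => dual_mul_smul r g h)

end Dual


/-! ### The vector representation -/

section Vector

set_option linter.unusedSimpArgs false

/-- The index set `{-n, …, -1, 0, 1, …, n}` of the basis `w_μ` of the vector module. -/
abbrev Idx (n : ℕ) : Type := {μ : ℤ // μ ∈ Finset.Icc (-(n : ℤ)) n}

/-- The weight `ε_μ`, with `ε_0 = 0` and `ε_{-i} = -ε_i`. -/
def wt {n : ℕ} (μ : ℤ) : Fin n → ℤ :=
  fun a => if μ = a.val + 1 then 1 else if μ = -(a.val + 1 : ℤ) then -1 else 0

/-- The matrix with entries `δ_{μ a} δ_{ν b}`. -/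
def unitMat (n : ℕ) (a b : ℤ) : Matrix (Idx n) (Idx n) ℂ :=
  Matrix.of fun μ ν => if μ.val = a ∧ ν.val = b then 1 else 0

variable {n : ℕ} (q : ℂˣ)

/-- The matrix of `k_j`: `δ_{μ ν} q^{(α_j, ε_μ)}`. -/
noncomputable def matK (j : Fin n) : Matrix (Idx n) (Idx n) ℂ :=
  Matrix.diagonal fun μ => ((q ^ (simpleRoot j ⬝ᵥ wt μ.val) : ℂˣ) : ℂ)

/-- The matrix of `k_j⁻¹`. -/
noncomputable def matL (j : Fin n) : Matrix (Idx n) (Idx n) ℂ :=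
  Matrix.diagonal fun μ => ((q ^ (-(simpleRoot j ⬝ᵥ wt μ.val)) : ℂˣ) : ℂ)

/-- The matrix of `e_i`: `δ_{μ i} δ_{ν, i+1} + δ_{μ, -i-1} δ_{ν, -i}` for `i < n` and
`δ_{μ n} δ_{ν 0} - δ_{μ 0} δ_{ν, -n}` for `i = n` (with `i` counted from one). -/
def matE (i : Fin n) : Matrix (Idx n) (Idx n) ℂ :=
  if IsOdd i then unitMat n n 0 - unitMat n 0 (-n)
  else unitMat n (i.val + 1) (i.val + 2) + unitMat n (-(i.val + 2)) (-(i.val + 1))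

/-- The matrix of `f_i`: `δ_{μ, i+1} δ_{ν i} + δ_{μ, -i} δ_{ν, -i-1}` for `i < n` and
`δ_{μ 0} δ_{ν n} + δ_{μ, -n} δ_{ν 0}` for `i = n` (with `i` counted from one). -/
def matF (i : Fin n) : Matrix (Idx n) (Idx n) ℂ :=
  if IsOdd i then unitMat n 0 n + unitMat n (-n) 0
  else unitMat n (i.val + 2) (i.val + 1) + unitMat n (-(i.val + 1)) (-(i.val + 2))

lemma unitMat_mul (a d : ℤ) {b c : ℤ} (hb : b ∈ Finset.Icc (-(n : ℤ)) n) :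
    unitMat n a b * unitMat n c d = if b = c then unitMat n a d else 0 := by
  ext μ ν
  rw [Matrix.mul_apply, Finset.sum_eq_single ⟨b, hb⟩]
  · by_cases h : b = c <;> by_cases h1 : μ.val = a <;> by_cases h2 : ν.val = d <;>
      simp [unitMat, h, h1, h2]
  · intro σ _ hσ
    have : σ.val ≠ b := fun h => hσ (Subtype.ext h)
    simp [unitMat, this]
  · intro h; exact absurd (Finset.mem_univ _) h

lemma matK_mul_unitMat (j : Fin n) (a b : ℤ) :
    matK q j * unitMat n a b = ((q ^ (simpleRoot j ⬝ᵥ wt a) : ℂˣ) : ℂ) • unitMat n a b := by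
  ext μ ν
  rw [matK, Matrix.diagonal_mul, Matrix.smul_apply]
  by_cases h1 : μ.val = a <;> simp [unitMat, h1]

lemma unitMat_mul_matK (j : Fin n) (a b : ℤ) :
    unitMat n a b * matK q j = ((q ^ (simpleRoot j ⬝ᵥ wt b) : ℂˣ) : ℂ) • unitMat n a b := by
  ext μ ν
  rw [matK, Matrix.mul_diagonal, Matrix.smul_apply]
  by_cases h1 : ν.val = b <;> simp [unitMat, h1, mul_comm]

lemma matK_weight (j : Fin n) {a b : ℤ} {m : ℤ}
    (h : simpleRoot j ⬝ᵥ wt a = m + simpleRoot j ⬝ᵥ wt b) :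
    matK q j * unitMat n a b = ((q ^ m : ℂˣ) : ℂ) • (unitMat n a b * matK q j) := by
  rw [matK_mul_unitMat, unitMat_mul_matK, smul_smul, ← Units.val_mul, ← zpow_add, h]

lemma wt_neg (μ : ℤ) : (wt (-μ) : Fin n → ℤ) = -wt μ := by
  funext a
  simp only [wt, Pi.neg_apply]
  split_ifs <;> omega

lemma wt_zero : (wt 0 : Fin n → ℤ) = 0 := by
  funext a
  simp only [wt, Pi.zero_apply]
  split_ifs <;> omega

lemma simpleRoot_even {i : Fin n} (h : ¬ IsOdd i) :
    simpleRoot i = wt (i.val + 1) - wt (i.val + 2) := by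
  funext a
  have := a.2
  have := i.2
  unfold IsOdd at h
  simp only [simpleRoot, wt, Pi.sub_apply, Fin.ext_iff]
  split_ifs <;> omega

lemma simpleRoot_odd {i : Fin n} (h : IsOdd i) : simpleRoot i = wt (n : ℤ) := by
  funext a
  have := a.2
  unfold IsOdd at h
  simp only [simpleRoot, wt, Fin.ext_iff]
  split_ifs <;> omega

/-- The pairing of a simple root with a weight of the vector module. -/
lemma root_wt (i : Fin n) (μ : ℤ) : simpleRoot i ⬝ᵥ wt μ =
    if IsOdd i then (if μ = n then 1 else if μ = -n then -1 else 0)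
    else if μ = i.val + 1 ∨ μ = -(i.val + 2 : ℤ) then 1
      else if μ = -(i.val + 1 : ℤ) ∨ μ = i.val + 2 then -1 else 0 := by
  have hi := i.2
  rw [simpleRoot_eq, sub_dotProduct, single_dotProduct]
  unfold IsOdd
  by_cases h : i.val + 1 < n
  · simp only [h, dite_true, single_dotProduct, wt]
    push_cast
    split_ifs <;> omega
  · simp only [h, dite_false, zero_dotProduct, wt]
    split_ifs <;> omega

lemma matK_matE (i j : Fin n) :
    matK q i * matE j = ((q ^ form i j : ℂˣ) : ℂ) • (matE j * matK q i) := by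
  unfold matE form
  split_ifs with h
  · rw [mul_sub, sub_mul, smul_sub, matK_weight q i (m := simpleRoot i ⬝ᵥ simpleRoot j),
      matK_weight q i (m := simpleRoot i ⬝ᵥ simpleRoot j)]
    · rw [simpleRoot_odd h, wt_neg, wt_zero, dotProduct_neg, dotProduct_zero]; ring
    · rw [simpleRoot_odd h, wt_zero, dotProduct_zero, add_zero]
  · rw [mul_add, add_mul, smul_add, matK_weight q i (m := simpleRoot i ⬝ᵥ simpleRoot j),
      matK_weight q i (m := simpleRoot i ⬝ᵥ simpleRoot j)]
    · rw [simpleRoot_even h, wt_neg, wt_neg, dotProduct_neg, dotProduct_neg, dotProduct_sub]; ring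
    · rw [simpleRoot_even h, dotProduct_sub]; ring

lemma matK_matF (i j : Fin n) :
    matK q i * matF j = ((q ^ (-form i j) : ℂˣ) : ℂ) • (matF j * matK q i) := by
  unfold matF form
  split_ifs with h
  · rw [mul_add, add_mul, smul_add, matK_weight q i (m := -(simpleRoot i ⬝ᵥ simpleRoot j)),
      matK_weight q i (m := -(simpleRoot i ⬝ᵥ simpleRoot j))]
    · rw [simpleRoot_odd h, wt_neg, wt_zero, dotProduct_neg, dotProduct_zero]; ring
    · rw [simpleRoot_odd h, wt_zero, dotProduct_zero]; ring
  · rw [mul_add, add_mul, smul_add, matK_weight q i (m := -(simpleRoot i ⬝ᵥ simpleRoot j)),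
      matK_weight q i (m := -(simpleRoot i ⬝ᵥ simpleRoot j))]
    · rw [simpleRoot_even h, wt_neg, wt_neg, dotProduct_neg, dotProduct_neg, dotProduct_sub]; ring
    · rw [simpleRoot_even h, dotProduct_sub]; ring

lemma unitMat_mul_eq (a d : ℤ) {b c : ℤ} (hb : -(n : ℤ) ≤ b ∧ b ≤ n) (h : b = c) :
    unitMat n a b * unitMat n c d = unitMat n a d := by
  rw [unitMat_mul a d (Finset.mem_Icc.2 hb), if_pos h]

lemma unitMat_mul_ne (a d : ℤ) {b c : ℤ} (h : b ≠ c) :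
    unitMat n a b * unitMat n c d = 0 := by
  ext μ ν
  rw [Matrix.mul_apply]
  refine Finset.sum_eq_zero fun σ _ => ?_
  by_cases h1 : σ.val = b
  · have : σ.val ≠ c := fun h2 => h (h1.symm.trans h2)
    simp [unitMat, this]
  · simp [unitMat, h1]


lemma matE_odd {i : Fin n} (h : IsOdd i) : matE i = unitMat n n 0 - unitMat n 0 (-n) := if_pos h
lemma matF_odd {i : Fin n} (h : IsOdd i) : matF i = unitMat n 0 n + unitMat n (-n) 0 := if_pos h
lemma matE_even {i : Fin n} (h : ¬ IsOdd i) : matE i =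
    unitMat n (i.val + 1) (i.val + 2) + unitMat n (-(i.val + 2)) (-(i.val + 1)) := if_neg h
lemma matF_even {i : Fin n} (h : ¬ IsOdd i) : matF i =
    unitMat n (i.val + 2) (i.val + 1) + unitMat n (-(i.val + 1)) (-(i.val + 2)) := if_neg h

lemma koszul_odd {i j : Fin n} (hi : IsOdd i) (hj : IsOdd j) : koszul i j = -1 := if_pos ⟨hi, hj⟩

lemma matE_matE {i j : Fin n} (h : i.val + 1 ≠ j.val) (h' : j.val + 1 ≠ i.val)
    (h2 : IsOdd i → ¬ IsOdd j) : matE i * matE j = 0 := by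
  have := i.2
  have := j.2
  by_cases hi : IsOdd i
  · have hj := h2 hi
    rw [matE_odd hi, matE_even hj]
    unfold IsOdd at hi hj
    simp (disch := omega) only [mul_add, sub_mul, unitMat_mul_ne, add_zero, sub_zero]
  · by_cases hj : IsOdd j
    · rw [matE_even hi, matE_odd hj]
      unfold IsOdd at hi hj
      simp (disch := omega) only [mul_sub, add_mul, unitMat_mul_ne, add_zero, sub_zero]
    · rw [matE_even hi, matE_even hj]
      unfold IsOdd at hi hj
      simp (disch := omega) only [mul_add, add_mul, unitMat_mul_ne, add_zero]

lemma matF_matF {i j : Fin n} (h : i.val + 1 ≠ j.val) (h' : j.val + 1 ≠ i.val)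
    (h2 : IsOdd i → ¬ IsOdd j) : matF i * matF j = 0 := by
  have := i.2
  have := j.2
  by_cases hi : IsOdd i
  · have hj := h2 hi
    rw [matF_odd hi, matF_even hj]
    unfold IsOdd at hi hj
    simp (disch := omega) only [mul_add, add_mul, unitMat_mul_ne, add_zero]
  · by_cases hj : IsOdd j
    · rw [matF_even hi, matF_odd hj]
      unfold IsOdd at hi hj
      simp (disch := omega) only [mul_add, add_mul, unitMat_mul_ne, add_zero]
    · rw [matF_even hi, matF_even hj]
      unfold IsOdd at hi hj
      simp (disch := omega) only [mul_add, add_mul, unitMat_mul_ne, add_zero]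

lemma matE_matF_ne {i j : Fin n} (h : i ≠ j) :
    matE i * matF j = 0 ∧ matF j * matE i = 0 := by
  have := i.2
  have := j.2
  have h : i.val ≠ j.val := fun H => h (Fin.ext H)
  by_cases hi : IsOdd i <;> by_cases hj : IsOdd j
  · unfold IsOdd at hi hj; omega
  · rw [matE_odd hi, matF_even hj]
    unfold IsOdd at hi hj
    constructor <;>
    simp (disch := omega) only [mul_add, add_mul, mul_sub, sub_mul, unitMat_mul_ne, add_zero,
      sub_zero]
  · rw [matE_even hi, matF_odd hj]
    unfold IsOdd at hi hj
    constructor <;>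
    simp (disch := omega) only [mul_add, add_mul, mul_sub, sub_mul, unitMat_mul_ne, add_zero,
      sub_zero]
  · rw [matE_even hi, matF_even hj]
    unfold IsOdd at hi hj
    constructor <;>
    simp (disch := omega) only [mul_add, add_mul, mul_sub, sub_mul, unitMat_mul_ne, add_zero,
      sub_zero]

lemma matK_sub_matL (i : Fin n) (μ ν : Idx n) : (matK q i - matL q i) μ ν =
    if μ.val = ν.val then ((q ^ (simpleRoot i ⬝ᵥ wt μ.val) : ℂˣ) : ℂ) -
      ((q ^ (-(simpleRoot i ⬝ᵥ wt μ.val)) : ℂˣ) : ℂ) else 0 := by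
  by_cases h : μ = ν
  · subst h
    simp [matK, matL]
  · have : μ.val ≠ ν.val := fun H => h (Subtype.ext H)
    simp [matK, matL, h, this]

lemma matEF (i : Fin n) : ((q : ℂ) - (q : ℂ)⁻¹) • (matE i * matF i - koszul i i • (matF i * matE i))
    = matK q i - matL q i := by
  have hi := i.2
  by_cases h : IsOdd i
  · have hh := h
    rw [koszul_odd h h, matE_odd h, matF_odd h]
    unfold IsOdd at h
    simp (disch := omega) only [mul_add, add_mul, mul_sub, sub_mul, unitMat_mul_ne, add_zero,
      sub_zero, unitMat_mul_eq, zero_add, zero_sub]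
    ext μ ν
    rw [matK_sub_matL, root_wt, if_pos hh]
    simp only [Matrix.smul_apply, Matrix.sub_apply, Matrix.add_apply, Matrix.neg_apply, unitMat,
      Matrix.of_apply, smul_eq_mul]
    by_cases h1 : μ.val = ν.val
    · rw [← h1]
      by_cases h2 : μ.val = n
      · have h3 : n ≠ 0 := by omega
        have h4 : (n : ℤ) ≠ -n := by omega
        simp [h2, h3, h4]
      · by_cases h5 : μ.val = -n
        · have h3 : -(n : ℤ) ≠ 0 := by omega
          have h4 : -(n : ℤ) ≠ n := by omega
          have h6 : n ≠ 0 := by omega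
          simp [h5, h6, h4]
        · have h3 : n ≠ 0 := by omega
          have h7 : (0 : ℤ) ≠ n := by omega
          by_cases h6 : μ.val = 0 <;> simp [h2, h5, h6, h3, h7]
    · have a1 : ¬ (μ.val = n ∧ ν.val = n) := by omega
      have a2 : ¬ (μ.val = 0 ∧ ν.val = 0) := by omega
      have a3 : ¬ (μ.val = -n ∧ ν.val = -n) := by omega
      simp [h1, a1, a2, a3]
  · have hh := h
    have hk : koszul i i = 1 := if_neg fun H => h H.1
    rw [hk, matE_even h, matF_even h]
    unfold IsOdd at h
    simp (disch := omega) only [mul_add, add_mul, mul_sub, sub_mul, unitMat_mul_ne, add_zero,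
      sub_zero, unitMat_mul_eq, zero_add, zero_sub]
    ext μ ν
    rw [matK_sub_matL, root_wt, if_neg hh]
    simp only [Matrix.smul_apply, Matrix.sub_apply, Matrix.add_apply, Matrix.neg_apply, unitMat,
      Matrix.of_apply, smul_eq_mul]
    by_cases h1 : μ.val = ν.val
    · rw [← h1]
      by_cases c1 : μ.val = i.val + 1
      · rw [if_pos (by omega), if_neg (by omega), if_neg (by omega), if_neg (by omega),
          if_pos (by omega), if_pos (by omega)]
        simp
      by_cases c2 : μ.val = -(i.val + 2 : ℤ)
      · have b2 : ¬ μ.val = -(i.val + 1 : ℤ) := by omega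
        have b3 : ¬ μ.val = i.val + 2 := by omega
        simp only [b2, b3, c1, if_true, if_false, or_false, false_or, and_self, eq_self_iff_true, c2]
        rw [if_neg (by omega), if_neg (by omega), if_neg (by omega)]
        simp
      by_cases c3 : μ.val = -(i.val + 1 : ℤ)
      · rw [if_neg (by omega), if_neg (by omega), if_neg (by omega), if_pos (by omega),
          if_pos (by omega), if_neg (by omega), if_pos (by omega)]
        simp
      by_cases c4 : μ.val = i.val + 2
      · rw [if_neg (by omega), if_neg (by omega), if_pos (by omega), if_neg (by omega),
          if_pos (by omega), if_neg (by omega), if_pos (by omega)]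
        simp
      · rw [if_neg (by omega), if_neg (by omega), if_neg (by omega), if_neg (by omega),
          if_pos (by omega), if_neg (by omega), if_neg (by omega)]
        simp
    · rw [if_neg (by omega), if_neg (by omega), if_neg (by omega), if_neg (by omega),
          if_neg (by omega)]
      simp

lemma matE_cube_even {i j : Fin n} (hi : ¬ IsOdd i) (h : Adj i j) :
    matE i * matE i = 0 ∧ matE i * matE j * matE i = 0 := by
  have := i.2
  have := j.2
  have h0 := hi
  unfold IsOdd at h0
  refine ⟨matE_matE (by omega) (by omega) fun H => absurd H hi, ?_⟩
  by_cases hj : IsOdd j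
  · rw [matE_even hi, matE_odd hj]
    unfold IsOdd at hj
    unfold Adj at h
    simp (disch := omega) only [mul_add, add_mul, mul_sub, sub_mul, unitMat_mul_ne,
      unitMat_mul_eq, add_zero, zero_add, zero_mul, neg_zero, zero_sub, sub_zero, neg_mul]
  · rw [matE_even hi, matE_even hj]
    unfold IsOdd at hj
    rcases h with h | h <;>
    simp (disch := omega) only [mul_add, add_mul, mul_sub, sub_mul, unitMat_mul_ne,
      unitMat_mul_eq, add_zero, zero_add, zero_mul]

lemma matF_cube_even {i j : Fin n} (hi : ¬ IsOdd i) (h : Adj i j) :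
    matF i * matF i = 0 ∧ matF i * matF j * matF i = 0 := by
  have := i.2
  have := j.2
  have h0 := hi
  unfold IsOdd at h0
  refine ⟨matF_matF (by omega) (by omega) fun H => absurd H hi, ?_⟩
  by_cases hj : IsOdd j
  · rw [matF_even hi, matF_odd hj]
    unfold IsOdd at hj
    unfold Adj at h
    simp (disch := omega) only [mul_add, add_mul, mul_sub, sub_mul, unitMat_mul_ne,
      unitMat_mul_eq, add_zero, zero_add, zero_mul]
  · rw [matF_even hi, matF_even hj]
    unfold IsOdd at hj
    rcases h with h | h <;>
    simp (disch := omega) only [mul_add, add_mul, mul_sub, sub_mul, unitMat_mul_ne,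
      unitMat_mul_eq, add_zero, zero_add, zero_mul]

lemma matE_odd_adj {i j : Fin n} (hi : IsOdd i) (h : Adj i j) :
    matE i * matE i * matE i = 0 ∧ matE i * matE i * matE j * matE i = 0 ∧
      matE i * matE j * matE i * matE i = 0 := by
  have := i.2
  have := j.2
  have hj := h.not_odd hi
  rw [matE_odd hi, matE_even hj]
  unfold IsOdd at hi hj
  unfold Adj at h
  refine ⟨?_, ?_, ?_⟩ <;>
  simp (disch := omega) only [mul_add, add_mul, mul_sub, sub_mul, unitMat_mul_ne,
      unitMat_mul_eq, add_zero, zero_add, zero_mul, neg_zero, zero_sub, sub_zero, neg_mul, mul_neg]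

lemma matF_odd_adj {i j : Fin n} (hi : IsOdd i) (h : Adj i j) :
    matF i * matF i * matF i = 0 ∧ matF i * matF i * matF j * matF i = 0 ∧
      matF i * matF j * matF i * matF i = 0 := by
  have := i.2
  have := j.2
  have hj := h.not_odd hi
  rw [matF_odd hi, matF_even hj]
  unfold IsOdd at hi hj
  unfold Adj at h
  refine ⟨?_, ?_, ?_⟩ <;>
  simp (disch := omega) only [mul_add, add_mul, mul_sub, sub_mul, unitMat_mul_ne,
      unitMat_mul_eq, add_zero, zero_add, zero_mul]

lemma matE_far {i j : Fin n} (h : i ≠ j) (h' : ¬ Adj i j) : matE i * matE j = 0 := by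
  have hv : i.val ≠ j.val := fun H => h (Fin.ext H)
  unfold Adj at h'
  exact matE_matE (by omega) (by omega) (by unfold IsOdd; omega)

lemma matF_far {i j : Fin n} (h : i ≠ j) (h' : ¬ Adj i j) : matF i * matF j = 0 := by
  have hv : i.val ≠ j.val := fun H => h (Fin.ext H)
  unfold Adj at h'
  exact matF_matF (by omega) (by omega) (by unfold IsOdd; omega)

variable (n) in
/-- The matrices of the generators in the vector module satisfy the relations of `U_q`. -/
noncomputable def vecDatum : Datum n q (Matrix (Idx n) (Idx n) ℂ) :=
  { K := matK q
    L := matL q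
    E := matE
    F := matF
    KL := fun i => by
      unfold matK matL
      rw [Matrix.diagonal_mul_diagonal, ← Matrix.diagonal_one]
      congr 1; funext μ
      rw [← Units.val_mul, ← zpow_add, add_neg_cancel, zpow_zero, Units.val_one]
    LK := fun i => by
      unfold matK matL
      rw [Matrix.diagonal_mul_diagonal, ← Matrix.diagonal_one]
      congr 1; funext μ
      rw [← Units.val_mul, ← zpow_add, neg_add_cancel, zpow_zero, Units.val_one]
    KK := fun i j => by
      unfold matK
      rw [Matrix.diagonal_mul_diagonal, Matrix.diagonal_mul_diagonal]
      congr 1; funext μ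
      exact mul_comm _ _
    KE := matK_matE q
    KF := matK_matF q
    EF := fun i j => by
      split_ifs with h
      · subst h; exact matEF q i
      · rw [(matE_matF_ne h).1, (matE_matF_ne h).2, smul_zero, sub_zero, smul_zero]
    EE := fun i j h h' => by
      rw [matE_far h h', matE_far h.symm fun H => h' H.symm]
    EEE := fun i j hi h => by
      obtain ⟨h1, h2⟩ := matE_cube_even hi h
      rw [serreTwo, h1, h2, mul_assoc, h1]; simp
    EEEE := fun i j hi h => by
      obtain ⟨h1, h2, h3⟩ := matE_odd_adj hi h
      rw [serreThree, h1, h2, h3, mul_assoc, mul_assoc, ← mul_assoc (matE i), h1]; simp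
    FF := fun i j h h' => by
      rw [matF_far h h', matF_far h.symm fun H => h' H.symm]
    FFF := fun i j hi h => by
      obtain ⟨h1, h2⟩ := matF_cube_even hi h
      rw [serreTwo, h1, h2, mul_assoc, h1]; simp
    FFFF := fun i j hi h => by
      obtain ⟨h1, h2, h3⟩ := matF_odd_adj hi h
      rw [serreThree, h1, h2, h3, mul_assoc, mul_assoc, ← mul_assoc (matF i), h1]; simp }

variable (n) in
/-- The vector representation of `U_q(osp(1|2n))` on the `2n + 1`-dimensional space with basis
`w_μ`, `μ ∈ {-n, …, n}`, where `w_0` is odd and all other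
`w_μ` are even: `x w_ν = Σ_μ t_{μ ν}(x) w_μ`. -/
noncomputable def vecRep : Uq n q →ₐ[ℂ] Matrix (Idx n) (Idx n) ℂ := (vecDatum n q).lift

end Vector

/-! ### The algebra of functions on the quantum supergroup -/

section Functions

variable {n : ℕ} {q : ℂˣ}

/-- The sign `(-1)^{[w_μ]}`. -/
def vsign (μ : ℤ) : ℂ := if μ = 0 then -1 else 1

lemma vsign_mul_self (μ : ℤ) : vsign μ * vsign μ = 1 := by
  unfold vsign; split_ifs <;> simp

variable (n) in
/-- The parity operator of the vector module. -/
noncomputable def vecPar : Matrix (Idx n) (Idx n) ℂ := Matrix.diagonal fun μ => vsign μ.val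

lemma vecPar_mul_self : vecPar n * vecPar n = 1 := by
  rw [vecPar, Matrix.diagonal_mul_diagonal, ← Matrix.diagonal_one]
  congr 1; funext μ; exact vsign_mul_self _

lemma vecPar_conj_unitMat (a b : ℤ) :
    vecPar n * unitMat n a b * vecPar n = (vsign a * vsign b) • unitMat n a b := by
  ext μ ν
  rw [vecPar, Matrix.mul_diagonal, Matrix.diagonal_mul, Matrix.smul_apply]
  by_cases h1 : μ.val = a <;> by_cases h2 : ν.val = b <;> simp [unitMat, h1, h2]

lemma vecPar_conj_diagonal (d : Idx n → ℂ) :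
    vecPar n * Matrix.diagonal d * vecPar n = Matrix.diagonal d := by
  rw [vecPar, Matrix.diagonal_mul_diagonal, Matrix.diagonal_mul_diagonal]
  congr 1; funext μ
  rw [mul_right_comm, vsign_mul_self, one_mul]

lemma vecPar_conj_matE (i : Fin n) : vecPar n * matE i * vecPar n = sgn i • matE i := by
  have hi := i.2
  by_cases h : IsOdd i
  · have h0 : vsign n = 1 := if_neg (by omega)
    have h1 : vsign (-n) = 1 := if_neg (by omega)
    have h2 : vsign 0 = -1 := if_pos rfl
    rw [matE_odd h, mul_sub, sub_mul, vecPar_conj_unitMat, vecPar_conj_unitMat, sgn, if_pos h,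
      smul_sub, h0, h1, h2, one_mul, mul_one]
  · have h0 : vsign (i.val + 1) = 1 := if_neg (by omega)
    have h1 : vsign (i.val + 2) = 1 := if_neg (by omega)
    have h2 : vsign (-(i.val + 2)) = 1 := if_neg (by omega)
    have h3 : vsign (-(i.val + 1)) = 1 := if_neg (by omega)
    rw [matE_even h, mul_add, add_mul, vecPar_conj_unitMat, vecPar_conj_unitMat, sgn, if_neg h,
      smul_add, h0, h1, h2, h3, one_mul]

lemma vecPar_conj_matF (i : Fin n) : vecPar n * matF i * vecPar n = sgn i • matF i := by
  have hi := i.2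
  by_cases h : IsOdd i
  · have h0 : vsign n = 1 := if_neg (by omega)
    have h1 : vsign (-n) = 1 := if_neg (by omega)
    have h2 : vsign 0 = -1 := if_pos rfl
    rw [matF_odd h, mul_add, add_mul, vecPar_conj_unitMat, vecPar_conj_unitMat, sgn, if_pos h,
      smul_add, h0, h1, h2, one_mul, mul_one]
  · have h0 : vsign (i.val + 1) = 1 := if_neg (by omega)
    have h1 : vsign (i.val + 2) = 1 := if_neg (by omega)
    have h2 : vsign (-(i.val + 2)) = 1 := if_neg (by omega)
    have h3 : vsign (-(i.val + 1)) = 1 := if_neg (by omega)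
    rw [matF_even h, mul_add, add_mul, vecPar_conj_unitMat, vecPar_conj_unitMat, sgn, if_neg h,
      smul_add, h0, h1, h2, h3, one_mul]

lemma vecRep_parity (x : Uq n q) :
    vecRep n q (parity n q x) = vecPar n * vecRep n q x * vecPar n := by
  induction x using Uq_induction with
  | hk i => rw [parity_k, vecRep, Datum.lift_k]; exact (vecPar_conj_diagonal _).symm
  | hl i => rw [parity_kinv, vecRep, Datum.lift_kinv]; exact (vecPar_conj_diagonal _).symm
  | he i => rw [parity_e, vecRep, map_smul, Datum.lift_e]; exact (vecPar_conj_matE i).symm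
  | hf i => rw [parity_f, vecRep, map_smul, Datum.lift_f]; exact (vecPar_conj_matF i).symm
  | hc r =>
    rw [AlgHom.commutes, AlgHom.commutes, ← Algebra.commutes, mul_assoc, vecPar_mul_self, mul_one]
  | ha x y h1 h2 => rw [map_add, map_add, map_add, h1, h2, mul_add, add_mul]
  | hm x y h1 h2 =>
    rw [map_mul, map_mul, map_mul, h1, h2]
    calc _ = vecPar n * vecRep n q x * (vecPar n * vecPar n) * vecRep n q y * vecPar n := by
          simp only [mul_assoc]
      _ = _ := by rw [vecPar_mul_self, mul_one]; simp only [mul_assoc]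

variable (q) in
/-- The matrix element `t_{μ ν}` of the vector representation, as a linear form on `U_q`. -/
noncomputable def tEntry (μ ν : Idx n) : UDual n q :=
  (lin n q).symm (Matrix.entryLinearMap ℂ ℂ μ ν ∘ₗ (vecRep n q).toLinearMap)

lemma lin_tEntry (μ ν : Idx n) (x : Uq n q) : lin n q (tEntry q μ ν) x = vecRep n q x μ ν := rfl

lemma dpar_tEntry (μ ν : Idx n) :
    dpar (tEntry q μ ν) = (vsign μ.val * vsign ν.val) • tEntry q μ ν :=
  dual_ext fun x => by
    rw [lin_dpar, lin_tEntry, vecRep_parity, vecPar, Matrix.mul_diagonal, Matrix.diagonal_mul,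
      map_smul, LinearMap.smul_apply, lin_tEntry, smul_eq_mul, mul_right_comm]

lemma circ_tEntry (x : Uq n q) (μ ν : Idx n) :
    circ x (tEntry q μ ν) = ∑ σ, vecRep n q x σ ν • tEntry q μ σ :=
  dual_ext fun y => by
    rw [lin_circ, lin_tEntry, map_mul, Matrix.mul_apply, map_sum, LinearMap.sum_apply]
    refine Finset.sum_congr rfl fun σ _ => ?_
    rw [map_smul, LinearMap.smul_apply, lin_tEntry, smul_eq_mul, mul_comm]

variable (n q) in
/-- The superalgebra `T_q` of functions on `OSp_q(1|2n)`: the algebra generated by the matrix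
elements `t_{μ ν}` of the vector representation.  (These belong to the finite dual of `U_q`, so it
makes no difference whether the algebra is generated in the finite dual or in the full dual.) -/
noncomputable def Tq : Subalgebra ℂ (UDual n q) :=
  Algebra.adjoin ℂ (Set.range fun p : Idx n × Idx n => tEntry q p.1 p.2)

lemma tEntry_mem (μ ν : Idx n) : tEntry q μ ν ∈ Tq n q := Algebra.subset_adjoin ⟨(μ, ν), rfl⟩

lemma Tq_induction {P : UDual n q → Prop} (ht : ∀ μ ν, P (tEntry q μ ν)) (h1 : P 1)
    (hs : ∀ (r : ℂ) g, P g → P (r • g)) (ha : ∀ g h, P g → P h → P (g + h))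
    (hm : ∀ g h, g ∈ Tq n q → h ∈ Tq n q → P g → P h → P (g * h)) {g : UDual n q}
    (hg : g ∈ Tq n q) : P g := by
  induction hg using Algebra.adjoin_induction with
  | mem g hg => obtain ⟨p, rfl⟩ := hg; exact ht _ _
  | algebraMap r => rw [Algebra.algebraMap_eq_smul_one]; exact hs r 1 h1
  | add g h _ _ h1 h2 => exact ha g h h1 h2
  | mul g h hg hh h1 h2 => exact hm g h hg hh h1 h2

lemma dpar_mem_Tq {g : UDual n q} (hg : g ∈ Tq n q) : dpar g ∈ Tq n q := by
  refine Tq_induction (P := fun g => dpar g ∈ Tq n q) (fun μ ν => ?_) ?_ (fun r g h => ?_)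
    (fun g h h1 h2 => ?_) (fun g h _ _ h1 h2 => ?_) hg
  · rw [dpar_tEntry]; exact Subalgebra.smul_mem _ (tEntry_mem μ ν) _
  · rw [dpar_one]; exact one_mem _
  · rw [map_smul]; exact Subalgebra.smul_mem _ h _
  · rw [map_add]; exact add_mem h1 h2
  · rw [dpar_mul]; exact mul_mem h1 h2

lemma dtw_mem_Tq (i : ZMod 2) {g : UDual n q} (hg : g ∈ Tq n q) : dtw i g ∈ Tq n q := by
  unfold dtw; split_ifs
  exacts [hg, dpar_mem_Tq hg]

lemma dpart_apply (i : ZMod 2) (g : UDual n q) :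
    dpart i g = (1 / 2 : ℂ) • (g + eps i • dpar g) :=
  dual_ext fun x => by
    rw [lin_dpart, part_apply, map_smul, map_add, map_smul, map_smul, map_add, map_smul]
    rfl

lemma dpart_mem_Tq (i : ZMod 2) {g : UDual n q} (hg : g ∈ Tq n q) : dpart i g ∈ Tq n q := by
  rw [dpart_apply]
  exact Subalgebra.smul_mem _ (add_mem hg (Subalgebra.smul_mem _ (dpar_mem_Tq hg) _)) _

/-- `T_q` is stable under the action `∘` of `U_q`. -/
lemma circ_mem_Tq (x : Uq n q) {g : UDual n q} (hg : g ∈ Tq n q) : circ x g ∈ Tq n q := by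
  have gens : ∀ x : Uq n q, ∀ μ ν, circ x (tEntry q μ ν) ∈ Tq n q := fun x μ ν => by
    rw [circ_tEntry]
    exact sum_mem fun σ _ => Subalgebra.smul_mem _ (tEntry_mem μ σ) _
  have gone : ∀ x : Uq n q, circ x (1 : UDual n q) ∈ Tq n q := fun x => by
    rw [circ_one]; exact Subalgebra.smul_mem _ (one_mem _) _
  have step : ∀ x : Uq n q, (∀ g h, g ∈ Tq n q → h ∈ Tq n q → circ x g ∈ Tq n q →
      circ x h ∈ Tq n q → circ x (g * h) ∈ Tq n q) → ∀ g ∈ Tq n q, circ x g ∈ Tq n q := by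
    intro x H g hg
    refine Tq_induction (P := fun g => circ x g ∈ Tq n q) (gens x) (gone x) (fun r g h => ?_)
      (fun g h h1 h2 => ?_) H hg
    · rw [map_smul]; exact Subalgebra.smul_mem _ h _
    · rw [map_add]; exact add_mem h1 h2
  have hk : ∀ i, ∀ g ∈ Tq n q, circ (k q i) g ∈ Tq n q := fun i => step _ fun g h _ _ h1 h2 => by
    rw [circ_k_mul]; exact mul_mem h1 h2
  have hl : ∀ i, ∀ g ∈ Tq n q, circ (kinv q i) g ∈ Tq n q := fun i =>
    step _ fun g h _ _ h1 h2 => by rw [circ_kinv_mul]; exact mul_mem h1 h2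
  refine circ_mem_of_gens (N := Subalgebra.toSubmodule (Tq n q)) hk hl
    (fun i => step _ fun g h hg hh h1 h2 => ?_) (fun i => step _ fun g h hg hh h1 h2 => ?_) x g hg
  · rw [circ_e_mul]
    exact add_mem (mul_mem h1 (hk i h hh)) (mul_mem (dtw_mem_Tq _ hg) h2)
  · rw [circ_f_mul]
    exact add_mem (mul_mem h1 hh) (mul_mem (hl i _ (dtw_mem_Tq _ hg)) h2)

/-- The action `x ∘ g` of `U_q` on `T_q`. -/
noncomputable def circT (x : Uq n q) : Tq n q →ₗ[ℂ] Tq n q :=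
  (circ x).restrict (p := Subalgebra.toSubmodule (Tq n q)) (q := Subalgebra.toSubmodule (Tq n q))
    fun _ hg => circ_mem_Tq x hg

@[simp] lemma coe_circT (x : Uq n q) (g : Tq n q) : (circT x g : UDual n q) = circ x g.val := rfl

/-- The homogeneous component of degree `i` of an element of `T_q`. -/
noncomputable def Tpart (i : ZMod 2) : Tq n q →ₗ[ℂ] Tq n q :=
  (dpart i).restrict (p := Subalgebra.toSubmodule (Tq n q))
    (q := Subalgebra.toSubmodule (Tq n q)) fun _ hg => dpart_mem_Tq i hg

@[simp] lemma coe_Tpart (i : ZMod 2) (g : Tq n q) : (Tpart i g : UDual n q) = dpart i g.val := rfl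

end Functions

/-! ### Functions on the quantum homogeneous superspace, and sections of bundles on it -/

section Homogeneous

variable {n : ℕ} (q : ℂˣ) (Θ : Set (Fin n))

lemma counit_smul_of_gens {g : UDual n q} (hk : ∀ i, circ (k q i) g = g)
    (hl : ∀ i, circ (kinv q i) g = g) (he : ∀ i ∈ Θ, circ (e q i) g = 0)
    (hf : ∀ i ∈ Θ, circ (f q i) g = 0) {x : Uq n q} (hx : x ∈ Uk q Θ) :
    circ x g = counit n q x • g := by
  refine Uk_induction (P := fun x => circ x g = counit n q x • g) (fun i => ?_) (fun i => ?_)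
    (fun i hi => ?_) (fun i hi => ?_) (fun r => ?_) (fun x y _ _ h1 h2 => ?_)
    (fun x y _ _ h1 h2 => ?_) hx
  · rw [hk, counit_k, one_smul]
  · rw [hl, counit_kinv, one_smul]
  · rw [he i hi, counit_e, zero_smul]
  · rw [hf i hi, counit_f, zero_smul]
  · rw [AlgHom.commutes, AlgHom.commutes]; rfl
  · rw [map_add, map_add, LinearMap.add_apply, h1, h2, add_smul]
  · rw [map_mul, map_mul, Module.End.mul_apply, h2, map_smul, h1, smul_smul, mul_comm]

/-- The algebra `E_q = {g ∈ T_q | x ∘ g = ε(x) g for all x ∈ U_q(𝔨)}` of functions on the quantum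
homogeneous superspace. -/
noncomputable def Efun : Subalgebra ℂ (Tq n q) where
  carrier := {g | ∀ x ∈ Uk q Θ, circT x g = counit n q x • g}
  algebraMap_mem' r x hx := by
    refine Subtype.ext ?_
    change circ x (algebraMap ℂ (UDual n q) r) = counit n q x • algebraMap ℂ (UDual n q) r
    rw [Algebra.algebraMap_eq_smul_one, map_smul, circ_one, smul_comm]
  add_mem' {g h} hg hh x hx := by rw [map_add, hg x hx, hh x hx, smul_add]
  mul_mem' {g h} hg hh x hx := by
    have hg' : ∀ x ∈ Uk q Θ, circ x g.val = counit n q x • g.val := fun x hx =>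
      congrArg Subtype.val (hg x hx)
    have hh' : ∀ x ∈ Uk q Θ, circ x h.val = counit n q x • h.val := fun x hx =>
      congrArg Subtype.val (hh x hx)
    refine Subtype.ext (counit_smul_of_gens q Θ (g := g.val * h.val) (fun i => ?_) (fun i => ?_)
      (fun i hi => ?_) (fun i hi => ?_) hx)
    · rw [circ_k_mul, hg' _ (k_mem_Uk i), hh' _ (k_mem_Uk i), counit_k, one_smul, one_smul]
    · rw [circ_kinv_mul, hg' _ (kinv_mem_Uk i), hh' _ (kinv_mem_Uk i), counit_kinv, one_smul,
        one_smul]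
    · rw [circ_e_mul, hg' _ (e_mem_Uk hi), hh' _ (e_mem_Uk hi), counit_e, zero_smul, zero_smul,
        zero_mul, mul_zero, add_zero]
    · rw [circ_f_mul, hg' _ (f_mem_Uk hi), hh' _ (f_mem_Uk hi), counit_f, zero_smul, zero_smul,
        zero_mul, mul_zero, add_zero]

lemma mem_Efun {g : Tq n q} : g ∈ Efun q Θ ↔ ∀ x ∈ Uk q Θ, circT x g = counit n q x • g := Iff.rfl

section Bundle

variable {V : Type*} [AddCommGroup V] [Module ℂ V]

/-- The parity operator `v ↦ (-1)^{[v]} v` of a `ℤ/2`-graded vector space. -/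
noncomputable def gradePar (𝒱 : ZMod 2 → Submodule ℂ V) [DirectSum.Decomposition 𝒱] :
    V →ₗ[ℂ] V :=
  ((𝒱 0).subtype ∘ₗ DirectSum.component ℂ (ZMod 2) (fun i => 𝒱 i) 0 -
    (𝒱 1).subtype ∘ₗ DirectSum.component ℂ (ZMod 2) (fun i => 𝒱 i) 1) ∘ₗ
    (DirectSum.decomposeLinearEquiv 𝒱).toLinearMap

lemma gradePar_of_mem (𝒱 : ZMod 2 → Submodule ℂ V) [DirectSum.Decomposition 𝒱] {i : ZMod 2}
    {v : V} (hv : v ∈ 𝒱 i) : gradePar 𝒱 v = eps i • v := by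
  have h0 : gradePar 𝒱 v =
    (DirectSum.decompose 𝒱 v 0 : V) - (DirectSum.decompose 𝒱 v 1 : V) := rfl
  rw [h0]
  obtain rfl | rfl := zmod_two_cases i
  · rw [DirectSum.decompose_of_mem_same 𝒱 hv, DirectSum.decompose_of_mem_ne 𝒱 hv zero_ne_one]
    simp
  · rw [DirectSum.decompose_of_mem_same 𝒱 hv, DirectSum.decompose_of_mem_ne 𝒱 hv one_ne_zero]
    simp

variable {q}

/-- The action `x ∘ ζ = Σ (-1)^{[x][v_i]} v_i ⊗ x ∘ g_i` on `ζ = Σ v_i ⊗ g_i ∈ V ⊗ T_q`. -/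
noncomputable def circVT (𝒱 : ZMod 2 → Submodule ℂ V) [DirectSum.Decomposition 𝒱] (x : Uq n q) :
    V ⊗[ℂ] Tq n q →ₗ[ℂ] V ⊗[ℂ] Tq n q :=
  TensorProduct.map LinearMap.id (circT (part n q 0 x)) +
    TensorProduct.map (gradePar 𝒱) (circT (part n q 1 x))

/-- The left multiplication `a ζ = Σ (-1)^{[a][v_i]} v_i ⊗ a g_i` of `ζ = Σ v_i ⊗ g_i`. -/
noncomputable def leftMul (𝒱 : ZMod 2 → Submodule ℂ V) [DirectSum.Decomposition 𝒱] (a : Tq n q) :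
    V ⊗[ℂ] Tq n q →ₗ[ℂ] V ⊗[ℂ] Tq n q :=
  TensorProduct.map LinearMap.id (LinearMap.mulLeft ℂ (Tpart 0 a)) +
    TensorProduct.map (gradePar 𝒱) (LinearMap.mulLeft ℂ (Tpart 1 a))

/-- The right multiplication `ζ a = Σ v_i ⊗ g_i a` of `ζ = Σ v_i ⊗ g_i`. -/
noncomputable def rightMul (V : Type*) [AddCommGroup V] [Module ℂ V] (a : Tq n q) :
    V ⊗[ℂ] Tq n q →ₗ[ℂ] V ⊗[ℂ] Tq n q :=
  TensorProduct.map LinearMap.id (LinearMap.mulRight ℂ a)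

/-- The space of sections
`H_q(V) = {ζ ∈ V ⊗ T_q | x ∘ ζ = (S(x) ⊗ id) ζ for all x ∈ U_q(𝔨)}`. -/
noncomputable def Hq (Θ : Set (Fin n)) [Module (Uk q Θ) V] [IsScalarTower ℂ (Uk q Θ) V]
    (𝒱 : ZMod 2 → Submodule ℂ V) [DirectSum.Decomposition 𝒱] :
    Submodule ℂ (V ⊗[ℂ] Tq n q) where
  carrier := {ζ | ∀ x : Uk q Θ, circVT 𝒱 x.val ζ =
    TensorProduct.map (Algebra.lsmul ℂ ℂ V (⟨antipode n q x.val, antipode_mem_Uk x.2⟩ : Uk q Θ))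
      LinearMap.id ζ}
  add_mem' {ζ ξ} h1 h2 x := by rw [map_add, map_add, h1 x, h2 x]
  zero_mem' x := by rw [map_zero, map_zero]
  smul_mem' r ζ h x := by rw [map_smul, map_smul, h x]

end Bundle

end Homogeneous

end QOsp

/-!
Sections of a homogeneous superbundle form a bimodule over the invariant functions because
`U_q(𝔨)` acts on `E_q` through the co-unit. Applied to a product,
the action of `x` is `Σ ± (x₁ ∘ g) (x₂ ∘ h)`; if one factor is in `E_q`, only the term with the
co-unit on that factor survives. So right multiplication by `a ∈ E_q` commutes with `x ∘ ·`
(`circ_mul_invariant`), and left multiplication by a homogeneous `a ∈ E_q` commutes with it up to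
the Koszul sign `(-1)^{[x][a]}` (`circ_invariant_mul`). Since `U_q(𝔨)` is generated by elements
with an explicit co-multiplication, both facts are checked on generators and extended
multiplicatively.

The condition defining `H_q(V)` equates `x ∘ ·` with the operator `S(x) ⊗ id`. Right multiplication
commutes with the latter for trivial reasons. Left multiplication by `a` of degree `j` carries the
sign operator `v ↦ (-1)^{j [v]} v` on `V`, which supercommutes with `S(x)` because both the action
on `V` and the antipode are even (`gradePar_smul`, `antipode_parity`), so the two signs cancel
(`leftMul_mem_Hq`). A general `a ∈ E_q` is treated through its homogeneous components, which are
again invariant (`Tpart_mem_Efun`).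

The sign `(-1)^{[x][a]}` for `a` of degree `j` and arbitrary `x` is encoded by replacing `x` with
`parTw j x`, which avoids decomposing `x`.
-/

namespace QOsp

/-! ### Sign twists and homogeneous components -/

section Twists

variable {n : ℕ} {q : ℂˣ}

/-- The automorphism `x ↦ (-1)^{j [x]} x` of `U_q`. -/
noncomputable def parTw (j : ZMod 2) : Uq n q →ₐ[ℂ] Uq n q :=
  if j = 0 then AlgHom.id ℂ _ else parity n q

@[simp] lemma parTw_zero (x : Uq n q) : parTw 0 x = x := rfl
@[simp] lemma parTw_one (x : Uq n q) : parTw 1 x = parity n q x := rfl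

lemma parTw_parTw (j : ZMod 2) (x : Uq n q) : parTw j (parTw j x) = x := by
  obtain rfl | rfl := zmod_two_cases j <;> simp

lemma parTw_part (i j : ZMod 2) (x : Uq n q) :
    part n q i (parTw j x) = parTw j (part n q i x) := by
  obtain rfl | rfl := zmod_two_cases j
  · rfl
  · rw [parTw_one, parTw_one, parity_part, part_parity]

lemma parTw_mem_Uk {Θ : Set (Fin n)} (j : ZMod 2) {x : Uq n q} (hx : x ∈ Uk q Θ) :
    parTw j x ∈ Uk q Θ := by
  obtain rfl | rfl := zmod_two_cases j
  exacts [hx, parity_mem_Uk hx]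

lemma antipode_one : antipode n q 1 = 1 := by
  unfold antipode
  simp only [LinearMap.comp_apply, AlgHom.toLinearMap_apply, map_one]
  rfl

lemma antipode_k (i : Fin n) : antipode n q (k q i) = kinv q i :=
  congrArg (toOp n q).symm (Datum.lift_k _ i)

lemma antipode_kinv (i : Fin n) : antipode n q (kinv q i) = k q i :=
  congrArg (toOp n q).symm (Datum.lift_kinv _ i)

lemma antipode_e (i : Fin n) : antipode n q (e q i) = (-1 : ℂ) • (e q i * kinv q i) :=
  congrArg (toOp n q).symm (Datum.lift_e _ i)

lemma antipode_f (i : Fin n) : antipode n q (f q i) = (-1 : ℂ) • (k q i * f q i) :=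
  congrArg (toOp n q).symm (Datum.lift_f _ i)

/-- The antipode is an even map. -/
lemma antipode_parity (x : Uq n q) :
    antipode n q (parity n q x) = parity n q (antipode n q x) := by
  induction x using Uq_induction with
  | hk i => rw [parity_k, antipode_k, parity_kinv]
  | hl i => rw [parity_kinv, antipode_kinv, parity_k]
  | he i =>
    rw [parity_e, map_smul, antipode_e, map_smul, map_mul, parity_e, parity_kinv, smul_mul_assoc,
      smul_comm]
  | hf i =>
    rw [parity_f, map_smul, antipode_f, map_smul, map_mul, parity_f, parity_k, mul_smul_comm,
      smul_comm]
  | hc r =>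
    rw [AlgHom.commutes, Algebra.algebraMap_eq_smul_one, map_smul, antipode_one, map_smul, map_one]
  | ha x y h1 h2 => simp only [map_add, h1, h2]
  | hm x y h1 h2 =>
    simp only [map_mul, antipode_mul, map_add, h1, h2, part_parity, parity_part]

lemma antipode_parTw (j : ZMod 2) (x : Uq n q) :
    antipode n q (parTw j x) = parTw j (antipode n q x) := by
  obtain rfl | rfl := zmod_two_cases j
  exacts [rfl, antipode_parity x]

lemma dpar_dpart (i : ZMod 2) (g : UDual n q) : dpar (dpart i g) = eps i • dpart i g :=
  dual_ext fun x => by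
    rw [lin_dpar, lin_dpart, part_parity, map_smul, map_smul, LinearMap.smul_apply, lin_dpart]

/-- The homogeneous components of a product in `T_q`. -/
lemma Tpart_mul (i : ZMod 2) (a b : Tq n q) :
    Tpart i (a * b) = Tpart 0 a * Tpart i b + Tpart 1 a * Tpart (i + 1) b := by
  refine Subtype.ext ?_
  change dpart i (a.val * b.val) =
    dpart 0 a.val * dpart i b.val + dpart 1 a.val * dpart (i + 1) b.val
  simp only [dpart_apply, dpar_mul, eps_add, eps_zero, eps_one, mul_add, add_mul, smul_add,
    mul_smul_comm, smul_mul_assoc, smul_smul]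
  module

lemma Tpart_one (i : ZMod 2) : Tpart i (1 : Tq n q) = if i = 0 then 1 else 0 := by
  refine Subtype.ext ?_
  change dpart i (1 : UDual n q) = _
  rw [dpart_apply, dpar_one]
  obtain rfl | rfl := zmod_two_cases i
  · simp only [eps_zero, if_true, one_smul]
    change _ = (1 : UDual n q)
    module
  · simp only [eps_one, one_ne_zero, if_false]
    change _ = (0 : UDual n q)
    module

end Twists

/-! ### Multiplication by invariant functions -/

section Invariants

variable {n : ℕ} {q : ℂˣ} {Θ : Set (Fin n)}

lemma circ_of_mem_Efun {a : Tq n q} (ha : a ∈ Efun q Θ) {x : Uq n q} (hx : x ∈ Uk q Θ) :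
    circ x a.val = counit n q x • a.val :=
  congrArg Subtype.val (ha x hx)

/-- The algebra of invariants is a graded subspace of `T_q`. -/
lemma Tpart_mem_Efun (j : ZMod 2) {a : Tq n q} (ha : a ∈ Efun q Θ) : Tpart j a ∈ Efun q Θ := by
  intro x hx
  refine Subtype.ext ?_
  change circ x (dpart j a.val) = counit n q x • dpart j a.val
  rw [dpart_apply, map_smul, map_add, map_smul, circ_dpar, circ_of_mem_Efun ha hx,
    circ_of_mem_Efun ha (parity_mem_Uk hx), counit_parity, map_smul, smul_comm (eps j),
    ← smul_add, smul_comm]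

/-- Left multiplication by an invariant supercommutes with the action of `U_q(𝔨)`: in the
expansion of `x ∘ (a h)` by the co-multiplication only the term with `ε` on `a` survives. -/
lemma circ_invariant_mul {j : ZMod 2} {a : Tq n q} (ha : a ∈ Efun q Θ)
    (hj : dpar a.val = eps j • a.val) {x : Uq n q} (hx : x ∈ Uk q Θ) :
    ∀ h : UDual n q, circ x (a.val * h) = a.val * circ (parTw j x) h := by
  have hs : ∀ (i : Fin n) (z h : UDual n q), dtw (deg i) a.val * z =
      (if j = 0 then 1 else sgn i) • (a.val * z) := fun i z h => by
    unfold dtw deg sgn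
    obtain rfl | rfl := zmod_two_cases j <;> by_cases hi : IsOdd i <;> simp [hi, hj]
  have he : ∀ (i : Fin n), parTw j (e q i) = (if j = 0 then 1 else sgn i : ℂ) • e q i := fun i => by
    obtain rfl | rfl := zmod_two_cases j <;> simp
  have hf : ∀ (i : Fin n), parTw j (f q i) = (if j = 0 then 1 else sgn i : ℂ) • f q i := fun i => by
    obtain rfl | rfl := zmod_two_cases j <;> simp
  have hk : ∀ (i : Fin n), parTw j (k q i) = k q i := fun i => by
    obtain rfl | rfl := zmod_two_cases j <;> simp
  have hl : ∀ (i : Fin n), parTw j (kinv q i) = kinv q i := fun i => by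
    obtain rfl | rfl := zmod_two_cases j <;> simp
  refine Uk_induction
    (P := fun x => ∀ h : UDual n q, circ x (a.val * h) = a.val * circ (parTw j x) h)
    (fun i h => ?_) (fun i h => ?_) (fun i hi h => ?_) (fun i hi h => ?_) (fun r h => ?_)
    (fun x y _ _ h1 h2 h => ?_) (fun x y _ _ h1 h2 h => ?_) hx
  · rw [circ_k_mul, circ_of_mem_Efun ha (k_mem_Uk i), counit_k, one_smul, hk]
  · rw [circ_kinv_mul, circ_of_mem_Efun ha (kinv_mem_Uk i), counit_kinv, one_smul, hl]
  · rw [circ_e_mul, circ_of_mem_Efun ha (e_mem_Uk hi), counit_e, zero_smul, zero_mul, zero_add,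
      hs i _ h, he, map_smul, LinearMap.smul_apply, mul_smul_comm]
  · have hd : circ (kinv q i) (dtw (deg i) a.val) = dtw (deg i) a.val := by
      unfold dtw
      split_ifs
      · rw [circ_of_mem_Efun ha (kinv_mem_Uk i), counit_kinv, one_smul]
      · rw [circ_dpar, parity_kinv, circ_of_mem_Efun ha (kinv_mem_Uk i), counit_kinv, one_smul]
    rw [circ_f_mul, circ_of_mem_Efun ha (f_mem_Uk hi), counit_f, zero_smul, zero_mul, zero_add,
      hd, hs i _ h, hf, map_smul, LinearMap.smul_apply, mul_smul_comm]
  · simp only [AlgHom.commutes, Module.algebraMap_end_apply, mul_smul_comm]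
  · rw [map_add, map_add, map_add, LinearMap.add_apply, LinearMap.add_apply, h1, h2, mul_add]
  · rw [map_mul circ, map_mul (parTw j), map_mul circ, Module.End.mul_apply, Module.End.mul_apply,
      h2, h1]

/-- Right multiplication by an invariant commutes with the action of `U_q(𝔨)`. -/
lemma circ_mul_invariant {a : Tq n q} (ha : a ∈ Efun q Θ) {x : Uq n q} (hx : x ∈ Uk q Θ) :
    ∀ g : UDual n q, circ x (g * a.val) = circ x g * a.val := by
  refine Uk_induction (P := fun x => ∀ g : UDual n q, circ x (g * a.val) = circ x g * a.val)
    (fun i g => ?_) (fun i g => ?_) (fun i hi g => ?_) (fun i hi g => ?_) (fun r g => ?_)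
    (fun x y _ _ h1 h2 g => ?_) (fun x y _ _ h1 h2 g => ?_) hx
  · rw [circ_k_mul, circ_of_mem_Efun ha (k_mem_Uk i), counit_k, one_smul]
  · rw [circ_kinv_mul, circ_of_mem_Efun ha (kinv_mem_Uk i), counit_kinv, one_smul]
  · rw [circ_e_mul, circ_of_mem_Efun ha (e_mem_Uk hi), counit_e, zero_smul, mul_zero, add_zero,
      circ_of_mem_Efun ha (k_mem_Uk i), counit_k, one_smul]
  · rw [circ_f_mul, circ_of_mem_Efun ha (f_mem_Uk hi), counit_f, zero_smul, mul_zero, add_zero]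
  · simp only [AlgHom.commutes, Module.algebraMap_end_apply, smul_mul_assoc]
  · rw [map_add, LinearMap.add_apply, LinearMap.add_apply, h1, h2, add_mul]
  · rw [map_mul circ, Module.End.mul_apply, Module.End.mul_apply, h2, h1]

end Invariants

/-! ### Multiplication of sections -/

section Sections

variable {n : ℕ} {q : ℂˣ} {V : Type*} [AddCommGroup V] [Module ℂ V]
  (𝒱 : ZMod 2 → Submodule ℂ V) [DirectSum.Decomposition 𝒱]

lemma gradePar_gradePar (v : V) : gradePar 𝒱 (gradePar 𝒱 v) = v := by
  induction v using DirectSum.Decomposition.inductionOn 𝒱 with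
  | zero => simp
  | @homogeneous i v =>
    rw [gradePar_of_mem 𝒱 v.2, map_smul, gradePar_of_mem 𝒱 v.2, smul_smul, eps_mul_self, one_smul]
  | add v w h1 h2 => rw [map_add, map_add, h1, h2]

/-- The operator `v ↦ (-1)^{j [v]} v` of a `ℤ/2`-graded vector space. -/
noncomputable def gradeTw (j : ZMod 2) : V →ₗ[ℂ] V := if j = 0 then LinearMap.id else gradePar 𝒱

@[simp] lemma gradeTw_zero (v : V) : gradeTw 𝒱 0 v = v := rfl
@[simp] lemma gradeTw_one (v : V) : gradeTw 𝒱 1 v = gradePar 𝒱 v := rfl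

lemma gradeTw_gradeTw (i j : ZMod 2) (v : V) :
    gradeTw 𝒱 i (gradeTw 𝒱 j v) = gradeTw 𝒱 (i + j) v := by
  have h11 : (1 : ZMod 2) + 1 = 0 := rfl
  obtain rfl | rfl := zmod_two_cases i <;> obtain rfl | rfl := zmod_two_cases j <;>
    simp [h11, gradePar_gradePar]

/-- Left multiplication `v ⊗ g ↦ (-1)^{j [v]} v ⊗ a g`, the Koszul sign being that of an element
`a` of degree `j`. -/
noncomputable def twMul (j : ZMod 2) (a : Tq n q) : V ⊗[ℂ] Tq n q →ₗ[ℂ] V ⊗[ℂ] Tq n q :=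
  TensorProduct.map (gradeTw 𝒱 j) (LinearMap.mulLeft ℂ a)

@[simp] lemma twMul_tmul (j : ZMod 2) (a g : Tq n q) (v : V) :
    twMul 𝒱 j a (v ⊗ₜ[ℂ] g) = gradeTw 𝒱 j v ⊗ₜ[ℂ] (a * g) := rfl

lemma leftMul_eq (a : Tq n q) (ζ : V ⊗[ℂ] Tq n q) :
    leftMul 𝒱 a ζ = twMul 𝒱 0 (Tpart 0 a) ζ + twMul 𝒱 1 (Tpart 1 a) ζ := rfl

lemma leftMul_tmul (a g : Tq n q) (v : V) : leftMul 𝒱 a (v ⊗ₜ[ℂ] g) =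
    v ⊗ₜ[ℂ] (Tpart 0 a * g) + gradePar 𝒱 v ⊗ₜ[ℂ] (Tpart 1 a * g) := rfl

@[simp] lemma rightMul_tmul (a g : Tq n q) (v : V) :
    rightMul V a (v ⊗ₜ[ℂ] g) = v ⊗ₜ[ℂ] (g * a) := rfl

lemma circVT_tmul (x : Uq n q) (v : V) (g : Tq n q) : circVT 𝒱 x (v ⊗ₜ[ℂ] g) =
    v ⊗ₜ[ℂ] circT (part n q 0 x) g + gradePar 𝒱 v ⊗ₜ[ℂ] circT (part n q 1 x) g := rfl

lemma leftMul_one (ζ : V ⊗[ℂ] Tq n q) : leftMul 𝒱 1 ζ = ζ := by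
  induction ζ using TensorProduct.induction_on with
  | zero => exact map_zero _
  | tmul v g => rw [leftMul_tmul, Tpart_one, Tpart_one]; simp
  | add ζ ξ h1 h2 => rw [map_add, h1, h2]

lemma leftMul_mul (a b : Tq n q) (ζ : V ⊗[ℂ] Tq n q) :
    leftMul 𝒱 (a * b) ζ = leftMul 𝒱 a (leftMul 𝒱 b ζ) := by
  have h11 : (1 : ZMod 2) + 1 = 0 := rfl
  induction ζ using TensorProduct.induction_on with
  | zero => simp only [map_zero]
  | tmul v g =>
    simp only [leftMul_tmul, map_add, Tpart_mul, gradePar_gradePar, zero_add, h11, add_mul,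
      TensorProduct.tmul_add, mul_assoc]
    abel
  | add ζ ξ h1 h2 => rw [map_add, h1, h2, map_add, map_add]

lemma leftMul_add (a b : Tq n q) (ζ : V ⊗[ℂ] Tq n q) :
    leftMul 𝒱 (a + b) ζ = leftMul 𝒱 a ζ + leftMul 𝒱 b ζ := by
  induction ζ using TensorProduct.induction_on with
  | zero => simp only [map_zero, add_zero]
  | tmul v g =>
    simp only [leftMul_tmul, map_add, add_mul, TensorProduct.tmul_add]
    abel
  | add ζ ξ h1 h2 => rw [map_add, h1, h2, map_add, map_add]; abel

lemma leftMul_zero (ζ : V ⊗[ℂ] Tq n q) : leftMul 𝒱 0 ζ = 0 := by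
  have h := leftMul_add 𝒱 0 0 ζ
  rwa [add_zero, left_eq_add] at h

lemma rightMul_one (ζ : V ⊗[ℂ] Tq n q) : rightMul V 1 ζ = ζ := by
  induction ζ using TensorProduct.induction_on with
  | zero => exact map_zero _
  | tmul v g => rw [rightMul_tmul, mul_one]
  | add ζ ξ h1 h2 => rw [map_add, h1, h2]

lemma rightMul_mul (a b : Tq n q) (ζ : V ⊗[ℂ] Tq n q) :
    rightMul V (a * b) ζ = rightMul V b (rightMul V a ζ) := by
  induction ζ using TensorProduct.induction_on with
  | zero => simp only [map_zero]
  | tmul v g => simp only [rightMul_tmul, mul_assoc]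
  | add ζ ξ h1 h2 => rw [map_add, h1, h2, map_add, map_add]

lemma rightMul_add (a b : Tq n q) (ζ : V ⊗[ℂ] Tq n q) :
    rightMul V (a + b) ζ = rightMul V a ζ + rightMul V b ζ := by
  induction ζ using TensorProduct.induction_on with
  | zero => simp only [map_zero, add_zero]
  | tmul v g => simp only [rightMul_tmul, mul_add, TensorProduct.tmul_add]
  | add ζ ξ h1 h2 => rw [map_add, h1, h2, map_add, map_add]; abel

lemma rightMul_zero (ζ : V ⊗[ℂ] Tq n q) : rightMul V 0 ζ = 0 := by
  have h := rightMul_add 0 0 ζ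
  rwa [add_zero, left_eq_add] at h

lemma leftMul_rightMul (a b : Tq n q) (ζ : V ⊗[ℂ] Tq n q) :
    leftMul 𝒱 a (rightMul V b ζ) = rightMul V b (leftMul 𝒱 a ζ) := by
  induction ζ using TensorProduct.induction_on with
  | zero => simp only [map_zero]
  | tmul v g => simp only [rightMul_tmul, leftMul_tmul, map_add, mul_assoc]
  | add ζ ξ h1 h2 => simp only [map_add, h1, h2]

variable {Θ : Set (Fin n)}

lemma circVT_twMul {j : ZMod 2} {a : Tq n q} (ha : a ∈ Efun q Θ)
    (hj : dpar a.val = eps j • a.val) {x : Uq n q} (hx : x ∈ Uk q Θ) (ζ : V ⊗[ℂ] Tq n q) :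
    circVT 𝒱 x (twMul 𝒱 j a ζ) = twMul 𝒱 j a (circVT 𝒱 (parTw j x) ζ) := by
  have key : ∀ (i : ZMod 2) (g : Tq n q),
      circT (part n q i x) (a * g) = a * circT (part n q i (parTw j x)) g := fun i g => by
    refine Subtype.ext ?_
    rw [parTw_part]
    exact circ_invariant_mul ha hj (part_mem_Uk i hx) g.val
  induction ζ using TensorProduct.induction_on with
  | zero => simp only [map_zero]
  | tmul v g =>
    rw [twMul_tmul, circVT_tmul, circVT_tmul, map_add, twMul_tmul, twMul_tmul, key, key,
      ← gradeTw_one, ← gradeTw_one, gradeTw_gradeTw, gradeTw_gradeTw, add_comm j]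
  | add ζ ξ h1 h2 => simp only [map_add, h1, h2]

lemma circVT_rightMul {a : Tq n q} (ha : a ∈ Efun q Θ) {x : Uq n q} (hx : x ∈ Uk q Θ)
    (ζ : V ⊗[ℂ] Tq n q) : circVT 𝒱 x (rightMul V a ζ) = rightMul V a (circVT 𝒱 x ζ) := by
  have key : ∀ (i : ZMod 2) (g : Tq n q),
      circT (part n q i x) (g * a) = circT (part n q i x) g * a := fun i g =>
    Subtype.ext (circ_mul_invariant ha (part_mem_Uk i hx) g.val)
  induction ζ using TensorProduct.induction_on with
  | zero => simp only [map_zero]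
  | tmul v g =>
    rw [rightMul_tmul, circVT_tmul, circVT_tmul, map_add, rightMul_tmul, rightMul_tmul, key, key]
  | add ζ ξ h1 h2 => simp only [map_add, h1, h2]

variable [Module (Uk q Θ) V] [IsScalarTower ℂ (Uk q Θ) V]

/-- The operator `S(x) ⊗ id` on `V ⊗ T_q`. -/
noncomputable def antipodeAct (x : Uk q Θ) : V ⊗[ℂ] Tq n q →ₗ[ℂ] V ⊗[ℂ] Tq n q :=
  TensorProduct.map
    (Algebra.lsmul ℂ ℂ V (⟨antipode n q x.val, antipode_mem_Uk x.2⟩ : Uk q Θ)) LinearMap.id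

lemma antipodeAct_tmul (x : Uk q Θ) (v : V) (g : Tq n q) : antipodeAct x (v ⊗ₜ[ℂ] g) =
    ((⟨antipode n q x.val, antipode_mem_Uk x.2⟩ : Uk q Θ) • v) ⊗ₜ[ℂ] g := rfl

lemma mem_Hq {ζ : V ⊗[ℂ] Tq n q} :
    ζ ∈ Hq Θ 𝒱 ↔ ∀ x : Uk q Θ, circVT 𝒱 x.val ζ = antipodeAct x ζ := Iff.rfl

lemma rightMul_antipodeAct (a : Tq n q) (x : Uk q Θ) (ζ : V ⊗[ℂ] Tq n q) :
    rightMul V a (antipodeAct x ζ) = antipodeAct x (rightMul V a ζ) := by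
  induction ζ using TensorProduct.induction_on with
  | zero => simp only [map_zero]
  | tmul v g => simp only [antipodeAct_tmul, rightMul_tmul]
  | add ζ ξ h1 h2 => simp only [map_add, h1, h2]

/-- Right multiplication by invariant functions preserves the space of sections. -/
lemma rightMul_mem_Hq {a : Tq n q} (ha : a ∈ Efun q Θ) {ζ : V ⊗[ℂ] Tq n q} (hζ : ζ ∈ Hq Θ 𝒱) :
    rightMul V a ζ ∈ Hq Θ 𝒱 := fun x => by
  rw [circVT_rightMul 𝒱 ha x.2, (mem_Hq 𝒱).1 hζ x]
  exact rightMul_antipodeAct a x ζ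

/-- The action of `U_q(𝔨)` on `V` is even. -/
lemma gradePar_smul
    (h𝒱 : ∀ (i j : ZMod 2) (x : Uk q Θ) (v : V),
      (x : Uq n q) ∈ grade n q i → v ∈ 𝒱 j → x • v ∈ 𝒱 (i + j)) (x : Uk q Θ) (v : V) :
    gradePar 𝒱 (x • v) = (⟨parity n q x.val, parity_mem_Uk x.2⟩ : Uk q Θ) • gradePar 𝒱 v := by
  have hom : ∀ (i : ZMod 2) (x : Uk q Θ), (x : Uq n q) ∈ grade n q i →
      gradePar 𝒱 (x • v) = eps i • x • gradePar 𝒱 v := fun i x hx => by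
    induction v using DirectSum.Decomposition.inductionOn 𝒱 with
    | zero => simp
    | @homogeneous j v =>
      rw [gradePar_of_mem 𝒱 v.2, gradePar_of_mem 𝒱 (h𝒱 i j x v hx v.2), eps_add, smul_comm x,
        smul_smul]
    | add v w h1 h2 => rw [smul_add, map_add, map_add, h1, h2, smul_add, smul_add]
  let y (i : ZMod 2) : Uk q Θ := ⟨part n q i x.val, part_mem_Uk i x.2⟩
  have hx : x = y 0 + y 1 := Subtype.ext (part_add x.val).symm
  have hp : (⟨parity n q x.val, parity_mem_Uk x.2⟩ : Uk q Θ) = eps 0 • y 0 + eps 1 • y 1 := by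
    refine Subtype.ext ?_
    change parity n q x.val = eps 0 • part n q 0 x.val + eps 1 • part n q 1 x.val
    rw [← parity_part, ← parity_part, ← map_add, part_add]
  rw [hp, hx, add_smul, map_add, hom 0 (y 0) (part_mem 0 _), hom 1 (y 1) (part_mem 1 _), add_smul,
    smul_assoc, smul_assoc]

lemma gradeTw_smul
    (h𝒱 : ∀ (i j : ZMod 2) (x : Uk q Θ) (v : V),
      (x : Uq n q) ∈ grade n q i → v ∈ 𝒱 j → x • v ∈ 𝒱 (i + j))
    (j : ZMod 2) (x : Uk q Θ) (v : V) :
    gradeTw 𝒱 j (x • v) = (⟨parTw j x.val, parTw_mem_Uk j x.2⟩ : Uk q Θ) • gradeTw 𝒱 j v := by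
  obtain rfl | rfl := zmod_two_cases j
  exacts [rfl, gradePar_smul 𝒱 h𝒱 x v]

lemma twMul_antipodeAct
    (h𝒱 : ∀ (i j : ZMod 2) (x : Uk q Θ) (v : V),
      (x : Uq n q) ∈ grade n q i → v ∈ 𝒱 j → x • v ∈ 𝒱 (i + j))
    (j : ZMod 2) (a : Tq n q) (x : Uk q Θ) (ζ : V ⊗[ℂ] Tq n q) :
    twMul 𝒱 j a (antipodeAct ⟨parTw j x.val, parTw_mem_Uk j x.2⟩ ζ) =
      antipodeAct x (twMul 𝒱 j a ζ) := by
  induction ζ using TensorProduct.induction_on with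
  | zero => simp only [map_zero]
  | tmul v g =>
    simp only [antipodeAct_tmul, twMul_tmul, gradeTw_smul 𝒱 h𝒱, antipode_parTw, parTw_parTw]
  | add ζ ξ h1 h2 => simp only [map_add, h1, h2]

/-- Left multiplication by invariant functions preserves the space of sections. -/
lemma leftMul_mem_Hq
    (h𝒱 : ∀ (i j : ZMod 2) (x : Uk q Θ) (v : V),
      (x : Uq n q) ∈ grade n q i → v ∈ 𝒱 j → x • v ∈ 𝒱 (i + j))
    {a : Tq n q} (ha : a ∈ Efun q Θ) {ζ : V ⊗[ℂ] Tq n q} (hζ : ζ ∈ Hq Θ 𝒱) :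
    leftMul 𝒱 a ζ ∈ Hq Θ 𝒱 := by
  have key : ∀ j, twMul 𝒱 j (Tpart j a) ζ ∈ Hq Θ 𝒱 := fun j x => by
    -- The degree `j` of the factor turns `x` into `parTw j x` on passing it, and `S(x)` acting
    -- on `V` picks up the same sign, since the antipode and the action on `V` are even.
    rw [circVT_twMul 𝒱 (Tpart_mem_Efun j ha) (dpar_dpart j a.val) x.2,
      (mem_Hq 𝒱).1 hζ ⟨parTw j x.val, parTw_mem_Uk j x.2⟩]
    exact twMul_antipodeAct 𝒱 h𝒱 j _ x ζ
  rw [leftMul_eq]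
  exact add_mem (key 0) (key 1)

end Sections

end QOsp

theorem theorem3 (n : ℕ) (hn : 1 ≤ n) (q : ℂˣ) (hq : ∀ m : ℕ, 0 < m → q ^ m ≠ 1)
    (Θ : Set (Fin n)) {V : Type*} [AddCommGroup V] [Module ℂ V] [FiniteDimensional ℂ V]
    [Module (QOsp.Uk q Θ) V] [IsScalarTower ℂ (QOsp.Uk q Θ) V]
    (𝒱 : ZMod 2 → Submodule ℂ V) [DirectSum.Decomposition 𝒱]
    (h𝒱 : ∀ (i j : ZMod 2) (x : QOsp.Uk q Θ) (v : V),
      (x : QOsp.Uq n q) ∈ QOsp.grade n q i → v ∈ 𝒱 j → x • v ∈ 𝒱 (i + j)) :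
    (∀ a ∈ QOsp.Efun q Θ, ∀ ζ ∈ QOsp.Hq Θ 𝒱,
      QOsp.leftMul 𝒱 a ζ ∈ QOsp.Hq Θ 𝒱 ∧ QOsp.rightMul V a ζ ∈ QOsp.Hq Θ 𝒱) ∧
    ∃ (L : Module (QOsp.Efun q Θ) (QOsp.Hq Θ 𝒱))
      (R : Module (QOsp.Efun q Θ)ᵐᵒᵖ (QOsp.Hq Θ 𝒱)),
      (∀ (a : QOsp.Efun q Θ) (ζ : QOsp.Hq Θ 𝒱), (L.smul a ζ).val = QOsp.leftMul 𝒱 a.val ζ.val) ∧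
      (∀ (a : QOsp.Efun q Θ) (ζ : QOsp.Hq Θ 𝒱),
        (R.smul (MulOpposite.op a) ζ).val = QOsp.rightMul V a.val ζ.val) ∧
      (∀ (a b : QOsp.Efun q Θ) (ζ : QOsp.Hq Θ 𝒱),
        L.smul a (R.smul (MulOpposite.op b) ζ) = R.smul (MulOpposite.op b) (L.smul a ζ)) := by
  have hL : ∀ (a : QOsp.Efun q Θ) (ζ : QOsp.Hq Θ 𝒱), QOsp.leftMul 𝒱 a.val ζ.val ∈ QOsp.Hq Θ 𝒱 :=
    fun a ζ => QOsp.leftMul_mem_Hq 𝒱 h𝒱 a.2 ζ.2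
  have hR : ∀ (a : QOsp.Efun q Θ) (ζ : QOsp.Hq Θ 𝒱), QOsp.rightMul V a.val ζ.val ∈ QOsp.Hq Θ 𝒱 :=
    fun a ζ => QOsp.rightMul_mem_Hq 𝒱 a.2 ζ.2
  refine ⟨fun a ha ζ hζ => ⟨hL ⟨a, ha⟩ ⟨ζ, hζ⟩, hR ⟨a, ha⟩ ⟨ζ, hζ⟩⟩,
    { smul := fun a ζ => ⟨_, hL a ζ⟩
      one_smul := fun ζ => Subtype.ext (QOsp.leftMul_one 𝒱 ζ.val)
      mul_smul := fun a b ζ => Subtype.ext (QOsp.leftMul_mul 𝒱 a.val b.val ζ.val)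
      smul_zero := fun a => Subtype.ext (map_zero (QOsp.leftMul 𝒱 a.val))
      smul_add := fun a ζ ξ => Subtype.ext (map_add (QOsp.leftMul 𝒱 a.val) ζ.val ξ.val)
      add_smul := fun a b ζ => Subtype.ext (QOsp.leftMul_add 𝒱 a.val b.val ζ.val)
      zero_smul := fun ζ => Subtype.ext (QOsp.leftMul_zero 𝒱 ζ.val) },
    { smul := fun a ζ => ⟨_, hR a.unop ζ⟩
      one_smul := fun ζ => Subtype.ext (QOsp.rightMul_one ζ.val)
      mul_smul := fun a b ζ => Subtype.ext (QOsp.rightMul_mul b.unop.val a.unop.val ζ.val)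
      smul_zero := fun a => Subtype.ext (map_zero (QOsp.rightMul V a.unop.val))
      smul_add := fun a ζ ξ => Subtype.ext (map_add (QOsp.rightMul V a.unop.val) ζ.val ξ.val)
      add_smul := fun a b ζ => Subtype.ext (QOsp.rightMul_add a.unop.val b.unop.val ζ.val)
      zero_smul := fun ζ => Subtype.ext (QOsp.rightMul_zero ζ.val) },
    fun a ζ => rfl, fun a ζ => rfl,
    fun a b ζ => Subtype.ext (QOsp.leftMul_rightMul 𝒱 a.val b.val ζ.val)⟩
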